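/- Let $k$ be an algebraically closed field of characteristic $\neq 2,3$, let $V$ be a 3-dimensional $k$-vector space with basis $x_1,x_2,x_3$ (indices taken in $\mathbb Z/3\mathbb Z$), and for $a,b,c\in k$ let $A=\mathrm{Skl}_3(a,b,c)$ be the quotient of the tensor algebra $T(V)$ by the two-sided ideal generated by $$t_i=a\,x_{i+1}x_{i-1}+b\,x_{i-1}x_{i+1}+c\,x_i^2,\qquad i=1,2,3,$$ with its natural grading. Let $$t^S=3(a+b)x_1x_2x_3+c(x_1^3+x_2^3+x_3^3)\in S(V)=k[x_1,x_2,x_3]$$ be the image in the symmetric algebra of the tensor $t=\sum_i x_it_i$. Assume that $A$ is Artin–Schelter regular (a connected graded algebra of polynomial growth and of finite global dimension $d$ with $\operatorname{Ext}^i_A(k,A)=0$ for $i\ne d$ and $\operatorname{Ext}^d_A(k,A)$ one-dimensional) and that $t^S$ is irreducible. Let $C\subset\mathbb P(V^*)$ be the curve $t^S=0$. Let $\operatorname{Aut}A$ be the group of grading-preserving automorphisms of the algebra $A$, viewed as a subgroup of $GL(V)\cong GL(V^*)$ by restriction to $A_1=V$, and let $G_A$ be its image in $PGL(V^*)$. Let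 $G\subset PGL(V^*)$ be the Hessian group, i.e. the group of all projective linear transformations permuting the nine points $(0:1:-\eta)$, $(-\eta:0:1)$, $(1:-\eta:0)$ with $\eta^3=1$. Let $T\subset PGL(V^*)$ be the subgroup generated by the transformations represented by the operators $x_i\mapsto x_{i+1}$ $(i\in\mathbb Z/3\mathbb Z)$ and $x_1\mapsto\varepsilon x_1,\ x_2\mapsto\varepsilon^2x_2,\ x_3\mapsto x_3$ on $V$, where $\varepsilon$ is a primitive cube root of $1$. Let $G_C=\{g\in PGL(V^*)\mid g(C)=C\}$. Then $C$ is smooth, hence an elliptic curve; $|G|=216$ and $|T|=9$; and $G_A$ is a subgroup of $G$. If $a\neq b$, then $G_A=T$. If $a=b$, then $G_A=G_C$. In the latter case $T\subset G_A$, the $j$-invariant satisfies $j(C)\ne0$, and $$(G_A:T)=\begin{cases}4&\text{if } j(C)=1728,\\ 2&\text{otherwise.}\end{cases}$$ -/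

import Mathlib

open scoped LinearAlgebra.Projectivization MatrixGroups Pointwise

universe u v

/-- Artin-Schelter regularity of dimension `d` of an `ℕ`-graded algebra `A = ⨁ 𝒜 n` over a field
`k`, formulated with left modules. The base field as an `A`-module is the quotient of `A` by the
left ideal generated by all homogeneous elements of positive degree. -/
structure IsArtinSchelterRegularOfDim (k : Type u) [Field k] {A : Type v} [Ring A] [Algebra k A]
    (𝒜 : ℕ → Submodule k A) (d : ℕ) : Prop where
  /-- The subspaces `𝒜 n` form an algebra grading of `A`. -/
  gradedMonoid : SetLike.GradedMonoid 𝒜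
  isInternal : DirectSum.IsInternal 𝒜
  /-- `A` is connected: the degree 0 component is the base field. -/
  connected : Module.finrank k (𝒜 0) = 1
  /-- `A` has polynomial growth. -/
  finite : ∀ n, Module.Finite k (𝒜 n)
  growth : ∃ C e : ℕ, ∀ n, Module.finrank k (𝒜 n) ≤ C * (n + 1) ^ e
  /-- `A` has global dimension at most `d` (and exactly `d`, in view of the last condition). -/
  globalDim : ∀ M : ModuleCat.{v} A, CategoryTheory.HasProjectiveDimensionLE M d
  /-- `A` is Gorenstein: `Ext_A^i(k, A)` is `0` for `i ≠ d` and one-dimensional for `i = d`. -/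
  ext_eq_zero : ∀ i, i ≠ d → Subsingleton (CategoryTheory.Abelian.Ext
    (ModuleCat.of A (A ⧸ Submodule.span A {x : A | ∃ n, 0 < n ∧ x ∈ 𝒜 n})) (ModuleCat.of A A) i)
  finrank_ext : Module.finrank k (CategoryTheory.Abelian.Ext
    (ModuleCat.of A (A ⧸ Submodule.span A {x : A | ∃ n, 0 < n ∧ x ∈ 𝒜 n})) (ModuleCat.of A A) d) = 1

/-- Artin-Schelter regularity of a graded algebra. -/
def IsArtinSchelterRegular (k : Type u) [Field k] {A : Type v} [Ring A] [Algebra k A]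
    (𝒜 : ℕ → Submodule k A) : Prop :=
  ∃ d, IsArtinSchelterRegularOfDim k 𝒜 d

namespace Skl

noncomputable section

variable {k : Type u} [Field k]

/-- The basis `x_i` of `V = k³`, indexed by `Fin 3 = ℤ/3ℤ` (so that `x_3` is `x 0`). -/
def x (i : Fin 3) : Fin 3 → k := Pi.single i 1

/-- The generators `x_i` as elements of the tensor algebra of `V`. -/
def X (i : Fin 3) : TensorAlgebra k (Fin 3 → k) := TensorAlgebra.ι k (x i)

/-- The defining relations `t_i = a x_{i+1} x_{i-1} + b x_{i-1} x_{i+1} + c x_i²`. -/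
def relTensor (a b c : k) (i : Fin 3) : TensorAlgebra k (Fin 3 → k) :=
  a • (X (i + 1) * X (i - 1)) + b • (X (i - 1) * X (i + 1)) + c • (X i * X i)

/-- The algebra `Skl_3(a,b,c)`: the tensor algebra of `V` modulo the two-sided ideal generated by
`t_1, t_2, t_3`. -/
abbrev Alg (a b c : k) : Type u :=
  RingQuot (fun s s₀ : TensorAlgebra k (Fin 3 → k) => ∃ i, s = relTensor a b c i ∧ s₀ = 0)

/-- The projection of the tensor algebra onto `Skl_3(a,b,c)`. -/
def proj (a b c : k) : TensorAlgebra k (Fin 3 → k) →ₐ[k] Alg a b c :=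
  RingQuot.mkAlgHom k _

/-- The canonical map from `V` to `Skl_3(a,b,c)`. -/
def gen (a b c : k) : (Fin 3 → k) →ₗ[k] Alg a b c :=
  (proj a b c).toLinearMap ∘ₗ TensorAlgebra.ι k

/-- The homogeneous component of degree `n`: the image of `V^{⊗ n}`. -/
def grading (a b c : k) (n : ℕ) : Submodule k (Alg a b c) :=
  (LinearMap.range (TensorAlgebra.ι k : (Fin 3 → k) →ₗ[k] _) ^ n).map (proj a b c).toLinearMap

/-- The group of automorphisms of the algebra `Skl_3(a,b,c)` preserving the grading. -/
def gradedAut (a b c : k) : Subgroup (Alg a b c ≃ₐ[k] Alg a b c) where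
  carrier := {φ | ∀ n, (grading a b c n).map φ.toLinearMap = grading a b c n}
  one_mem' n := by
    ext y
    simp
  mul_mem' {φ ψ} hφ hψ n := by
    have h : (φ * ψ).toLinearMap = φ.toLinearMap ∘ₗ ψ.toLinearMap := rfl
    rw [h, Submodule.map_comp, hψ n, hφ n]
  inv_mem' {φ} hφ n := by
    have h : (φ⁻¹).toLinearMap ∘ₗ φ.toLinearMap = LinearMap.id := by
      ext y
      exact φ.symm_apply_apply y
    conv_lhs => rw [← hφ n]
    rw [← Submodule.map_comp, h, Submodule.map_id]

/-- The group of graded automorphisms viewed as a subgroup of `GL(V)`: all invertible operators on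
`V` which extend to a graded automorphism of `Skl_3(a,b,c)`. -/
def autGL (a b c : k) : Subgroup (GL (Fin 3) k) where
  carrier := {M | ∃ φ ∈ gradedAut a b c, ∀ w, φ (gen a b c w) = gen a b c (M.val.mulVec w)}
  one_mem' := ⟨1, one_mem _, fun w => by simp⟩
  mul_mem' := by
    rintro M N ⟨φ, hφ, h⟩ ⟨ψ, hψ, h'⟩
    refine ⟨φ * ψ, mul_mem hφ hψ, fun w => ?_⟩
    rw [AlgEquiv.mul_apply, h', h, Units.val_mul, Matrix.mulVec_mulVec]
  inv_mem' := by
    rintro M ⟨φ, hφ, h⟩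
    refine ⟨φ⁻¹, inv_mem hφ, fun w => ?_⟩
    have h1 := h ((M⁻¹).val.mulVec w)
    rw [Matrix.mulVec_mulVec, ← Units.val_mul, mul_inv_cancel, Units.val_one,
      Matrix.one_mulVec] at h1
    rw [← h1]
    exact φ.symm_apply_apply _

/-- The canonical isomorphism `GL(V) → GL(V*)`, `θ ↦ (p ↦ p ∘ θ⁻¹)`, in terms of matrices with
respect to the basis `x_i` and the dual basis. -/
def contragredient : GL (Fin 3) k →* GL (Fin 3) k where
  toFun M :=
    { val := (M⁻¹).val.transpose
      inv := M.val.transpose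
      val_inv := by rw [← Matrix.transpose_mul, ← Units.val_mul]; simp
      inv_val := by rw [← Matrix.transpose_mul, ← Units.val_mul]; simp }
  map_one' := by
    apply Units.ext
    change ((1 : GL (Fin 3) k)⁻¹).val.transpose = 1
    rw [inv_one, Units.val_one, Matrix.transpose_one]
  map_mul' M N := by
    apply Units.ext
    change ((M * N)⁻¹).val.transpose = (M⁻¹).val.transpose * (N⁻¹).val.transpose
    rw [mul_inv_rev, Units.val_mul, Matrix.transpose_mul]

/-- The map `GL(V) ≅ GL(V*) → PGL(V*)`. Here `V*` is identified with `k³` by means of the dual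
basis: a linear form `p` on `V` has coordinates `p(x_i)`. -/
def toPGLDual : GL (Fin 3) k →* PGL(3, k) :=
  Matrix.ProjGenLinGroup.mk.comp contragredient

/-- The group `G_A`: the image of the graded automorphism group of `Skl_3(a,b,c)` in `PGL(V*)`. -/
def imageAut (a b c : k) : Subgroup PGL(3, k) :=
  (autGL a b c).map toPGLDual

/-- The tensor
`t = ∑ (a x_{i-1} x_i x_{i+1} + b x_{i+1} x_i x_{i-1} + c x_i³)`. -/
def tensor (a b c : k) : TensorAlgebra k (Fin 3 → k) :=
  ∑ i : Fin 3, (a • (X (i - 1) * X i * X (i + 1)) + b • (X (i + 1) * X i * X (i - 1)) +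
    c • (X i * X i * X i))

/-- The projection of the tensor algebra of `V` onto the symmetric algebra
`S(V) = k[x_1, x_2, x_3]`. -/
def toSym : TensorAlgebra k (Fin 3 → k) →ₐ[k] MvPolynomial (Fin 3) k :=
  TensorAlgebra.lift k (Fintype.linearCombination k MvPolynomial.X)

/-- The cubic polynomial `t^S`: the image of the tensor `t` in the symmetric algebra. -/
def cubic (a b c : k) : MvPolynomial (Fin 3) k := toSym (tensor a b c)

open MvPolynomial in
theorem cubic_eq (a b c : k) : cubic a b c =
    C (3 * (a + b)) * (.X 0 * .X 1 * .X 2) + C c * (.X 0 ^ 3 + .X 1 ^ 3 + .X 2 ^ 3) := by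
  have hX : ∀ i : Fin 3, toSym (X i : TensorAlgebra k (Fin 3 → k)) = .X i := by
    intro i
    simp [toSym, X, x, Fintype.linearCombination_apply_single]
  have e1 : (0 : Fin 3) - 1 = 2 := rfl
  have e2 : (1 : Fin 3) + 1 = 2 := rfl
  have e3 : (2 : Fin 3) - 1 = 1 := rfl
  have e4 : (2 : Fin 3) + 1 = 0 := rfl
  simp only [cubic, tensor, Fin.sum_univ_three, map_add, map_smul, map_mul, hX, e1, e2, e3, e4,
    zero_add, sub_self, MvPolynomial.smul_eq_C_mul, map_ofNat]
  ring

/-- The curve in `ℙ(V*)` defined by the equation `f = 0` for a homogeneous polynomial `f`. -/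
def curve (f : MvPolynomial (Fin 3) k) : Set (ℙ k (Fin 3 → k)) :=
  {P | MvPolynomial.eval P.rep f = 0}

/-- For a homogeneous polynomial the choice of homogeneous coordinates does not matter. -/
theorem mk_mem_curve {f : MvPolynomial (Fin 3) k} {n : ℕ} (hf : f.IsHomogeneous n)
    {w : Fin 3 → k} (hw : w ≠ 0) :
    Projectivization.mk k w hw ∈ curve f ↔ MvPolynomial.eval w f = 0 := by
  obtain ⟨s, hs⟩ := Projectivization.exists_smul_eq_mk_rep k w hw
  have h : MvPolynomial.eval ((s : k) • w) f = (s : k) ^ n * MvPolynomial.eval w f := by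
    rw [MvPolynomial.eval_eq, MvPolynomial.eval_eq, Finset.mul_sum]
    refine Finset.sum_congr rfl fun d hd => ?_
    have hdeg : ∑ i ∈ d.support, d i = n := by
      have h0 := hf (MvPolynomial.mem_support_iff.mp hd)
      rw [Finsupp.weight_apply] at h0
      simpa [Finsupp.sum] using h0
    simp only [Pi.smul_apply, smul_eq_mul, mul_pow, Finset.prod_mul_distrib,
      Finset.prod_pow_eq_pow_sum, hdeg]
    ring
  rw [curve, Set.mem_ofPred_eq, ← hs, Units.smul_def, h]
  simp

/-- `f` is a ternary cubic form defining a smooth (hence elliptic) plane curve. -/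
def IsSmoothCubic (f : MvPolynomial (Fin 3) k) : Prop :=
  f.IsHomogeneous 3 ∧ ∀ w : Fin 3 → k, w ≠ 0 → MvPolynomial.eval w f = 0 →
    ∃ i, MvPolynomial.eval w (MvPolynomial.pderiv i f) ≠ 0

/-- `j` is the `j`-invariant of the plane curve `C`: some projective linear transformation takes
`C` to an elliptic curve in Weierstrass form with `j`-invariant `j`. -/
def IsJInvariant (C : Set (ℙ k (Fin 3 → k))) (j : k) : Prop :=
  ∃ (W : WeierstrassCurve k) (_ : W.IsElliptic) (g : PGL(3, k)),
    g • C = curve W.toProjective.polynomial ∧ W.j = j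

/-- The vector with coordinates `1` and `-η` in places `i + 1` and `i - 1`, and `0` in place `i`. -/
def flexVec (i : Fin 3) (η : k) : Fin 3 → k := x (i + 1) - η • x (i - 1)

/-- The 9 points `(0 : 1 : -η)`, `(-η : 0 : 1)`, `(1 : -η : 0)` with `η³ = 1`. -/
def flexes (k : Type u) [Field k] : Set (ℙ k (Fin 3 → k)) :=
  {P | ∃ (i : Fin 3) (η : k), η ^ 3 = 1 ∧ ∃ h : flexVec i η ≠ 0,
    P = Projectivization.mk k (flexVec i η) h}

/-- The Hessian group `G`: all projective linear transformations permuting the 9 points. -/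
def hessianGroup (k : Type u) [Field k] : Subgroup PGL(3, k) :=
  MulAction.stabilizer PGL(3, k) (flexes k)

/-- The group `G_C` of all projective linear transformations `g` with `g(C) = C`. -/
def curveStabilizer (C : Set (ℙ k (Fin 3 → k))) : Subgroup PGL(3, k) :=
  MulAction.stabilizer PGL(3, k) C

/-- The subgroup of translations `T`, generated by the transformations represented by the operators
`x_i ↦ x_{i+1}` and `x_1 ↦ ε x_1, x_2 ↦ ε² x_2, x_3 ↦ x_3` on `V`, where `ε` is a primitive cube
root of 1 (the two choices of `ε` give the same subgroup). -/
def translations (k : Type u) [Field k] : Subgroup PGL(3, k) :=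
  Subgroup.closure (toPGLDual ''
    ({M | ∀ i, M.val.mulVec (x i) = x (i + 1)} ∪
     {M | ∃ ε : k, IsPrimitiveRoot ε 3 ∧ ∀ i, M.val.mulVec (x i) = ε ^ (i : ℕ) • x i}))

end

end Skl

/-! Write `μ = (a + b) / c`. Irreducibility of `t^S` gives `c ≠ 0` and `1 + μ³ ≠ 0`, so `C` is the
smooth member of the Hesse pencil with parameter `μ`.

Automorphisms are governed by the cyclically invariant tensor `t = ∑ x_i t_i`. A graded automorphism
`θ` preserves the span of the `t_i`, so it maps `t` into `V ⊗ span(t_i)`. Comparing coefficients and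
using cyclic invariance forces `θ^{⊗3} t = ν t` (`tensorMap_eq_smul_of_mem_autGL`), unless `a = b =
0` or `a = b`, `a³ = c³`. In those two cases a linear change of variables turns the relations into
combinations of squares, and the algebra contains enough free words to grow exponentially, against
regularity. Conversely every invertible `θ` with `θ^{⊗3} t = ν t`, `ν ≠ 0`, extends to an
automorphism.

Projecting to the symmetric algebra shows `G_A ≤ G_C`. If `a = b`, then `t` is symmetric, hence
determined by `t^S`, and `G_A = G_C`. If `a ≠ b`, the antisymmetric part of `t` is nonzero, which
forces `det θ = ν`.

This suggests the character `χ = ν / det` on the similitudes of the Hesse cubic (`multiplierChar`),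
which descends to `G_C`. Moving the flex `(0 : 1 : -1)` to infinity gives `Y²Z = X³ + AXZ² + BZ³`.
The stabilizer of the flex becomes the group of maps `diag(u², u³, 1)` with `Au⁴ = A`, `Bu⁶ = B`,
and there `χ = u⁶ / u⁵ = u`. Since `T` lies in the kernel of `χ` and acts simply transitively on the
nine flexes, `T = ker χ` (`mk_mem_translations_iff`). Thus `G_A = T` for `a ≠ b`, and `(G_C : T)` is
the number of admissible `u`. Finally `j(C) = 0` means `μ(μ³ - 8) = 0`, which for `μ = 2a / c` is
exactly the case excluded by growth.

For `|G| = 216`, the Fermat cubic has stabilizer of order `9 · 6`, and its `G`-orbit consists of the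
four members of the pencil with `j = 0`. -/

namespace Skl

noncomputable section

variable {k : Type u} [Field k]

/-! ### Ternary cubic forms and tensors of degree 3. -/

section CubicForms

/-- The cubic form `x³ + y³ + z³ + 3μxyz` of the Hesse pencil. -/
def hesse (μ : k) (w : Fin 3 → k) : k :=
  w 0 ^ 3 + w 1 ^ 3 + w 2 ^ 3 + 3 * μ * (w 0 * w 1 * w 2)

/-- The function given by a ternary cubic form. -/
def IsCubicForm (F : (Fin 3 → k) → k) : Prop :=
  ∃ t : Fin 3 → Fin 3 → Fin 3 → k, ∀ w, F w = ∑ i, ∑ j, ∑ l, t i j l * (w i * w j * w l)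

theorem isCubicForm_of_coeffs {F : (Fin 3 → k) → k} (a₁ a₂ a₃ a₄ a₅ a₆ a₇ a₈ a₉ a₁₀ : k)
    (h : ∀ w, F w =
      a₁ * w 0 ^ 3 + a₂ * w 1 ^ 3 + a₃ * w 2 ^ 3 + a₄ * (w 0 ^ 2 * w 1) + a₅ * (w 0 ^ 2 * w 2) +
        a₆ * (w 1 ^ 2 * w 0) + a₇ * (w 1 ^ 2 * w 2) + a₈ * (w 2 ^ 2 * w 0) +
        a₉ * (w 2 ^ 2 * w 1) + a₁₀ * (w 0 * w 1 * w 2)) : IsCubicForm F := by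
  refine ⟨![![![a₁, a₄, a₅], ![0, 0, a₁₀], 0], ![0, ![a₆, a₂, a₇], 0],
    ![0, 0, ![a₈, a₉, a₃]]], fun w => ?_⟩
  rw [h]
  simp [Fin.sum_univ_three]
  ring

theorem IsCubicForm.exists_coeffs {F : (Fin 3 → k) → k} (hF : IsCubicForm F) :
    ∃ a₁ a₂ a₃ a₄ a₅ a₆ a₇ a₈ a₉ a₁₀ : k, ∀ w, F w =
      a₁ * w 0 ^ 3 + a₂ * w 1 ^ 3 + a₃ * w 2 ^ 3 + a₄ * (w 0 ^ 2 * w 1) + a₅ * (w 0 ^ 2 * w 2) +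
        a₆ * (w 1 ^ 2 * w 0) + a₇ * (w 1 ^ 2 * w 2) + a₈ * (w 2 ^ 2 * w 0) +
        a₉ * (w 2 ^ 2 * w 1) + a₁₀ * (w 0 * w 1 * w 2) := by
  obtain ⟨t, h⟩ := hF
  use t 0 0 0, t 1 1 1, t 2 2 2, t 0 0 1 + t 0 1 0 + t 1 0 0, t 0 0 2 + t 0 2 0 + t 2 0 0,
    t 1 1 0 + t 1 0 1 + t 0 1 1, t 1 1 2 + t 1 2 1 + t 2 1 1, t 2 2 0 + t 2 0 2 + t 0 2 2,
    t 2 2 1 + t 2 1 2 + t 1 2 2, t 0 1 2 + t 0 2 1 + t 1 0 2 + t 1 2 0 + t 2 0 1 + t 2 1 0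
  intro w
  rw [h]
  simp only [Fin.sum_univ_three]
  ring

theorem mulVec_three (M : Matrix (Fin 3) (Fin 3) k) (w : Fin 3 → k) (i : Fin 3) :
    M.mulVec w i = M i 0 * w 0 + M i 1 * w 1 + M i 2 * w 2 := by
  simp [Matrix.mulVec, dotProduct, Fin.sum_univ_three]

/-- The action of a linear operator on tensors of degree 3. -/
def tensorMap (M : Matrix (Fin 3) (Fin 3) k) (t : Fin 3 → Fin 3 → Fin 3 → k) :
    Fin 3 → Fin 3 → Fin 3 → k :=
  fun i j l => ∑ i', ∑ j', ∑ l', M i i' * M j j' * M l l' * t i' j' l'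

/-- The cubic form defined by a tensor of degree 3. -/
def tensorForm (t : Fin 3 → Fin 3 → Fin 3 → k) (w : Fin 3 → k) : k :=
  ∑ i, ∑ j, ∑ l, t i j l * (w i * w j * w l)

/-- A tensor over `V` gives a function on `V*`, so an operator on the tensor acts on the argument by
its transpose. -/
theorem tensorForm_mulVec (M : Matrix (Fin 3) (Fin 3) k) (t : Fin 3 → Fin 3 → Fin 3 → k)
    (w : Fin 3 → k) : tensorForm t (M.transpose.mulVec w) = tensorForm (tensorMap M t) w := by
  simp only [tensorForm, tensorMap, mulVec_three, Fin.sum_univ_three, Matrix.transpose_apply]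
  ring

theorem IsCubicForm.comp_mulVec {F : (Fin 3 → k) → k} (hF : IsCubicForm F)
    (M : Matrix (Fin 3) (Fin 3) k) : IsCubicForm fun w => F (M.mulVec w) := by
  obtain ⟨t, h⟩ := hF
  refine ⟨tensorMap M.transpose t, fun w => (h _).trans ?_⟩
  exact tensorForm_mulVec M.transpose t w

theorem isCubicForm_hesse (μ : k) : IsCubicForm (hesse μ) :=
  isCubicForm_of_coeffs 1 1 1 0 0 0 0 0 0 (3 * μ) fun w => by
    rw [hesse]
    ring

theorem IsCubicForm.map_smul {F : (Fin 3 → k) → k} (hF : IsCubicForm F) (s : k) (w : Fin 3 → k) :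
    F (s • w) = s ^ 3 * F w := by
  obtain ⟨t, h⟩ := hF
  simp only [h, Finset.mul_sum, Pi.smul_apply, smul_eq_mul]
  refine Finset.sum_congr rfl fun i _ => Finset.sum_congr rfl fun j _ =>
    Finset.sum_congr rfl fun l _ => ?_
  ring

theorem IsCubicForm.map_zero {F : (Fin 3 → k) → k} (hF : IsCubicForm F) : F 0 = 0 := by
  simpa using hF.map_smul 0 0

theorem hesse_smul (μ s : k) (w : Fin 3 → k) : hesse μ (s • w) = s ^ 3 * hesse μ w :=
  (isCubicForm_hesse μ).map_smul s w

theorem hesse_zero (μ : k) : hesse μ 0 = 0 := (isCubicForm_hesse μ).map_zero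

theorem eval_cubic (a b c : k) (w : Fin 3 → k) : MvPolynomial.eval w (cubic a b c) =
    3 * (a + b) * (w 0 * w 1 * w 2) + c * (w 0 ^ 3 + w 1 ^ 3 + w 2 ^ 3) := by
  simp [cubic_eq]

theorem eval_cubic_eq_hesse {a b c : k} (hc : c ≠ 0) (w : Fin 3 → k) :
    MvPolynomial.eval w (cubic a b c) = c * hesse ((a + b) / c) w := by
  rw [eval_cubic, hesse]
  field_simp
  ring

theorem isHomogeneous_cubic (a b c : k) : (cubic a b c).IsHomogeneous 3 := by
  rw [cubic_eq]
  have h0 := fun i : Fin 3 => MvPolynomial.isHomogeneous_X k i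
  have hp := fun i : Fin 3 => (h0 i).pow 3
  have h1 := (MvPolynomial.isHomogeneous_C (Fin 3) (3 * (a + b))).mul (((h0 0).mul (h0 1)).mul (h0 2))
  have h2 := (MvPolynomial.isHomogeneous_C (Fin 3) c).mul (((hp 0).add (hp 1)).add (hp 2))
  exact h1.add h2

end CubicForms

/-! ### Projective maps between plane curves, in homogeneous coordinates. -/

section Curves

theorem units_smul_eq_mulVec (M : GL (Fin 3) k) (w : Fin 3 → k) : M • w = M.val.mulVec w := rfl

theorem mulVec_ne_zero (M : GL (Fin 3) k) {w : Fin 3 → k} (hw : w ≠ 0) : M.val.mulVec w ≠ 0 :=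
  (smul_ne_zero_iff_ne M).mpr hw

theorem mulVec_inv_mulVec (M : GL (Fin 3) k) (w : Fin 3 → k) :
    M.val.mulVec ((M⁻¹).val.mulVec w) = w := by
  rw [Matrix.mulVec_mulVec, ← Units.val_mul, mul_inv_cancel, Units.val_one, Matrix.one_mulVec]

theorem inv_mulVec_mulVec (M : GL (Fin 3) k) (w : Fin 3 → k) :
    (M⁻¹).val.mulVec (M.val.mulVec w) = w := by
  rw [Matrix.mulVec_mulVec, ← Units.val_mul, inv_mul_cancel, Units.val_one, Matrix.one_mulVec]

theorem smul_eq_iff_forall_mk {S S' : Set (ℙ k (Fin 3 → k))} (M : GL (Fin 3) k) :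
    (Matrix.ProjGenLinGroup.mk M : PGL(3, k)) • S = S' ↔ ∀ (w : Fin 3 → k) (hw : w ≠ 0),
      Projectivization.mk k w hw ∈ S ↔
        Projectivization.mk k (M.val.mulVec w) (mulVec_ne_zero M hw) ∈ S' := by
  constructor
  · rintro rfl w hw
    rw [← Set.smul_mem_smul_set_iff (a := (Matrix.ProjGenLinGroup.mk M : PGL(3, k)))]
    rfl
  · intro h
    ext P
    induction P using Projectivization.ind with
    | h w hw =>
      rw [Set.mem_smul_set_iff_inv_smul_mem, ← map_inv, Projectivization.PGL.mk_smul_mk]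
      rw [h _ (by rw [units_smul_eq_mulVec]; exact mulVec_ne_zero _ hw)]
      simp only [units_smul_eq_mulVec, mulVec_inv_mulVec]

theorem smul_curve_eq_iff {F F' : MvPolynomial (Fin 3) k} {n : ℕ} (hn : n ≠ 0)
    (hF : F.IsHomogeneous n) (hF' : F'.IsHomogeneous n) (M : GL (Fin 3) k) :
    (Matrix.ProjGenLinGroup.mk M : PGL(3, k)) • curve F = curve F' ↔
      ∀ w, MvPolynomial.eval w F = 0 ↔ MvPolynomial.eval (M.val.mulVec w) F' = 0 := by
  rw [smul_eq_iff_forall_mk]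
  constructor
  · intro h w
    by_cases hw : w = 0
    · subst hw
      have h0 : ∀ G : MvPolynomial (Fin 3) k, G.IsHomogeneous n → MvPolynomial.eval 0 G = 0 := by
        intro G hG
        rw [MvPolynomial.eval_zero, MvPolynomial.constantCoeff_eq]
        exact hG.coeff_eq_zero (by simpa using hn.symm)
      rw [Matrix.mulVec_zero, h0 F hF, h0 F' hF']
    · have := h w hw
      rwa [mk_mem_curve hF, mk_mem_curve hF'] at this
  · intro h w hw
    rw [mk_mem_curve hF, mk_mem_curve hF']
    exact h w

/-- The curve defined by a member of the Hesse pencil. -/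
def hesseCurve (μ : k) : Set (ℙ k (Fin 3 → k)) := curve (cubic μ 0 1)

theorem eval_cubic_one (μ : k) (w : Fin 3 → k) :
    MvPolynomial.eval w (cubic μ 0 1) = hesse μ w := by
  rw [eval_cubic_eq_hesse one_ne_zero]
  simp

theorem mk_mem_hesseCurve {μ : k} {w : Fin 3 → k} (hw : w ≠ 0) :
    Projectivization.mk k w hw ∈ hesseCurve μ ↔ hesse μ w = 0 := by
  rw [hesseCurve, mk_mem_curve (isHomogeneous_cubic _ _ _), eval_cubic_one]

theorem curve_cubic_eq_hesseCurve {a b c : k} (hc : c ≠ 0) :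
    curve (cubic a b c) = hesseCurve ((a + b) / c) := by
  ext P
  simp only [hesseCurve, curve, Set.mem_ofPred_eq, eval_cubic_eq_hesse hc, eval_cubic_one,
    mul_eq_zero, hc, false_or]

theorem smul_hesseCurve_eq_iff {μ μ' : k} (M : GL (Fin 3) k) :
    (Matrix.ProjGenLinGroup.mk M : PGL(3, k)) • hesseCurve μ = hesseCurve μ' ↔
      ∀ w, hesse μ w = 0 ↔ hesse μ' (M.val.mulVec w) = 0 := by
  rw [hesseCurve, hesseCurve,
    smul_curve_eq_iff three_ne_zero (isHomogeneous_cubic _ _ _) (isHomogeneous_cubic _ _ _)]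
  simp only [eval_cubic_one]

end Curves

/-! ### Irreducibility and smoothness of the cubic. -/

section Smoothness

open MvPolynomial in
theorem not_isUnit_of_eval_zero {p : MvPolynomial (Fin 3) k} (h : eval 0 p = 0) : ¬IsUnit p := by
  intro hp
  have := hp.map (eval (0 : Fin 3 → k))
  rw [h] at this
  exact not_isUnit_zero this

open MvPolynomial in
theorem ne_zero_of_irreducible_cubic {a b c : k} (h : Irreducible (cubic a b c)) : c ≠ 0 := by
  rintro rfl
  rw [cubic_eq, C_0, zero_mul, add_zero] at h
  have e : C (3 * (a + b)) * (.X 0 * .X 1 * .X 2) =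
      (.X 0 * (C (3 * (a + b)) * (.X 1 * .X 2)) : MvPolynomial (Fin 3) k) := by ring
  rw [e] at h
  rcases h.isUnit_or_isUnit rfl with h' | h'
  · exact not_isUnit_of_eval_zero (by simp) h'
  · exact not_isUnit_of_eval_zero (by simp) h'

theorem mul_sum_cubes_factor {R : Type*} [CommRing R] (x y z c η : R) (h : η ^ 3 = 1) :
    3 * -(c * η) * (x * y * z) + c * (x ^ 3 + y ^ 3 + z ^ 3) = (x + y + η * z) *
      (c * (x ^ 2 + y ^ 2 + η ^ 2 * z ^ 2 - x * y - η * x * z - η * y * z)) := by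
  linear_combination (-c * z ^ 3) * h

open MvPolynomial in
-- If the sum vanished, `-(a + b) / c` would be a cube root of unity `η`, and the cubic would have
-- the linear factor `x + y + ηz`.
theorem pow_add_pow_ne_zero_of_irreducible_cubic {a b c : k} (h : Irreducible (cubic a b c)) :
    (a + b) ^ 3 + c ^ 3 ≠ 0 := by
  intro h0
  have hc := ne_zero_of_irreducible_cubic h
  obtain ⟨η, hη⟩ : ∃ η, a + b = -(c * η) := ⟨-(a + b) / c, by field_simp⟩
  have h1 : η ^ 3 = 1 := by
    apply mul_left_cancel₀ (pow_ne_zero 3 hc)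
    rw [hη] at h0
    linear_combination -h0
  have h1' : (C η ^ 3 : MvPolynomial (Fin 3) k) = 1 := by rw [← C_pow, h1, C_1]
  have h3 : (C 3 : MvPolynomial (Fin 3) k) = 3 := map_ofNat C 3
  have e := mul_sum_cubes_factor (.X 0) (.X 1) (.X 2) (C c) (C η) h1'
  rw [← C_mul, ← C_neg, ← hη, ← h3, ← C_mul, ← cubic_eq] at e
  rcases h.isUnit_or_isUnit e with h' | h'
  · refine not_isUnit_of_eval_zero ?_ h'
    simp only [map_add, map_mul, eval_X, Pi.zero_apply, mul_zero, add_zero]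
  · refine not_isUnit_of_eval_zero ?_ h'
    simp only [map_add, map_sub, map_mul, map_pow, eval_X, Pi.zero_apply, mul_zero, add_zero,
      sub_zero, ne_eq, OfNat.ofNat_ne_zero, not_false_eq_true, zero_pow]

theorem isSmoothCubic_cubic (h3 : (3 : k) ≠ 0) {a b c : k} (hc : c ≠ 0)
    (h : (a + b) ^ 3 + c ^ 3 ≠ 0) : IsSmoothCubic (cubic a b c) := by
  refine ⟨isHomogeneous_cubic a b c, fun w hw _ => ?_⟩
  by_contra! hcon
  have hd : ∀ s : k, ∀ i, (MvPolynomial.eval w) (MvPolynomial.pderiv i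
      (MvPolynomial.C s * (.X 0 * .X 1 * .X 2) + MvPolynomial.C c * (.X 0 ^ 3 + .X 1 ^ 3 + .X 2 ^ 3)))
      = s * (w (i + 1) * w (i + 2)) + 3 * (c * w i ^ 2) := by
    intro s i
    simp only [map_add, MvPolynomial.pderiv_mul, MvPolynomial.pderiv_C, MvPolynomial.pderiv_X,
      MvPolynomial.pderiv_pow, map_mul, MvPolynomial.eval_X, map_pow]
    fin_cases i <;> simp <;> ring
  simp only [cubic_eq, hd] at hcon
  have e0 : 3 * (a + b) * (w 1 * w 2) + 3 * (c * w 0 ^ 2) = 0 := hcon 0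
  have e1 : 3 * (a + b) * (w 2 * w 0) + 3 * (c * w 1 ^ 2) = 0 := hcon 1
  have e2 : 3 * (a + b) * (w 0 * w 1) + 3 * (c * w 2 ^ 2) = 0 := hcon 2
  have f0 : c * w 0 ^ 2 = -((a + b) * (w 1 * w 2)) := by
    apply mul_left_cancel₀ h3
    linear_combination e0
  have f1 : c * w 1 ^ 2 = -((a + b) * (w 0 * w 2)) := by
    apply mul_left_cancel₀ h3
    linear_combination e1
  have f2 : c * w 2 ^ 2 = -((a + b) * (w 0 * w 1)) := by
    apply mul_left_cancel₀ h3
    linear_combination e2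
  -- Multiplying the three equations of a singular point shows that one coordinate vanishes; each
  -- equation then kills its own coordinate.
  have hprod : ((a + b) ^ 3 + c ^ 3) * (w 0 * w 1 * w 2) ^ 2 = 0 := by
    have : c * w 0 ^ 2 * (c * w 1 ^ 2) * (c * w 2 ^ 2) = -((a + b) * (w 1 * w 2)) *
        -((a + b) * (w 0 * w 2)) * -((a + b) * (w 0 * w 1)) := by rw [f0, f1, f2]
    linear_combination this
  have hq : w 0 * w 1 * w 2 = 0 := by
    rcases mul_eq_zero.mp hprod with h' | h'
    · exact absurd h' h
    · exact pow_eq_zero_iff two_ne_zero |>.mp h'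
  have g0 : w 0 = 0 := by
    have : c * w 0 ^ 3 = 0 := by linear_combination w 0 * f0 - (a + b) * hq
    simpa [hc] using this
  have g1 : w 1 = 0 := by
    have : c * w 1 ^ 3 = 0 := by linear_combination w 1 * f1 - (a + b) * hq
    simpa [hc] using this
  have g2 : w 2 = 0 := by
    have : c * w 2 ^ 3 = 0 := by linear_combination w 2 * f2 - (a + b) * hq
    simpa [hc] using this
  apply hw
  ext i
  fin_cases i <;> assumption

end Smoothness

/-! ### Cube roots of unity. -/

section RootsOfUnity

theorem exists_sq_add_self_add_one [IsAlgClosed k] (h2 : (2 : k) ≠ 0) :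
    ∃ ε : k, ε ^ 2 + ε + 1 = 0 := by
  obtain ⟨s, hs⟩ := IsAlgClosed.exists_pow_nat_eq (-3 : k) two_pos
  refine ⟨(-1 + s) / 2, ?_⟩
  field_simp
  linear_combination hs

theorem cube_eq_one_of_sq_add_self_add_one {ε : k} (h : ε ^ 2 + ε + 1 = 0) : ε ^ 3 = 1 := by
  linear_combination (ε - 1) * h

theorem cube_eq_one_iff {ε : k} (h : ε ^ 2 + ε + 1 = 0) (η : k) :
    η ^ 3 = 1 ↔ η = 1 ∨ η = ε ∨ η = ε ^ 2 := by
  have e : η ^ 3 - 1 = (η - 1) * ((η - ε) * (η - ε ^ 2)) := by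
    linear_combination (η - 1) * (η - ε + 1) * h
  rw [← sub_eq_zero, e, mul_eq_zero, mul_eq_zero, sub_eq_zero, sub_eq_zero, sub_eq_zero]

theorem ne_one_of_sq_add_self_add_one (h3 : (3 : k) ≠ 0) {ε : k} (h : ε ^ 2 + ε + 1 = 0) :
    ε ≠ 1 := by
  rintro rfl
  apply h3
  linear_combination h

end RootsOfUnity

/-! ### The nine flexes of the Hesse pencil. -/

section Flexes

theorem flexVec_zero (η : k) : flexVec 0 η = ![0, 1, -η] := by
  have : (-1 : Fin 3) = 2 := rfl
  ext j
  fin_cases j <;> simp [flexVec, x, this]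

theorem flexVec_one (η : k) : flexVec 1 η = ![-η, 0, 1] := by
  have : (1 + 1 : Fin 3) = 2 := rfl
  ext j
  fin_cases j <;> simp [flexVec, x, this]

theorem flexVec_two (η : k) : flexVec 2 η = ![1, -η, 0] := by
  have : (2 + 1 : Fin 3) = 0 := rfl
  have : (2 - 1 : Fin 3) = 1 := rfl
  ext j
  fin_cases j <;> simp [flexVec, x, *]

theorem flexVec_ne_zero (i : Fin 3) (η : k) : flexVec i η ≠ 0 := by
  intro h
  fin_cases i
  · simpa [flexVec_zero] using congrFun h 1
  · simpa [flexVec_one] using congrFun h 2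
  · simpa [flexVec_two] using congrFun h 0

theorem mk_mem_flexes_iff {w : Fin 3 → k} (hw : w ≠ 0) :
    Projectivization.mk k w hw ∈ flexes k ↔
      w 0 * w 1 * w 2 = 0 ∧ w 0 ^ 3 + w 1 ^ 3 + w 2 ^ 3 = 0 := by
  constructor
  · rintro ⟨i, η, hη, h, e⟩
    rw [Projectivization.mk_eq_mk_iff'] at e
    obtain ⟨s, rfl⟩ := e
    fin_cases i <;> simp [flexVec_zero, flexVec_one, flexVec_two] <;>
      linear_combination (-s ^ 3) * hη
  · rintro ⟨hq, hs⟩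
    have key : ∀ i : Fin 3, w (i + 1) ^ 3 + w (i - 1) ^ 3 = 0 → w (i + 1) ≠ 0 →
        w = w (i + 1) • flexVec i (-w (i - 1) / w (i + 1)) →
        Projectivization.mk k w hw ∈ flexes k := by
      intro i h1 hne h
      refine ⟨i, -w (i - 1) / w (i + 1), ?_, flexVec_ne_zero _ _, ?_⟩
      · field_simp
        linear_combination -h1
      · rw [Projectivization.mk_eq_mk_iff']
        exact ⟨w (i + 1), h.symm⟩
    have e : (1 + 1 : Fin 3) = 2 ∧ (2 + 1 : Fin 3) = 0 ∧ (2 - 1 : Fin 3) = 1 ∧ (-1 : Fin 3) = 2 :=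
      ⟨rfl, rfl, rfl, rfl⟩
    rcases mul_eq_zero.mp hq with h | h
    · rcases mul_eq_zero.mp h with h | h
      · rw [h] at hs
        have hne : w 1 ≠ 0 := by
          intro h1
          have h2 : w 2 = 0 := by simpa [h1] using hs
          exact hw (by ext j; fin_cases j <;> assumption)
        refine key 0 (show w 1 ^ 3 + w 2 ^ 3 = 0 by linear_combination hs) hne ?_
        ext j
        fin_cases j <;> simp [flexVec_zero, e, h] <;> field_simp
      · rw [h] at hs
        have hne : w 2 ≠ 0 := by
          intro h1
          have h2 : w 0 = 0 := by simpa [h1] using hs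
          exact hw (by ext j; fin_cases j <;> assumption)
        refine key 1 (show w 2 ^ 3 + w 0 ^ 3 = 0 by linear_combination hs) hne ?_
        ext j
        fin_cases j <;> simp [flexVec_one, e, h] <;> field_simp
    · rw [h] at hs
      have hne : w 0 ≠ 0 := by
        intro h1
        have h2 : w 1 = 0 := by simpa [h1] using hs
        exact hw (by ext j; fin_cases j <;> assumption)
      refine key 2 (show w 0 ^ 3 + w 1 ^ 3 = 0 by linear_combination hs) hne ?_
      ext j
      fin_cases j <;> simp [flexVec_two, e, h] <;> field_simp

/-- `P` is a flex of the curve `F = 0`: the form `F` restricts to the cube of a linear form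
vanishing at `P` on some line through `P`. -/
def IsFlex (F : (Fin 3 → k) → k) (P : Fin 3 → k) : Prop :=
  ∃ Q : Fin 3 → k, (∀ s : k, Q ≠ s • P) ∧ ∀ r s : k, F (r • P + s • Q) = s ^ 3 * F Q

theorem IsFlex.map_mulVec {F F' : (Fin 3 → k) → k} {ν : k} (M : GL (Fin 3) k)
    (h : ∀ w, F' (M.val.mulVec w) = ν * F w) {P : Fin 3 → k} (hP : IsFlex F P) :
    IsFlex F' (M.val.mulVec P) := by
  obtain ⟨Q, hQ, hF⟩ := hP
  refine ⟨M.val.mulVec Q, fun s hs => hQ s ?_, fun r s => ?_⟩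
  · rw [← inv_mulVec_mulVec M Q, hs, Matrix.mulVec_smul, inv_mulVec_mulVec]
  · rw [← Matrix.mulVec_smul, ← Matrix.mulVec_smul, ← Matrix.mulVec_add, h, h, hF]
    ring

/-- The witness is a second point of the tangent line: at a point with `w 0 = 0` the gradient is
proportional to `(μ w₁w₂, w₁², w₂²)`, which annihilates `(w₁, -μw₂, 0)`. -/
theorem isFlex_hesse (μ : k) {w : Fin 3 → k} (hw : w ≠ 0) (hq : w 0 * w 1 * w 2 = 0)
    (hs : w 0 ^ 3 + w 1 ^ 3 + w 2 ^ 3 = 0) : IsFlex (hesse μ) w := by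
  rcases mul_eq_zero.mp hq with h | h
  · rcases mul_eq_zero.mp h with h | h
    · rw [h] at hs
      refine ⟨![w 1, -(μ * w 2), 0], fun s e => ?_, fun r s => ?_⟩
      · have h1 : w 1 = 0 := by simpa [h] using congrFun e 0
        have h2 : w 2 = 0 := by simpa [h1] using hs
        exact hw (by ext j; fin_cases j <;> assumption)
      · simp [hesse, h]
        linear_combination r ^ 3 * hs
    · rw [h] at hs
      refine ⟨![0, w 2, -(μ * w 0)], fun s e => ?_, fun r s => ?_⟩
      · have h1 : w 2 = 0 := by simpa [h] using congrFun e 1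
        have h2 : w 0 = 0 := by simpa [h1] using hs
        exact hw (by ext j; fin_cases j <;> assumption)
      · simp [hesse, h]
        linear_combination r ^ 3 * hs
  · rw [h] at hs
    refine ⟨![-(μ * w 1), 0, w 0], fun s e => ?_, fun r s => ?_⟩
    · have h1 : w 0 = 0 := by simpa [h] using congrFun e 2
      have h2 : w 1 = 0 := by simpa [h1] using hs
      exact hw (by ext j; fin_cases j <;> assumption)
    · simp [hesse, h]
      linear_combination r ^ 3 * hs

theorem cross_eq_zero_of_cross_eq_zero {A B N : Fin 3 → k} (hN : N ≠ 0)
    (hA : ∀ i j, A i * N j = A j * N i) (hB : ∀ i j, B i * N j = B j * N i) (i j : Fin 3) :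
    A i * B j = A j * B i := by
  obtain ⟨l, hl⟩ := Function.ne_iff.mp hN
  have hl : N l ≠ 0 := hl
  apply mul_right_cancel₀ (mul_ne_zero hl hl)
  linear_combination (A i * N l) * hB j l + (B l * N j) * hA i l - (A j * N l) * hB i l -
    (B l * N i) * hA j l

/-- A ternary quadratic form with a two-dimensional isotropic subspace is degenerate. -/
theorem det_eq_zero_of_isotropic {a b c d e f : k} {P Q : Fin 3 → k} (hP : P ≠ 0)
    (hPQ : ∀ s : k, Q ≠ s • P)
    (h1 : (a * P 0 + d * P 1 + e * P 2) * P 0 + (d * P 0 + b * P 1 + f * P 2) * P 1 +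
      (e * P 0 + f * P 1 + c * P 2) * P 2 = 0)
    (h2 : (a * P 0 + d * P 1 + e * P 2) * Q 0 + (d * P 0 + b * P 1 + f * P 2) * Q 1 +
      (e * P 0 + f * P 1 + c * P 2) * Q 2 = 0)
    (h3 : (a * Q 0 + d * Q 1 + e * Q 2) * Q 0 + (d * Q 0 + b * Q 1 + f * Q 2) * Q 1 +
      (e * Q 0 + f * Q 1 + c * Q 2) * Q 2 = 0) :
    a * b * c + 2 * (d * e * f) - a * f ^ 2 - b * e ^ 2 - c * d ^ 2 = 0 := by
  set A : Fin 3 → k := ![a * P 0 + d * P 1 + e * P 2, d * P 0 + b * P 1 + f * P 2,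
    e * P 0 + f * P 1 + c * P 2] with hA
  set B : Fin 3 → k := ![a * Q 0 + d * Q 1 + e * Q 2, d * Q 0 + b * Q 1 + f * Q 2,
    e * Q 0 + f * Q 1 + c * Q 2] with hB
  set N : Fin 3 → k := ![P 1 * Q 2 - P 2 * Q 1, P 2 * Q 0 - P 0 * Q 2, P 0 * Q 1 - P 1 * Q 0]
    with hN
  have hN0 : N ≠ 0 := by
    intro h
    have n0 : P 1 * Q 2 - P 2 * Q 1 = 0 := congrFun h 0
    have n1 : P 2 * Q 0 - P 0 * Q 2 = 0 := congrFun h 1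
    have n2 : P 0 * Q 1 - P 1 * Q 0 = 0 := congrFun h 2
    obtain ⟨l, hl⟩ := Function.ne_iff.mp hP
    apply hPQ (Q l / P l)
    ext j
    simp only [Pi.smul_apply, smul_eq_mul, Pi.zero_apply] at hl ⊢
    rw [div_mul_eq_mul_div, eq_div_iff hl]
    fin_cases l <;> fin_cases j <;> simp only [Fin.zero_eta, Fin.mk_one, Fin.reduceFinMk]
      <;> grind
  have hAN : ∀ i j, A i * N j = A j * N i := by
    intro i j
    fin_cases i <;> fin_cases j <;> simp [A, N] <;> grind
  have hBN : ∀ i j, B i * N j = B j * N i := by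
    intro i j
    fin_cases i <;> fin_cases j <;> simp [B, N] <;> grind
  -- With `S` the symmetric matrix of the form, `A = SP` and `B = SQ` are orthogonal to `P` and `Q`,
  -- hence parallel to `N = P × Q`. So `A × B = 0`, while `S (A × B) = det S • N`; a nonzero
  -- coordinate of `N` gives `det S = 0`.
  have hAB := cross_eq_zero_of_cross_eq_zero hN0 hAN hBN
  obtain ⟨l, hl⟩ := Function.ne_iff.mp hN0
  apply mul_right_cancel₀ hl
  have c0 := hAB 1 2
  have c1 := hAB 2 0
  have c2 := hAB 0 1
  simp only [A, B, Matrix.cons_val] at c0 c1 c2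
  rw [zero_mul]
  fin_cases l
  · change _ * (P 1 * Q 2 - P 2 * Q 1) = 0
    linear_combination a * c0 + d * c1 + e * c2
  · change _ * (P 2 * Q 0 - P 0 * Q 2) = 0
    linear_combination d * c0 + b * c1 + f * c2
  · change _ * (P 0 * Q 1 - P 1 * Q 0) = 0
    linear_combination e * c0 + f * c1 + c * c2

/-- At a flex the polar conic contains the inflectional tangent, so the Hessian determinant
vanishes. Modulo the cubic itself that determinant is a multiple of `(1 + μ³) w₀w₁w₂`. -/
theorem of_isFlex_hesse (h2 : (2 : k) ≠ 0) (h3 : (3 : k) ≠ 0) {μ : k} (hμ : 1 + μ ^ 3 ≠ 0)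
    {w : Fin 3 → k} (hw : w ≠ 0) (h : IsFlex (hesse μ) w) :
    w 0 * w 1 * w 2 = 0 ∧ w 0 ^ 3 + w 1 ^ 3 + w 2 ^ 3 = 0 := by
  obtain ⟨Q, hQ, hF⟩ := h
  have e0 : hesse μ w = 0 := by simpa using hF 1 0
  have e1 := hF 1 1
  have e2 := hF 1 (-1)
  simp only [hesse, Pi.add_apply, Pi.smul_apply, smul_eq_mul] at e0 e1 e2
  have g1 : w 0 ^ 2 * Q 0 + w 1 ^ 2 * Q 1 + w 2 ^ 2 * Q 2 +
      μ * (w 1 * w 2 * Q 0 + w 0 * w 2 * Q 1 + w 0 * w 1 * Q 2) = 0 := by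
    apply mul_left_cancel₀ (mul_ne_zero h2 h3)
    linear_combination e1 - e2
  have g2 : w 0 * Q 0 ^ 2 + w 1 * Q 1 ^ 2 + w 2 * Q 2 ^ 2 +
      μ * (w 0 * Q 1 * Q 2 + w 1 * Q 0 * Q 2 + w 2 * Q 0 * Q 1) = 0 := by
    apply mul_left_cancel₀ (mul_ne_zero h2 h3)
    linear_combination e1 + e2 - 2 * e0
  have hdet := det_eq_zero_of_isotropic (a := 2 * w 0) (b := 2 * w 1) (c := 2 * w 2)
    (d := μ * w 2) (e := μ * w 1) (f := μ * w 0) hw hQ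
    (by linear_combination 2 * e0) (by linear_combination 2 * g1) (by linear_combination 2 * g2)
  have hq : w 0 * w 1 * w 2 = 0 := by
    apply mul_left_cancel₀ (mul_ne_zero (pow_ne_zero 3 h2) hμ)
    linear_combination hdet + 2 * μ ^ 2 * e0
  exact ⟨hq, by linear_combination e0 - 3 * μ * hq⟩

theorem mk_mem_hessianGroup_of_hesse (h2 : (2 : k) ≠ 0) (h3 : (3 : k) ≠ 0) {μ μ' : k}
    (hμ : 1 + μ ^ 3 ≠ 0) (hμ' : 1 + μ' ^ 3 ≠ 0) {M : GL (Fin 3) k} {ν : k} (hν : ν ≠ 0)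
    (h : ∀ w, hesse μ' (M.val.mulVec w) = ν * hesse μ w) :
    (Matrix.ProjGenLinGroup.mk M : PGL(3, k)) ∈ hessianGroup k := by
  rw [hessianGroup, MulAction.mem_stabilizer_iff, smul_eq_iff_forall_mk]
  intro w hw
  rw [mk_mem_flexes_iff, mk_mem_flexes_iff]
  constructor
  · rintro ⟨hq, hs⟩
    exact of_isFlex_hesse h2 h3 hμ' (mulVec_ne_zero M hw)
      ((isFlex_hesse μ hw hq hs).map_mulVec M h)
  · rintro ⟨hq, hs⟩
    have h' : ∀ w, hesse μ ((M⁻¹).val.mulVec w) = ν⁻¹ * hesse μ' w := by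
      intro w
      rw [eq_inv_mul_iff_mul_eq₀ hν, ← h, mulVec_inv_mulVec]
    have := (isFlex_hesse μ' (mulVec_ne_zero M hw) hq hs).map_mulVec M⁻¹ h'
    rw [inv_mulVec_mulVec] at this
    exact of_isFlex_hesse h2 h3 hμ hw this

/-- The cubics through the nine flexes form the Hesse pencil. -/
theorem IsCubicForm.eq_pencil [IsAlgClosed k] (h2 : (2 : k) ≠ 0) (h3 : (3 : k) ≠ 0)
    {F : (Fin 3 → k) → k} (hF : IsCubicForm F)
    (h : ∀ w, w 0 * w 1 * w 2 = 0 → w 0 ^ 3 + w 1 ^ 3 + w 2 ^ 3 = 0 → F w = 0) :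
    ∃ α β : k, ∀ w, F w = α * (w 0 ^ 3 + w 1 ^ 3 + w 2 ^ 3) + β * (w 0 * w 1 * w 2) := by
  obtain ⟨ε, hε⟩ := exists_sq_add_self_add_one h2
  have hε3 := cube_eq_one_of_sq_add_self_add_one hε
  -- On each coordinate line the cubic gives a polynomial of degree at most 2 in `η` vanishing at
  -- all three cube roots of unity, hence zero. This kills the mixed coefficients and equates those
  -- of the cubes.
  have key : ∀ p q r s : k, (∀ η : k, η ^ 3 = 1 → p - q - r * η + s * η ^ 2 = 0) →
      p = q ∧ r = 0 ∧ s = 0 := by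
    intro p q r s hη
    have e1 := hη 1 (one_pow 3)
    have e2 := hη ε hε3
    have e3 := hη (ε ^ 2) (by rw [← pow_mul, mul_comm, pow_mul, hε3, one_pow])
    have hpq : p = q := by
      apply mul_left_cancel₀ h3
      linear_combination e1 + e2 + e3 + r * hε - s * (ε ^ 2 - ε + 1) * hε
    have hne := ne_one_of_sq_add_self_add_one h3 hε
    subst hpq
    have hrs : r = s := by linear_combination -e1
    subst hrs
    have : r = 0 := by
      have h' : r * (ε * (ε - 1)) = 0 := by linear_combination e2
      have hε0 : ε ≠ 0 := by
        rintro rfl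
        simp at hε
      simpa [hε0, sub_eq_zero, hne] using h'
    exact ⟨rfl, this, this⟩
  obtain ⟨a₁, a₂, a₃, a₄, a₅, a₆, a₇, a₈, a₉, a₁₀, hc⟩ := hF.exists_coeffs
  have k0 := key a₂ a₃ a₇ a₉ fun η hη => by
    have := h ![0, 1, -η] (by simp) (by simp; linear_combination -hη)
    rw [hc] at this
    simp at this
    linear_combination this + a₃ * hη
  have k1 := key a₃ a₁ a₈ a₅ fun η hη => by
    have := h ![-η, 0, 1] (by simp) (by simp; linear_combination -hη)
    rw [hc] at this
    simp at this
    linear_combination this + a₁ * hη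
  have k2 := key a₁ a₂ a₄ a₆ fun η hη => by
    have := h ![1, -η, 0] (by simp) (by simp; linear_combination -hη)
    rw [hc] at this
    simp at this
    linear_combination this + a₂ * hη
  obtain ⟨rfl, rfl, rfl⟩ := k0
  obtain ⟨rfl, rfl, rfl⟩ := k1
  obtain ⟨-, rfl, rfl⟩ := k2
  exact ⟨a₂, a₁₀, fun w => by rw [hc]; ring⟩

theorem nat_card_cube_roots [IsAlgClosed k] (h2 : (2 : k) ≠ 0) (h3 : (3 : k) ≠ 0) :
    Nat.card {η : k // η ^ 3 = 1} = 3 := by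
  obtain ⟨ε, hε⟩ := exists_sq_add_self_add_one h2
  have hne := ne_one_of_sq_add_self_add_one h3 hε
  have hε0 : ε ≠ 0 := by
    rintro rfl
    simp at hε
  have e : {η : k | η ^ 3 = 1} = {1, ε, ε ^ 2} := by
    ext η
    simp [cube_eq_one_iff hε]
  have : Set.ncard {η : k | η ^ 3 = 1} = 3 := by
    rw [e, Set.ncard_eq_three]
    refine ⟨1, ε, ε ^ 2, hne.symm, fun h => hne ?_, fun h => hne ?_, rfl⟩
    · linear_combination ε * h + (ε - 1) * hε
    · exact (mul_left_cancel₀ hε0 (by linear_combination h)).symm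
  exact this

theorem nat_card_flexes [IsAlgClosed k] (h2 : (2 : k) ≠ 0) (h3 : (3 : k) ≠ 0) :
    Nat.card (flexes k) = 9 := by
  let f : Fin 3 × {η : k // η ^ 3 = 1} → flexes k := fun p =>
    ⟨Projectivization.mk k (flexVec p.1 p.2) (flexVec_ne_zero _ _), p.1, p.2, p.2.2, _, rfl⟩
  have hf : Function.Bijective f := by
    constructor
    · rintro ⟨i, η, hη⟩ ⟨i', η', hη'⟩ h
      have h' := congrArg Subtype.val h
      simp only [f, Projectivization.mk_eq_mk_iff'] at h'
      obtain ⟨s, hs⟩ := h'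
      have hη0 : η ≠ 0 := by
        rintro rfl
        simp at hη
      have e0 := congrFun hs 0
      have e1 := congrFun hs 1
      have e2 := congrFun hs 2
      clear h hs f
      fin_cases i <;> fin_cases i' <;>
        simp [flexVec_zero, flexVec_one, flexVec_two] at e0 e1 e2 ⊢ <;> grind
    · rintro ⟨P, i, η, hη, h, rfl⟩
      exact ⟨(i, ⟨η, hη⟩), rfl⟩
  rw [← Nat.card_congr (Equiv.ofBijective f hf), Nat.card_prod, nat_card_cube_roots h2 h3,
    Nat.card_fin]

end Flexes

/-! ### Cubics vanishing on a short Weierstrass curve. -/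

section ShortWeierstrass

theorem coeffs_eq_zero_of_forall_eval [Infinite k] {c₀ c₁ c₂ c₃ c₄ c₅ : k}
    (h : ∀ x : k, c₀ + c₁ * x + c₂ * x ^ 2 + c₃ * x ^ 3 + c₄ * x ^ 4 + c₅ * x ^ 5 = 0) :
    c₀ = 0 ∧ c₁ = 0 ∧ c₂ = 0 ∧ c₃ = 0 ∧ c₄ = 0 ∧ c₅ = 0 := by
  open Polynomial in
  have hp : (C c₀ + C c₁ * .X + C c₂ * .X ^ 2 + C c₃ * .X ^ 3 + C c₄ * .X ^ 4 + C c₅ * .X ^ 5 : k[X])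
      = 0 := Polynomial.funext fun x => by simpa using h x
  have hc := fun n => congrArg (fun p => Polynomial.coeff p n) hp
  have h0 := hc 0
  have h1 := hc 1
  have h2 := hc 2
  have h3 := hc 3
  have h4 := hc 4
  have h5 := hc 5
  simp [Polynomial.coeff_X, Polynomial.coeff_C, Polynomial.coeff_X_pow] at h0 h1 h2 h3 h4 h5
  exact ⟨h0, h1, h2, h3, h4, h5⟩

theorem cubic_coeffs_eq_zero (h2 : (2 : k) ≠ 0) {a₁ a₂ a₃ a₄ a₅ a₆ a₇ a₈ a₉ a₁₀ : k}
    (h : ∀ x y z : k,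
      a₁ * x ^ 3 + a₂ * y ^ 3 + a₃ * z ^ 3 + a₄ * (x ^ 2 * y) + a₅ * (x ^ 2 * z) +
        a₆ * (y ^ 2 * x) + a₇ * (y ^ 2 * z) + a₈ * (z ^ 2 * x) + a₉ * (z ^ 2 * y) +
        a₁₀ * (x * y * z) = 0) :
    a₁ = 0 ∧ a₂ = 0 ∧ a₃ = 0 ∧ a₄ = 0 ∧ a₅ = 0 ∧ a₆ = 0 ∧ a₇ = 0 ∧ a₈ = 0 ∧ a₉ = 0 ∧
      a₁₀ = 0 := by
  have key : ∀ p q : k, p + q = 0 → -p + q = 0 → p = 0 ∧ q = 0 := by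
    intro p q h h'
    exact ⟨mul_left_cancel₀ h2 (by linear_combination h - h'),
      mul_left_cancel₀ h2 (by linear_combination h + h')⟩
  have b₁ : a₁ = 0 := by simpa using h 1 0 0
  have b₂ : a₂ = 0 := by simpa using h 0 1 0
  have b₃ : a₃ = 0 := by simpa using h 0 0 1
  subst b₁ b₂ b₃
  obtain ⟨rfl, rfl⟩ := key a₄ a₆ (by linear_combination h 1 1 0) (by linear_combination h 1 (-1) 0)
  obtain ⟨rfl, rfl⟩ := key a₅ a₈ (by linear_combination h 1 0 1) (by linear_combination h 1 0 (-1))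
  obtain ⟨rfl, rfl⟩ := key a₇ a₉ (by linear_combination h 0 1 1) (by linear_combination h 0 1 (-1))
  simpa using h 1 1 1

/-- The cubic form of the Weierstrass equation `Y²Z = X³ + AXZ² + BZ³`. -/
def wform (A B : k) (w : Fin 3 → k) : k :=
  w 1 ^ 2 * w 2 - (w 0 ^ 3 + A * (w 0 * w 2 ^ 2) + B * w 2 ^ 3)

theorem IsCubicForm.eq_smul_wform [IsAlgClosed k] (h2 : (2 : k) ≠ 0) {A B : k}
    {F : (Fin 3 → k) → k} (hF : IsCubicForm F) (h : ∀ w, wform A B w = 0 → F w = 0) :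
    ∃ ν, ∀ w, F w = ν * wform A B w := by
  have := IsAlgClosed.instInfinite (K := k)
  obtain ⟨a₁, a₂, a₃, a₄, a₅, a₆, a₇, a₈, a₉, a₁₀, hc⟩ := hF.exists_coeffs
  have b₂ : a₂ = 0 := by
    have := h ![0, 1, 0] (by simp [wform])
    rw [hc] at this
    simpa using this
  subst b₂
  -- Both points `(t : ±s : 1)` with `s² = t³ + At + B` lie on the curve, so the parts even and odd
  -- in `s` vanish separately. The odd part is multiplied by `s` to become a polynomial in `t`.
  have key : ∀ t : k, a₁ * t ^ 3 + a₃ + a₅ * t ^ 2 + a₈ * t +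
      (a₆ * t + a₇) * (t ^ 3 + A * t + B) = 0 ∧
      (t ^ 3 + A * t + B) * (a₄ * t ^ 2 + a₁₀ * t + a₉) = 0 := by
    intro t
    obtain ⟨s, hs⟩ := IsAlgClosed.exists_pow_nat_eq (t ^ 3 + A * t + B) two_pos
    have e1 := h ![t, s, 1] (by simp [wform]; linear_combination hs)
    have e2 := h ![t, -s, 1] (by simp [wform]; linear_combination hs)
    rw [hc] at e1 e2
    simp at e1 e2
    constructor
    · apply mul_left_cancel₀ h2
      linear_combination e1 + e2 - 2 * (a₆ * t + a₇) * hs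
    · apply mul_left_cancel₀ h2
      linear_combination s * (e1 - e2) - 2 * (a₄ * t ^ 2 + a₁₀ * t + a₉) * hs
  obtain ⟨c0, c1, c2, c3, c4, -⟩ := coeffs_eq_zero_of_forall_eval (c₀ := a₃ + B * a₇)
    (c₁ := a₈ + B * a₆ + A * a₇) (c₂ := a₅ + A * a₆) (c₃ := a₁ + a₇) (c₄ := a₆) (c₅ := (0 : k))
    fun t => by linear_combination (key t).1
  obtain ⟨-, -, -, d3, d4, d5⟩ := coeffs_eq_zero_of_forall_eval (c₀ := B * a₉)
    (c₁ := B * a₁₀ + A * a₉) (c₂ := B * a₄ + A * a₁₀) (c₃ := A * a₄ + a₉) (c₄ := a₁₀) (c₅ := a₄)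
    fun t => by linear_combination (key t).2
  subst c4 d4 d5
  have e9 : a₉ = 0 := by linear_combination d3
  refine ⟨a₇, fun w => ?_⟩
  rw [hc, wform]
  linear_combination w 0 ^ 3 * c3 + w 2 ^ 3 * c0 + w 0 ^ 2 * w 2 * c2 + w 2 ^ 2 * w 0 * c1 +
    w 2 ^ 2 * w 1 * e9

end ShortWeierstrass

/-! ### From the Hesse form to the Weierstrass form. -/

section HesseToWeierstrass

/-- The coefficient `A` of the Weierstrass form `Y²Z = X³ + AXZ² + BZ³` of a Hesse cubic. -/
def coeffA (μ : k) : k := -3 * μ * (μ ^ 3 - 8)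

/-- The coefficient `B` of the Weierstrass form `Y²Z = X³ + AXZ² + BZ³` of a Hesse cubic. -/
def coeffB (μ : k) : k := 2 * (μ ^ 6 + 20 * μ ^ 3 - 8)

theorem discr_coeffs (μ : k) : 4 * coeffA μ ^ 3 + 27 * coeffB μ ^ 2 = 6912 * (1 + μ ^ 3) ^ 3 := by
  rw [coeffA, coeffB]
  ring

theorem exists_hesse_to_wform [IsAlgClosed k] (h2 : (2 : k) ≠ 0) (h3 : (3 : k) ≠ 0) {μ : k}
    (hμ : 1 + μ ^ 3 ≠ 0) : ∃ (M : GL (Fin 3) k) (ν m : k), ν ≠ 0 ∧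
      (∀ w, wform (coeffA μ) (coeffB μ) (M.val.mulVec w) = ν * hesse μ w) ∧
      M.val.mulVec ![0, 1, -1] = ![0, m, 0] := by
  obtain ⟨σ, hσ⟩ := IsAlgClosed.exists_pow_nat_eq (3 : k) two_pos
  have hσ0 : σ ≠ 0 := by
    rintro rfl
    apply h3
    rw [← hσ]
    simp
  -- The last row is the tangent line at `(0 : 1 : -1)`, the middle row is antisymmetric under
  -- swapping the last two coordinates (the inversion), and the first row is the symmetric form
  -- leaving no `X²Z` term. The factor `σ = √3` normalizes `Y²Z`.
  set N : Matrix (Fin 3) (Fin 3) k := !![-4 * (1 + μ ^ 3) + 3 * μ ^ 3, -3 * μ ^ 2, -3 * μ ^ 2;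
    0, 4 * σ * (1 + μ ^ 3), -(4 * σ * (1 + μ ^ 3)); -μ, 1, 1] with hN
  have hdet : N.det = -(2 ^ 5 * σ * (1 + μ ^ 3) ^ 2) := by
    rw [hN, Matrix.det_fin_three]
    simp
    ring
  have hne : N.det ≠ 0 := by
    rw [hdet]
    exact neg_ne_zero.mpr (mul_ne_zero (mul_ne_zero (pow_ne_zero 5 h2) hσ0) (pow_ne_zero 2 hμ))
  refine ⟨Matrix.GeneralLinearGroup.mkOfDetNeZero N hne, 2 ^ 6 * (1 + μ ^ 3) ^ 2,
    8 * σ * (1 + μ ^ 3), mul_ne_zero (pow_ne_zero 6 h2) (pow_ne_zero 2 hμ), fun w => ?_, ?_⟩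
  · change wform _ _ (N.mulVec w) = _
    simp only [wform, mulVec_three, hN, hesse, coeffA, coeffB, Matrix.of_apply, Matrix.cons_val]
    linear_combination (4 * (1 + μ ^ 3) * (w 1 - w 2)) ^ 2 * (-μ * w 0 + w 1 + w 2) * hσ
  · change N.mulVec _ = _
    ext i
    rw [mulVec_three]
    fin_cases i <;> simp [hN] <;> ring

/-- The Weierstrass model reduces this to `IsCubicForm.eq_smul_wform`. It turns equality of zero
sets into proportionality of forms. -/
theorem IsCubicForm.eq_smul_hesse [IsAlgClosed k] (h2 : (2 : k) ≠ 0) (h3 : (3 : k) ≠ 0) {μ : k}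
    (hμ : 1 + μ ^ 3 ≠ 0) {F : (Fin 3 → k) → k} (hF : IsCubicForm F)
    (h : ∀ w, hesse μ w = 0 → F w = 0) : ∃ ν, ∀ w, F w = ν * hesse μ w := by
  obtain ⟨M, ν, -, hν, hM, -⟩ := exists_hesse_to_wform h2 h3 hμ
  obtain ⟨ν', h'⟩ := (hF.comp_mulVec (M⁻¹).val).eq_smul_wform h2
    (A := coeffA μ) (B := coeffB μ) fun w hw => h _ (by
      have := hM ((M⁻¹).val.mulVec w)
      rw [mulVec_inv_mulVec, hw, eq_comm] at this
      exact (mul_eq_zero.mp this).resolve_left hν)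
  refine ⟨ν' * ν, fun w => ?_⟩
  have := h' (M.val.mulVec w)
  rw [inv_mulVec_mulVec, hM] at this
  rw [this, mul_assoc]

theorem hesse_x_zero (μ : k) : hesse μ (x 0) = 1 := by
  simp [hesse, x]

theorem exists_multiplier [IsAlgClosed k] (h2 : (2 : k) ≠ 0) (h3 : (3 : k) ≠ 0) {μ : k}
    (hμ : 1 + μ ^ 3 ≠ 0) {F : (Fin 3 → k) → k} (hF : IsCubicForm F) (M : GL (Fin 3) k)
    (h : ∀ w, hesse μ w = 0 ↔ F (M.val.mulVec w) = 0) :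
    ∃ ν, ν ≠ 0 ∧ ∀ w, F (M.val.mulVec w) = ν * hesse μ w := by
  obtain ⟨ν, hν⟩ := (hF.comp_mulVec M.val).eq_smul_hesse h2 h3 hμ fun w => (h w).mp
  refine ⟨ν, ?_, hν⟩
  rintro rfl
  have := (h (x 0)).mpr (by rw [hν, zero_mul])
  rw [hesse_x_zero] at this
  exact one_ne_zero this

end HesseToWeierstrass

/-! ### Linear maps between Weierstrass cubics fixing the point at infinity. -/

section WeierstrassMaps

/-- The form of the projective Weierstrass equation of `W`. -/
def weierstrassForm (W : WeierstrassCurve k) (w : Fin 3 → k) : k :=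
  MvPolynomial.eval w W.toProjective.polynomial

theorem weierstrassForm_eq (W : WeierstrassCurve k) (w : Fin 3 → k) : weierstrassForm W w =
    w 1 ^ 2 * w 2 + W.a₁ * w 0 * w 1 * w 2 + W.a₃ * w 1 * w 2 ^ 2 -
      (w 0 ^ 3 + W.a₂ * w 0 ^ 2 * w 2 + W.a₄ * w 0 * w 2 ^ 2 + W.a₆ * w 2 ^ 3) :=
  WeierstrassCurve.Projective.eval_polynomial (W' := W.toProjective) w

theorem isCubicForm_weierstrassForm (W : WeierstrassCurve k) : IsCubicForm (weierstrassForm W) :=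
  isCubicForm_of_coeffs (-1) 0 (-W.a₆) 0 (-W.a₂) 0 1 (-W.a₄) W.a₃ W.a₁ fun w => by
    rw [weierstrassForm_eq]
    ring

/-- The Weierstrass curve `Y² = X³ + AX + B`. -/
def shortCurve (A B : k) : WeierstrassCurve k := ⟨0, 0, 0, A, B⟩

theorem weierstrassForm_shortCurve (A B : k) : weierstrassForm (shortCurve A B) = wform A B := by
  ext w
  rw [weierstrassForm_eq, wform]
  simp [shortCurve]
  ring

theorem isFlex_weierstrassForm (W : WeierstrassCurve k) :
    IsFlex (weierstrassForm W) ![0, 1, 0] := by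
  refine ⟨![1, 0, 0], fun s h => ?_, fun r s => ?_⟩
  · simpa using congrFun h 0
  · simp [weierstrassForm_eq]

variable {W : WeierstrassCurve k} {A B ν m : k} {M : GL (Fin 3) k}

/-- Coefficientwise description of a linear map between two Weierstrass cubics which preserves the
point at infinity. -/
theorem weierstrassForm_map_coeffs (h2 : (2 : k) ≠ 0)
    (h : ∀ w, weierstrassForm W (M.val.mulVec w) = ν * wform A B w)
    (hm : M.val.mulVec ![0, 1, 0] = ![0, m, 0]) :
    ∃ p q r t d : k, p ≠ 0 ∧ m ≠ 0 ∧ d ≠ 0 ∧ M.val = !![p, 0, r; q, m, t; 0, 0, d] ∧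
      p ^ 3 = ν ∧ m ^ 2 * d = ν ∧ 2 * q + W.a₁ * p = 0 ∧ 2 * t + W.a₁ * r + W.a₃ * d = 0 ∧
      q ^ 2 * d + W.a₁ * p * q * d - 3 * p ^ 2 * r - W.a₂ * p ^ 2 * d = 0 ∧
      2 * q * t * d + W.a₁ * (p * t + r * q) * d + W.a₃ * q * d ^ 2 - 3 * p * r ^ 2 -
        2 * W.a₂ * p * r * d - W.a₄ * p * d ^ 2 = -(ν * A) ∧
      t ^ 2 * d + W.a₁ * r * t * d + W.a₃ * t * d ^ 2 - r ^ 3 - W.a₂ * r ^ 2 * d -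
        W.a₄ * r * d ^ 2 - W.a₆ * d ^ 3 = -(ν * B) := by
  set N := M.val with hN
  have hdet : N.det ≠ 0 := by
    rw [hN]
    exact M.det_ne_zero
  have m01 : N 0 1 = 0 := by
    have := congrFun hm 0
    rw [mulVec_three] at this
    simpa using this
  have m11 : N 1 1 = m := by
    have := congrFun hm 1
    rw [mulVec_three] at this
    simpa using this
  have m21 : N 2 1 = 0 := by
    have := congrFun hm 2
    rw [mulVec_three] at this
    simpa using this
  have hm0 : m ≠ 0 := by
    rintro rfl
    apply hdet
    rw [Matrix.det_fin_three, m01, m11, m21]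
    ring
  -- The inflectional tangent `Z = 0` is preserved: the `XY²` coefficient of the transformed form is
  -- `m² N₂₀`, and the target has none.
  have m20 : N 2 0 = 0 := by
    have e0 := h ![1, 0, 0]
    have e1 := h ![1, 1, 0]
    have e2 := h ![1, -1, 0]
    simp only [weierstrassForm_eq, wform, mulVec_three, m01, m11, m21, Matrix.cons_val] at e0 e1 e2
    apply mul_left_cancel₀ (mul_ne_zero h2 (pow_ne_zero 2 hm0))
    linear_combination e1 + e2 - 2 * e0
  rw [Matrix.det_fin_three, m01, m11, m21, m20] at hdet
  have hp : N 0 0 ≠ 0 := by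
    intro h0
    apply hdet
    rw [h0]
    ring
  have hd : N 2 2 ≠ 0 := by
    intro h0
    apply hdet
    rw [h0]
    ring
  refine ⟨N 0 0, N 1 0, N 0 2, N 1 2, N 2 2, hp, hm0, hd, ?_, ?_⟩
  · ext i j
    fin_cases i <;> fin_cases j <;> simp [m01, m11, m21, m20]
  generalize k00 : N 0 0 = p at *
  generalize k10 : N 1 0 = q at *
  generalize k02 : N 0 2 = r at *
  generalize k12 : N 1 2 = t at *
  generalize k22 : N 2 2 = d at *
  obtain ⟨c1, -, c3, -, c5, -, c7, c8, c9, c10⟩ := cubic_coeffs_eq_zero h2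
    (a₁ := ν - p ^ 3) (a₂ := 0)
    (a₃ := t ^ 2 * d + W.a₁ * r * t * d + W.a₃ * t * d ^ 2 - r ^ 3 - W.a₂ * r ^ 2 * d -
        W.a₄ * r * d ^ 2 - W.a₆ * d ^ 3 + ν * B) (a₄ := 0)
    (a₅ := q ^ 2 * d + W.a₁ * p * q * d - 3 * p ^ 2 * r - W.a₂ * p ^ 2 * d) (a₆ := 0)
    (a₇ := m ^ 2 * d - ν)
    (a₈ := 2 * q * t * d + W.a₁ * (p * t + r * q) * d + W.a₃ * q * d ^ 2 - 3 * p * r ^ 2 -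
        2 * W.a₂ * p * r * d - W.a₄ * p * d ^ 2 + ν * A)
    (a₉ := m * d * (2 * t + W.a₁ * r + W.a₃ * d)) (a₁₀ := m * d * (2 * q + W.a₁ * p))
    fun X Y Z => by
      have e := h ![X, Y, Z]
      rw [weierstrassForm_eq, wform, mulVec_three, mulVec_three, mulVec_three,
        m01, m11, m21, m20, k00, k10, k02, k12, k22] at e
      simp only [Matrix.cons_val] at e
      linear_combination e
  have hmd := mul_ne_zero hm0 hd
  exact ⟨by linear_combination -c1, by linear_combination c7, (mul_eq_zero.mp c10).resolve_left hmd,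
    (mul_eq_zero.mp c9).resolve_left hmd, c5, by linear_combination c8, by linear_combination c3⟩

/-- Weierstrass curves which are projectively equivalent by a map preserving the point at infinity
have the same `j`-invariant. -/
theorem j_eq_of_weierstrassForm_map (h2 : (2 : k) ≠ 0) [W.IsElliptic]
    (h : ∀ w, weierstrassForm W (M.val.mulVec w) = ν * wform A B w)
    (hm : M.val.mulVec ![0, 1, 0] = ![0, m, 0]) :
    W.j = (shortCurve A B).c₄ ^ 3 / (shortCurve A B).Δ := by
  obtain ⟨p, q, r, t, d, hp, hm0, hd, -, e1, e2, e3, e4, e5, e6, e7⟩ :=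
    weierstrassForm_map_coeffs h2 h hm
  have hu : m / p ≠ 0 := div_ne_zero hm0 hp
  -- In affine coordinates `M / d` is the substitution with `u² = p / d` and `u³ = m / d`, whence `u
  -- = m / p`.
  let C : WeierstrassCurve.VariableChange k := ⟨Units.mk0 (m / p) hu, r / d, q / p, t / d⟩
  have hp' : p = (m / p) ^ 2 * d := by
    field_simp
    linear_combination e1 - e2
  have hC : C • W = shortCurve A B := by
    have hv : ((C.u⁻¹ : kˣ) : k) ^ 2 = d / p := by
      simp only [C, Units.val_inv_eq_inv_val, Units.val_mk0]
      field_simp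
      linear_combination e1 - e2
    have f1 : W.a₁ + 2 * (q / p) = 0 := by
      field_simp
      linear_combination e3
    have f2 : W.a₂ - q / p * W.a₁ + 3 * (r / d) - (q / p) ^ 2 = 0 := by
      field_simp
      linear_combination -e5
    have f3 : W.a₃ + r / d * W.a₁ + 2 * (t / d) = 0 := by
      field_simp
      linear_combination e4
    have f4 : W.a₄ - q / p * W.a₃ + 2 * (r / d) * W.a₂ - (t / d + r / d * (q / p)) * W.a₁ +
        3 * (r / d) ^ 2 - 2 * (q / p) * (t / d) = p ^ 2 / d ^ 2 * A := by
      field_simp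
      linear_combination -e6 - A * e1
    have f6 : W.a₆ + r / d * W.a₄ + (r / d) ^ 2 * W.a₂ + (r / d) ^ 3 - t / d * W.a₃ -
        (t / d) ^ 2 - r / d * (t / d) * W.a₁ = p ^ 3 / d ^ 3 * B := by
      field_simp
      linear_combination -e7 - B * e1
    ext
    · rw [WeierstrassCurve.variableChange_a₁, f1, mul_zero]
      rfl
    · rw [WeierstrassCurve.variableChange_a₂, f2, mul_zero]
      rfl
    · rw [WeierstrassCurve.variableChange_a₃, f3, mul_zero]
      rfl
    · rw [WeierstrassCurve.variableChange_a₄, f4,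
        show ((C.u⁻¹ : kˣ) : k) ^ 4 = (((C.u⁻¹ : kˣ) : k) ^ 2) ^ 2 by ring, hv]
      field_simp
      rfl
    · rw [WeierstrassCurve.variableChange_a₆, f6,
        show ((C.u⁻¹ : kˣ) : k) ^ 6 = (((C.u⁻¹ : kˣ) : k) ^ 2) ^ 3 by ring, hv]
      field_simp
      rfl
  rw [← W.variableChange_j C, WeierstrassCurve.j, ← hC, ← WeierstrassCurve.coe_Δ',
    Units.val_inv_eq_inv_val]
  field_simp

/-- Automorphisms of a short Weierstrass cubic which preserve the point at infinity. -/
theorem wform_aut (h2 : (2 : k) ≠ 0) (h3 : (3 : k) ≠ 0)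
    (h : ∀ w, wform A B (M.val.mulVec w) = ν * wform A B w)
    (hm : M.val.mulVec ![0, 1, 0] = ![0, m, 0]) :
    ∃ u, ν = u * M.val.det ∧ A * u ^ 4 = A ∧ B * u ^ 6 = B ∧
      (u = 1 → ∃ d : k, ∀ w, M.val.mulVec w = d • w) := by
  rw [← weierstrassForm_shortCurve] at h
  obtain ⟨p, q, r, t, d, hp, hm0, hd, hM, e1, e2, e3, e4, e5, e6, e7⟩ :=
    weierstrassForm_map_coeffs h2 (fun w => by rw [h, weierstrassForm_shortCurve]) hm
  simp only [shortCurve, zero_mul, add_zero, mul_zero, sub_zero] at e3 e4 e5 e6 e7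
  obtain rfl : q = 0 := by simpa [h2] using e3
  obtain rfl : t = 0 := by simpa [h2] using e4
  obtain rfl : r = 0 := by
    simpa [h3, hp] using e5
  have hdet : M.val.det = p * m * d := by
    rw [hM, Matrix.det_fin_three]
    simp
  have hA : A * (p ^ 2 - d ^ 2) = 0 := by
    apply mul_left_cancel₀ hp
    linear_combination e6 + A * e1
  have hB : B * (p ^ 3 - d ^ 3) = 0 := by linear_combination e7 + B * e1
  have hu : (m / p) ^ 2 = p / d := by
    field_simp
    linear_combination e2 - e1
  -- Here `M / d = diag(u², u³, 1)` with `u = m / p`, and `ν / det M = m²d / (pmd) = u`.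
  refine ⟨m / p, ?_, ?_, ?_, fun h1 => ⟨d, fun w => ?_⟩⟩
  · rw [hdet, ← e2]
    field_simp
  · rw [show (m / p) ^ 4 = ((m / p) ^ 2) ^ 2 by ring, hu]
    field_simp
    linear_combination hA
  · rw [show (m / p) ^ 6 = ((m / p) ^ 2) ^ 3 by ring, hu]
    field_simp
    linear_combination hB
  · rw [h1, one_pow, eq_comm, div_eq_one_iff_eq hd] at hu
    rw [div_eq_one_iff_eq hp] at h1
    ext i
    rw [mulVec_three, hM, h1, hu]
    fin_cases i <;> simp

theorem wform_diagonal {u : k} (hA : A * u ^ 4 = A) (hB : B * u ^ 6 = B) (w : Fin 3 → k) :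
    wform A B ((Matrix.diagonal ![u ^ 2, u ^ 3, 1]).mulVec w) = u ^ 6 * wform A B w := by
  simp only [wform, Matrix.mulVec_diagonal, Matrix.cons_val]
  linear_combination (u ^ 2 * w 0 * w 2 ^ 2) * hA + w 2 ^ 3 * hB

end WeierstrassMaps

/-! ### The similitude group of a Hesse cubic and its character. -/

section MultiplierCharacter

/-- The linear operators preserving a member of the Hesse pencil up to a scalar. -/
def hesseSimilitudes (μ : k) : Subgroup (GL (Fin 3) k) where
  carrier := {M | ∃ ν : kˣ, ∀ w, hesse μ (M.val.mulVec w) = ν * hesse μ w}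
  one_mem' := ⟨1, fun w => by simp⟩
  mul_mem' := by
    rintro M N ⟨ν, h⟩ ⟨ν', h'⟩
    refine ⟨ν * ν', fun w => ?_⟩
    rw [Units.val_mul, ← Matrix.mulVec_mulVec, h, h', Units.val_mul, mul_assoc]
  inv_mem' := by
    rintro M ⟨ν, h⟩
    refine ⟨ν⁻¹, fun w => ?_⟩
    rw [Units.val_inv_eq_inv_val, eq_inv_mul_iff_mul_eq₀ ν.ne_zero, ← h, mulVec_inv_mulVec]

theorem hesse_mulVec_x_zero {μ ν : k} {M : GL (Fin 3) k}
    (h : ∀ w, hesse μ (M.val.mulVec w) = ν * hesse μ w) : hesse μ (M.val.mulVec (x 0)) = ν := by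
  rw [h, hesse_x_zero, mul_one]

/-- The ratio of the multiplier of a similitude of a Hesse cubic and of its determinant. -/
def multiplierChar (μ : k) : hesseSimilitudes μ →* kˣ :=
  MonoidHom.toHomUnits
    -- The cubic takes the value 1 at `x 0`, so its value at the image of `x 0` is the multiplier.
    { toFun := fun M => hesse μ (M.1.val.mulVec (x 0)) / M.1.val.det
      map_one' := by simp [hesse_x_zero]
      map_mul' := by
        rintro ⟨M, ν, h⟩ ⟨N, ν', h'⟩
        have h'' : ∀ w, hesse μ ((M * N).val.mulVec w) = ν * ν' * hesse μ w := fun w => by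
          rw [Units.val_mul, ← Matrix.mulVec_mulVec, h, h', mul_assoc]
        change hesse μ ((M * N).val.mulVec (x 0)) / (M * N).val.det =
          hesse μ (M.val.mulVec (x 0)) / M.val.det * (hesse μ (N.val.mulVec (x 0)) / N.val.det)
        rw [hesse_mulVec_x_zero h, hesse_mulVec_x_zero h',
          hesse_mulVec_x_zero h'', Units.val_mul, Matrix.det_mul, mul_div_mul_comm] }

theorem multiplierChar_eq_iff {μ ν : k} {M : hesseSimilitudes μ}
    (h : ∀ w, hesse μ (M.1.val.mulVec w) = ν * hesse μ w) (u : kˣ) :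
    multiplierChar μ M = u ↔ ν = u * M.1.val.det := by
  rw [Units.ext_iff, ← div_eq_iff M.1.det_ne_zero, ← hesse_mulVec_x_zero h]
  rfl

theorem mk_mem_curveStabilizer_iff [IsAlgClosed k] (h2 : (2 : k) ≠ 0) (h3 : (3 : k) ≠ 0) {μ : k}
    (hμ : 1 + μ ^ 3 ≠ 0) (M : GL (Fin 3) k) :
    (Matrix.ProjGenLinGroup.mk M : PGL(3, k)) ∈ curveStabilizer (hesseCurve μ) ↔
      M ∈ hesseSimilitudes μ := by
  rw [curveStabilizer, MulAction.mem_stabilizer_iff, smul_hesseCurve_eq_iff]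
  constructor
  · intro h
    obtain ⟨ν, hν, h'⟩ := exists_multiplier h2 h3 hμ (isCubicForm_hesse μ) M h
    exact ⟨Units.mk0 ν hν, h'⟩
  · rintro ⟨ν, h⟩ w
    rw [h, mul_eq_zero]
    simp

theorem curveStabilizer_eq_map [IsAlgClosed k] (h2 : (2 : k) ≠ 0) (h3 : (3 : k) ≠ 0) {μ : k}
    (hμ : 1 + μ ^ 3 ≠ 0) : curveStabilizer (hesseCurve μ) =
      (hesseSimilitudes μ).map Matrix.ProjGenLinGroup.mk := by
  ext g
  obtain ⟨M, rfl⟩ := Matrix.ProjGenLinGroup.mk_surjective g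
  rw [mk_mem_curveStabilizer_iff h2 h3 hμ]
  constructor
  · exact fun h => ⟨M, h, rfl⟩
  · rintro ⟨N, hN, e⟩
    rw [← mk_mem_curveStabilizer_iff h2 h3 hμ, ← e, mk_mem_curveStabilizer_iff h2 h3 hμ]
    exact hN

theorem curveStabilizer_le_hessianGroup [IsAlgClosed k] (h2 : (2 : k) ≠ 0) (h3 : (3 : k) ≠ 0)
    {μ : k} (hμ : 1 + μ ^ 3 ≠ 0) : curveStabilizer (hesseCurve μ) ≤ hessianGroup k := by
  rw [curveStabilizer_eq_map h2 h3 hμ]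
  rintro _ ⟨M, ⟨ν, h⟩, rfl⟩
  exact mk_mem_hessianGroup_of_hesse h2 h3 hμ hμ ν.ne_zero h

end MultiplierCharacter

/-! ### The translation group and its action on flexes. -/

section Translations

/-- The cyclic permutation `x_i ↦ x_{i+1}` of the basis. -/
def cyclicOp (k : Type u) [Field k] : GL (Fin 3) k where
  val := !![0, 0, 1; 1, 0, 0; 0, 1, 0]
  inv := !![0, 1, 0; 0, 0, 1; 1, 0, 0]
  val_inv := by ext i j; fin_cases i <;> fin_cases j <;> simp
  inv_val := by ext i j; fin_cases i <;> fin_cases j <;> simp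

/-- The diagonal operator with eigenvalues `1`, `ε`, `ε²` for a cube root `ε` of 1. -/
def diagonalOp (ε : k) (hε : ε ^ 3 = 1) : GL (Fin 3) k where
  val := !![1, 0, 0; 0, ε, 0; 0, 0, ε ^ 2]
  inv := !![1, 0, 0; 0, ε ^ 2, 0; 0, 0, ε]
  val_inv := by
    ext i j
    fin_cases i <;> fin_cases j <;> simp <;> linear_combination hε
  inv_val := by
    ext i j
    fin_cases i <;> fin_cases j <;> simp <;> linear_combination hε

theorem toPGLDual_mem_map_of_transpose {μ : k} (M : GL (Fin 3) k)
    (h : ∀ w, hesse μ (M.val.transpose.mulVec w) = hesse μ w) (hdet : M.val.det = 1) :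
    toPGLDual M ∈
      ((multiplierChar μ).ker.map (hesseSimilitudes μ).subtype).map Matrix.ProjGenLinGroup.mk := by
  have h' : ∀ w, hesse μ ((contragredient M).val.mulVec w) = 1 * hesse μ w := by
    intro w
    have e : M.val.transpose.mulVec ((contragredient M).val.mulVec w) = w := by
      rw [Matrix.mulVec_mulVec]
      change (M.val.transpose * (M⁻¹).val.transpose).mulVec w = w
      rw [← Matrix.transpose_mul, ← Units.val_mul, inv_mul_cancel, Units.val_one,
        Matrix.transpose_one, Matrix.one_mulVec]
    rw [one_mul, ← h, e]
  have hmem : contragredient M ∈ hesseSimilitudes μ := ⟨1, fun w => by rw [h', Units.val_one]⟩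
  refine ⟨contragredient M, ⟨⟨contragredient M, hmem⟩, ?_, rfl⟩, rfl⟩
  rw [SetLike.mem_coe, MonoidHom.mem_ker, multiplierChar_eq_iff (M := ⟨_, hmem⟩) h']
  change 1 = 1 * (M⁻¹).val.transpose.det
  rw [Matrix.det_transpose, Matrix.coe_units_inv, Matrix.det_nonsing_inv, hdet]
  simp

theorem val_eq_cyclic {M : GL (Fin 3) k} (h : ∀ i, M.val.mulVec (x i) = x (i + 1)) :
    M.val = !![0, 0, 1; 1, 0, 0; 0, 1, 0] := by
  ext i j
  have := congrFun (h j) i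
  simp only [x, Matrix.mulVec_single_one, Matrix.col_apply] at this
  rw [this]
  fin_cases i <;> fin_cases j <;> simp

theorem val_eq_diagonal {M : GL (Fin 3) k} {ε : k}
    (h : ∀ i : Fin 3, M.val.mulVec (x i) = ε ^ (i : ℕ) • x i) :
    M.val = !![1, 0, 0; 0, ε, 0; 0, 0, ε ^ 2] := by
  ext i j
  have := congrFun (h j) i
  simp only [x, Matrix.mulVec_single_one, Matrix.col_apply] at this
  rw [this]
  fin_cases i <;> fin_cases j <;> simp

/-- Both kinds of generators preserve every cubic of the pencil exactly and have determinant 1. No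
smoothness is involved, so `μ` may be chosen freely later. -/
theorem translations_le (μ : k) : translations k ≤
    ((multiplierChar μ).ker.map (hesseSimilitudes μ).subtype).map Matrix.ProjGenLinGroup.mk := by
  rw [translations, Subgroup.closure_le]
  rintro _ ⟨M, hM | ⟨ε, hε, hM⟩, rfl⟩
  · apply toPGLDual_mem_map_of_transpose
    · intro w
      simp only [val_eq_cyclic hM, hesse, mulVec_three, Matrix.transpose_apply, Matrix.of_apply,
        Matrix.cons_val]
      ring
    · rw [val_eq_cyclic hM, Matrix.det_fin_three]
      simp
  · have h3 := hε.pow_eq_one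
    apply toPGLDual_mem_map_of_transpose
    · intro w
      simp only [val_eq_diagonal hM, hesse, mulVec_three, Matrix.transpose_apply, Matrix.of_apply,
        Matrix.cons_val]
      linear_combination (w 1 ^ 3 + w 2 ^ 3 * (ε ^ 3 + 1) + 3 * μ * (w 0 * w 1 * w 2)) * h3
    · rw [val_eq_diagonal hM, Matrix.det_fin_three]
      simp
      linear_combination h3

theorem mk_cyclicOp_mem : (Matrix.ProjGenLinGroup.mk (cyclicOp k) : PGL(3, k)) ∈ translations k := by
  have e : contragredient (cyclicOp k) = cyclicOp k := by
    apply Units.ext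
    change (!![0, 1, 0; 0, 0, 1; 1, 0, 0] : Matrix (Fin 3) (Fin 3) k).transpose =
      !![0, 0, 1; 1, 0, 0; 0, 1, 0]
    ext i j
    fin_cases i <;> fin_cases j <;> simp
  rw [← e]
  refine Subgroup.subset_closure ⟨cyclicOp k, Or.inl fun i => ?_, rfl⟩
  ext j
  simp only [x, Matrix.mulVec_single_one, Matrix.col_apply, cyclicOp]
  fin_cases i <;> fin_cases j <;> simp

theorem mk_diagonalOp_mem {ε : k} (h : IsPrimitiveRoot ε 3) :
    (Matrix.ProjGenLinGroup.mk (diagonalOp ε h.pow_eq_one) : PGL(3, k)) ∈ translations k := by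
  -- Passing to the dual inverts a diagonal operator, so the one with parameter `ε² = ε⁻¹` must be
  -- used on `V`.
  have h' : IsPrimitiveRoot (ε ^ 2) 3 := h.pow_of_coprime 2 (by norm_num)
  have e : contragredient (diagonalOp (ε ^ 2) h'.pow_eq_one) = diagonalOp ε h.pow_eq_one := by
    apply Units.ext
    change (!![1, 0, 0; 0, (ε ^ 2) ^ 2, 0; 0, 0, ε ^ 2] : Matrix (Fin 3) (Fin 3) k).transpose =
      !![1, 0, 0; 0, ε, 0; 0, 0, ε ^ 2]
    ext i j
    fin_cases i <;> fin_cases j <;> simp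
    linear_combination ε * h.pow_eq_one
  rw [← e]
  refine Subgroup.subset_closure ⟨diagonalOp (ε ^ 2) h'.pow_eq_one, Or.inr ⟨ε ^ 2, h', fun i => ?_⟩,
    rfl⟩
  ext j
  simp only [x, Matrix.mulVec_single_one, Matrix.col_apply, diagonalOp]
  fin_cases i <;> fin_cases j <;> simp

theorem isPrimitiveRoot_of_sq_add_self_add_one (h3 : (3 : k) ≠ 0) {ε : k}
    (h : ε ^ 2 + ε + 1 = 0) : IsPrimitiveRoot ε 3 :=
  IsPrimitiveRoot.iff_orderOf.mpr (orderOf_eq_prime (cube_eq_one_of_sq_add_self_add_one h)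
    (ne_one_of_sq_add_self_add_one h3 h))

/-- The flex `(0 : 1 : -1)`. -/
def baseFlex (k : Type u) [Field k] : ℙ k (Fin 3 → k) :=
  Projectivization.mk k (flexVec 0 1) (flexVec_ne_zero _ _)

/-- The diagonal operator permutes the three flexes on the line `w 0 = 0`, and the cyclic one
permutes the three coordinate lines. -/
theorem exists_translation_smul_baseFlex [IsAlgClosed k] (h2 : (2 : k) ≠ 0) (h3 : (3 : k) ≠ 0)
    {P : ℙ k (Fin 3 → k)} (hP : P ∈ flexes k) : ∃ g ∈ translations k, g • baseFlex k = P := by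
  obtain ⟨ε, hε⟩ := exists_sq_add_self_add_one h2
  have hprim := isPrimitiveRoot_of_sq_add_self_add_one h3 hε
  obtain ⟨i, η, hη, hi, rfl⟩ := hP
  have hD : ∀ ζ : k, ζ ^ 3 = 1 → (Matrix.ProjGenLinGroup.mk (diagonalOp ε hprim.pow_eq_one) :
      PGL(3, k)) • Projectivization.mk k (flexVec 0 ζ) (flexVec_ne_zero _ _) =
        Projectivization.mk k (flexVec 0 (ε * ζ)) (flexVec_ne_zero _ _) := by
    intro ζ hζ
    rw [Projectivization.PGL.mk_smul_mk, Projectivization.mk_eq_mk_iff']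
    refine ⟨ε, ?_⟩
    ext j
    rw [units_smul_eq_mulVec, mulVec_three]
    fin_cases j <;> simp [flexVec_zero, diagonalOp]
    ring
  have h0 : ∃ g ∈ translations k, g • baseFlex k =
      Projectivization.mk k (flexVec 0 η) (flexVec_ne_zero _ _) := by
    have hmem := mk_diagonalOp_mem hprim
    rcases (cube_eq_one_iff hε η).mp hη with rfl | rfl | rfl
    · exact ⟨1, one_mem _, one_smul _ _⟩
    · refine ⟨_, hmem, ?_⟩
      rw [baseFlex, hD _ (one_pow 3)]
      simp only [mul_one]
    · refine ⟨_, mul_mem hmem hmem, ?_⟩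
      rw [mul_smul, baseFlex, hD _ (one_pow 3), hD _ (by rw [mul_one, hprim.pow_eq_one])]
      simp only [mul_one, sq]
  obtain ⟨g, hg, e⟩ := h0
  have hC := mk_cyclicOp_mem (k := k)
  have c0 : (Matrix.ProjGenLinGroup.mk (cyclicOp k) : PGL(3, k)) •
      Projectivization.mk k (flexVec 0 η) (flexVec_ne_zero _ _) =
        Projectivization.mk k (flexVec 1 η) (flexVec_ne_zero _ _) := by
    rw [Projectivization.PGL.mk_smul_mk, Projectivization.mk_eq_mk_iff']
    refine ⟨1, ?_⟩
    ext j
    rw [units_smul_eq_mulVec, mulVec_three]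
    fin_cases j <;> simp [flexVec_zero, flexVec_one, cyclicOp]
  have c1 : (Matrix.ProjGenLinGroup.mk (cyclicOp k) : PGL(3, k)) •
      Projectivization.mk k (flexVec 1 η) (flexVec_ne_zero _ _) =
        Projectivization.mk k (flexVec 2 η) (flexVec_ne_zero _ _) := by
    rw [Projectivization.PGL.mk_smul_mk, Projectivization.mk_eq_mk_iff']
    refine ⟨1, ?_⟩
    ext j
    rw [units_smul_eq_mulVec, mulVec_three]
    fin_cases j <;> simp [flexVec_one, flexVec_two, cyclicOp]
  fin_cases i
  · exact ⟨g, hg, e⟩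
  · exact ⟨_, mul_mem hC hg, by rw [mul_smul, e, c0]; rfl⟩
  · exact ⟨_, mul_mem hC (mul_mem hC hg), by rw [mul_smul, mul_smul, e, c0, c1]; rfl⟩

end Translations

/-! ### Similitudes fixing a flex. -/

section Stabilizers

theorem mulVec_eq_smul_of_smul_baseFlex {M : GL (Fin 3) k}
    (h : (Matrix.ProjGenLinGroup.mk M : PGL(3, k)) • baseFlex k = baseFlex k) :
    ∃ s : k, M.val.mulVec ![0, 1, -1] = s • ![0, 1, -1] := by
  rw [baseFlex, Projectivization.PGL.mk_smul_mk, Projectivization.mk_eq_mk_iff'] at h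
  obtain ⟨s, hs⟩ := h
  rw [flexVec_zero] at hs
  exact ⟨s, hs.symm⟩

theorem mk_eq_one_of_mulVec {M : GL (Fin 3) k} {d : k} (h : ∀ w, M.val.mulVec w = d • w) :
    (Matrix.ProjGenLinGroup.mk M : PGL(3, k)) = 1 := by
  have hd : d ≠ 0 := by
    rintro rfl
    have := h (M⁻¹.val.mulVec (x 0))
    rw [mulVec_inv_mulVec, zero_smul] at this
    simpa [x] using congrFun this 0
  have e : M = Matrix.GeneralLinearGroup.scalar (Fin 3) (Units.mk0 d hd) := by
    apply Units.ext
    apply Matrix.ext_of_mulVec_single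
    intro i
    rw [h]
    ext j
    simp [Matrix.GeneralLinearGroup.coe_scalar, Pi.single_apply]
  rw [e, Matrix.ProjGenLinGroup.mk_scalar]

/-- The similitudes of a smooth Hesse cubic preserving the flex `(0 : 1 : -1)`. -/
theorem multiplierChar_of_smul_baseFlex [IsAlgClosed k] (h2 : (2 : k) ≠ 0) (h3 : (3 : k) ≠ 0) {μ : k}
    (hμ : 1 + μ ^ 3 ≠ 0) (M : hesseSimilitudes μ)
    (hM : (Matrix.ProjGenLinGroup.mk M.1 : PGL(3, k)) • baseFlex k = baseFlex k) :
    coeffA μ * (multiplierChar μ M : k) ^ 4 = coeffA μ ∧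
      coeffB μ * (multiplierChar μ M : k) ^ 6 = coeffB μ ∧
      (multiplierChar μ M = 1 → (Matrix.ProjGenLinGroup.mk M.1 : PGL(3, k)) = 1) := by
  -- Conjugation by `N` moves the flex to infinity and changes neither the multiplier nor the
  -- determinant, so `wform_aut` computes the character.
  obtain ⟨N, κ, m, hκ, hN, hO⟩ := exists_hesse_to_wform h2 h3 hμ
  obtain ⟨M, ν, hν⟩ := M
  obtain ⟨s, hs⟩ := mulVec_eq_smul_of_smul_baseFlex hM
  have hm : m ≠ 0 := by
    rintro rfl
    refine mulVec_ne_zero N (w := ![0, 1, -1]) (fun h => ?_) (hO.trans ?_)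
    · simpa using congrFun h 1
    · ext i
      fin_cases i <;> rfl
  have hinv : ∀ w, wform (coeffA μ) (coeffB μ) w = κ * hesse μ ((N⁻¹).val.mulVec w) := fun w => by
    rw [← hN, mulVec_inv_mulVec]
  have h1 : ∀ w, wform (coeffA μ) (coeffB μ) ((N * M * N⁻¹).val.mulVec w) =
      ν * wform (coeffA μ) (coeffB μ) w := fun w => by
    rw [Units.val_mul, Units.val_mul, ← Matrix.mulVec_mulVec, ← Matrix.mulVec_mulVec, hN, hν, hinv]
    ring
  have hO' : (N⁻¹).val.mulVec ![0, 1, 0] = m⁻¹ • ![0, 1, -1] := by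
    have : (![0, 1, 0] : Fin 3 → k) = m⁻¹ • ![0, m, 0] := by
      ext i
      fin_cases i <;> simp [hm]
    rw [this, ← hO, Matrix.mulVec_smul, inv_mulVec_mulVec]
  have h2' : (N * M * N⁻¹).val.mulVec ![0, 1, 0] = ![0, s, 0] := by
    rw [Units.val_mul, Units.val_mul, ← Matrix.mulVec_mulVec, ← Matrix.mulVec_mulVec, hO',
      Matrix.mulVec_smul, hs, Matrix.mulVec_smul, Matrix.mulVec_smul, hO]
    ext i
    fin_cases i <;> simp
    field_simp
  obtain ⟨u, hu, hA, hB, hone⟩ := wform_aut h2 h3 h1 h2'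
  have hdet : (N * M * N⁻¹).val.det = M.val.det := by
    rw [← Matrix.GeneralLinearGroup.val_det_apply, map_mul, map_mul, map_inv,
      mul_inv_cancel_comm, Matrix.GeneralLinearGroup.val_det_apply]
  have hu0 : u ≠ 0 := by
    rintro rfl
    rw [zero_mul] at hu
    exact ν.ne_zero hu
  have hχ : multiplierChar μ ⟨M, ν, hν⟩ = Units.mk0 u hu0 := by
    rw [multiplierChar_eq_iff (M := ⟨M, ν, hν⟩) hν, hu, hdet]
    rfl
  rw [hχ]
  refine ⟨hA, hB, fun h => ?_⟩
  obtain ⟨d, hd⟩ := hone (by simpa using congrArg Units.val h)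
  have := mk_eq_one_of_mulVec hd
  rw [map_mul, map_mul, map_inv] at this
  simpa using this

end Stabilizers

/-! ### The structure of the stabilizer of a smooth Hesse cubic. -/

section CurveStabilizer

theorem exists_translation_mul_fixes_baseFlex [IsAlgClosed k] (h2 : (2 : k) ≠ 0) (h3 : (3 : k) ≠ 0) {μ : k}
    {P : ℙ k (Fin 3 → k)} (hP : P ∈ flexes k) :
    ∃ N ∈ (multiplierChar μ).ker, (Matrix.ProjGenLinGroup.mk N.1 : PGL(3, k)) ∈ translations k ∧
      (Matrix.ProjGenLinGroup.mk N.1 : PGL(3, k)) • baseFlex k = P := by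
  obtain ⟨g, hg, e⟩ := exists_translation_smul_baseFlex h2 h3 hP
  obtain ⟨_, ⟨N, hN, rfl⟩, rfl⟩ := translations_le μ hg
  exact ⟨N, hN, hg, e⟩

theorem baseFlex_mem : baseFlex k ∈ flexes k := ⟨0, 1, one_pow 3, flexVec_ne_zero _ _, rfl⟩

/-- Similitudes permute the flexes and translations act transitively on them, so a translation, on
which the character is trivial, corrects any similitude to one fixing the base flex. -/
theorem exists_decomposition [IsAlgClosed k] (h2 : (2 : k) ≠ 0) (h3 : (3 : k) ≠ 0) {μ : k} (hμ : 1 + μ ^ 3 ≠ 0)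
    (M : hesseSimilitudes μ) : ∃ N ∈ (multiplierChar μ).ker,
      (Matrix.ProjGenLinGroup.mk N.1 : PGL(3, k)) ∈ translations k ∧
      (Matrix.ProjGenLinGroup.mk (N⁻¹ * M).1 : PGL(3, k)) • baseFlex k = baseFlex k := by
  have hG : (Matrix.ProjGenLinGroup.mk M.1 : PGL(3, k)) ∈ hessianGroup k := by
    obtain ⟨ν, hν⟩ := M.2
    exact mk_mem_hessianGroup_of_hesse h2 h3 hμ hμ ν.ne_zero hν
  have hP : (Matrix.ProjGenLinGroup.mk M.1 : PGL(3, k)) • baseFlex k ∈ flexes k := by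
    rw [hessianGroup, MulAction.mem_stabilizer_iff] at hG
    rw [← hG]
    exact Set.smul_mem_smul_set baseFlex_mem
  obtain ⟨N, hN, hT, e⟩ := exists_translation_mul_fixes_baseFlex (μ := μ) h2 h3 hP
  refine ⟨N, hN, hT, ?_⟩
  rw [Subgroup.coe_mul, Subgroup.coe_inv, map_mul, map_inv, mul_smul, ← e, inv_smul_smul]

/-- Scaling by `u` multiplies both the multiplier and the determinant by `u³`. -/
theorem multiplierChar_eq_of_mk_eq {μ : k} {M N : hesseSimilitudes μ}
    (h : (Matrix.ProjGenLinGroup.mk M.1 : PGL(3, k)) = Matrix.ProjGenLinGroup.mk N.1) :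
    multiplierChar μ M = multiplierChar μ N := by
  obtain ⟨u, hu⟩ := Matrix.ProjGenLinGroup.mk_eq_mk_iff.mp h
  obtain ⟨ν, hν⟩ := M.2
  have hmul : ∀ w, N.1.val.mulVec w = (u : k) • M.1.val.mulVec w := by
    intro w
    rw [← hu, Units.val_mul, Matrix.GeneralLinearGroup.coe_scalar, ← Matrix.mulVec_mulVec,
      Matrix.scalar_apply, ← Matrix.smul_one_eq_diagonal, Matrix.smul_mulVec, Matrix.one_mulVec,
      Matrix.mulVec_smul]
  have hN : ∀ w, hesse μ (N.1.val.mulVec w) = (u ^ 3 * ν : k) * hesse μ w := by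
    intro w
    rw [hmul, hesse_smul, hν, mul_assoc]
  have hdet : N.1.val.det = u ^ 3 * M.1.val.det := by
    rw [← hu, Units.val_mul, Matrix.GeneralLinearGroup.coe_scalar, Matrix.det_mul,
      Matrix.scalar_apply, Matrix.det_diagonal, mul_comm]
    simp
  symm
  rw [multiplierChar_eq_iff hN, hdet, (multiplierChar_eq_iff hν _).mp rfl]
  ring

/-- The kernel of the character is exactly the translation group: after correction by a translation,
an element of the kernel fixes the base flex and is therefore projectively trivial. -/
theorem mk_mem_translations_iff [IsAlgClosed k] (h2 : (2 : k) ≠ 0) (h3 : (3 : k) ≠ 0) {μ : k}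
    (hμ : 1 + μ ^ 3 ≠ 0) (M : hesseSimilitudes μ) :
    (Matrix.ProjGenLinGroup.mk M.1 : PGL(3, k)) ∈ translations k ↔ multiplierChar μ M = 1 := by
  constructor
  · intro h
    obtain ⟨_, ⟨N, hN, rfl⟩, e⟩ := translations_le μ h
    rw [← multiplierChar_eq_of_mk_eq e]
    exact hN
  · intro h
    obtain ⟨N, hN, hT, hfix⟩ := exists_decomposition h2 h3 hμ M
    have hχ : multiplierChar μ (N⁻¹ * M) = 1 := by
      rw [map_mul, map_inv, h, (MonoidHom.mem_ker.mp hN), inv_one, one_mul]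
    have := (multiplierChar_of_smul_baseFlex h2 h3 hμ _ hfix).2.2 hχ
    rw [Subgroup.coe_mul, Subgroup.coe_inv, map_mul, map_inv, inv_mul_eq_one] at this
    rwa [← this]

theorem nat_card_translations [IsAlgClosed k] (h2 : (2 : k) ≠ 0) (h3 : (3 : k) ≠ 0) :
    Nat.card (translations k) = 9 := by
  -- The Fermat cubic is an auxiliary choice: it shows that a translation fixing the base flex is
  -- trivial, so translations are in bijection with the flexes.
  have hμ : 1 + (0 : k) ^ 3 ≠ 0 := by simp
  have hrep : ∀ g ∈ translations k, ∃ N ∈ (multiplierChar (0 : k)).ker,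
      Matrix.ProjGenLinGroup.mk N.1 = g := by
    intro g hg
    obtain ⟨_, ⟨N, hN, rfl⟩, e⟩ := translations_le 0 hg
    exact ⟨N, hN, e⟩
  have hflex : ∀ g : translations k, g.1 • baseFlex k ∈ flexes k := by
    rintro ⟨g, hg⟩
    obtain ⟨N, -, rfl⟩ := hrep g hg
    obtain ⟨ν, hν⟩ := N.2
    have hG := mk_mem_hessianGroup_of_hesse h2 h3 hμ hμ ν.ne_zero hν
    rw [hessianGroup, MulAction.mem_stabilizer_iff] at hG
    rw [← hG]
    exact Set.smul_mem_smul_set baseFlex_mem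
  let f : translations k → flexes k := fun g => ⟨g.1 • baseFlex k, hflex g⟩
  have hf : Function.Bijective f := by
    constructor
    · intro g g' h
      have h' : g.1 • baseFlex k = g'.1 • baseFlex k := congrArg Subtype.val h
      obtain ⟨N, hN, e⟩ := hrep _ (g⁻¹ * g').2
      have := (multiplierChar_of_smul_baseFlex h2 h3 hμ N (by
        rw [e, Subgroup.coe_mul, Subgroup.coe_inv, mul_smul, ← h', inv_smul_smul])).2.2 hN
      rw [e] at this
      exact inv_mul_eq_one.mp (Subtype.ext this)
    · rintro ⟨P, hP⟩
      obtain ⟨g, hg, e⟩ := exists_translation_smul_baseFlex h2 h3 hP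
      exact ⟨⟨g, hg⟩, Subtype.ext e⟩
  rw [Nat.card_congr (Equiv.ofBijective f hf), nat_card_flexes h2 h3]

theorem mem_range_multiplierChar_iff [IsAlgClosed k] (h2 : (2 : k) ≠ 0) (h3 : (3 : k) ≠ 0) {μ : k}
    (hμ : 1 + μ ^ 3 ≠ 0) (u : kˣ) : u ∈ (multiplierChar μ).range ↔
      coeffA μ * (u : k) ^ 4 = coeffA μ ∧ coeffB μ * (u : k) ^ 6 = coeffB μ := by
  constructor
  · rintro ⟨M, rfl⟩
    obtain ⟨N, hN, -, hfix⟩ := exists_decomposition h2 h3 hμ M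
    have := multiplierChar_of_smul_baseFlex h2 h3 hμ _ hfix
    rw [map_mul, map_inv, (MonoidHom.mem_ker.mp hN), inv_one, one_mul] at this
    exact ⟨this.1, this.2.1⟩
  · rintro ⟨hA, hB⟩
    obtain ⟨N, κ, m, hκ, hN, -⟩ := exists_hesse_to_wform h2 h3 hμ
    have hdet : (Matrix.diagonal ![(u : k) ^ 2, (u : k) ^ 3, 1]).det = (u : k) ^ 5 := by
      rw [Matrix.det_diagonal, Fin.prod_univ_three]
      simp
      ring
    -- This operator has multiplier `u⁶` on the Weierstrass cubic and determinant `u⁵`, so its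
    -- character value is `u`.
    let D := Matrix.GeneralLinearGroup.mkOfDetNeZero (Matrix.diagonal ![(u : k) ^ 2, (u : k) ^ 3, 1])
      (by rw [hdet]; exact pow_ne_zero 5 u.ne_zero)
    have h : ∀ w, hesse μ ((N⁻¹ * D * N).val.mulVec w) = (u ^ 6 : kˣ) * hesse μ w := by
      intro w
      apply mul_left_cancel₀ hκ
      rw [← hN, Units.val_mul, Units.val_mul, ← Matrix.mulVec_mulVec, ← Matrix.mulVec_mulVec,
        mulVec_inv_mulVec]
      change wform _ _ ((Matrix.diagonal ![(u : k) ^ 2, (u : k) ^ 3, 1]).mulVec _) = _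
      rw [wform_diagonal hA hB, hN, Units.val_pow_eq_pow_val]
      ring
    refine ⟨⟨N⁻¹ * D * N, u ^ 6, h⟩, ?_⟩
    rw [multiplierChar_eq_iff (M := ⟨N⁻¹ * D * N, u ^ 6, h⟩) h, Units.val_pow_eq_pow_val]
    have : (N⁻¹ * D * N).val.det = u ^ 5 := by
      rw [← Matrix.GeneralLinearGroup.val_det_apply, map_mul, map_mul, map_inv,
        mul_right_comm, inv_mul_cancel, one_mul, Matrix.GeneralLinearGroup.val_det_apply]
      exact hdet
    rw [this]
    ring

theorem relIndex_translations [IsAlgClosed k] (h2 : (2 : k) ≠ 0) (h3 : (3 : k) ≠ 0) {μ : k}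
    (hμ : 1 + μ ^ 3 ≠ 0) : (translations k).relIndex (curveStabilizer (hesseCurve μ)) =
      Nat.card (multiplierChar μ).range := by
  rw [curveStabilizer_eq_map h2 h3 hμ, ← Subgroup.relIndex_comap, Subgroup.relIndex,
    ← Subgroup.index_ker]
  congr 1
  ext M
  rw [Subgroup.mem_subgroupOf, Subgroup.mem_comap, mk_mem_translations_iff h2 h3 hμ,
    MonoidHom.mem_ker]

theorem translations_le_curveStabilizer [IsAlgClosed k] (h2 : (2 : k) ≠ 0) (h3 : (3 : k) ≠ 0) {μ : k}
    (hμ : 1 + μ ^ 3 ≠ 0) : translations k ≤ curveStabilizer (hesseCurve μ) := by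
  rw [curveStabilizer_eq_map h2 h3 hμ]
  refine (translations_le μ).trans (Subgroup.map_mono ?_)
  rintro _ ⟨M, -, rfl⟩
  exact M.2

theorem nat_card_range_multiplierChar [IsAlgClosed k] (h2 : (2 : k) ≠ 0) (h3 : (3 : k) ≠ 0) {μ : k}
    (hμ : 1 + μ ^ 3 ≠ 0) {n : ℕ} (hn : (n : k) ≠ 0)
    (h : ∀ u : k, coeffA μ * u ^ 4 = coeffA μ ∧ coeffB μ * u ^ 6 = coeffB μ ↔ u ^ n = 1) :
    Nat.card (multiplierChar μ).range = n := by
  have : NeZero (n : k) := ⟨hn⟩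
  have : NeZero n := NeZero.of_neZero_natCast k
  rw [← HasEnoughRootsOfUnity.natCard_rootsOfUnity k n]
  congr
  ext u
  rw [mem_range_multiplierChar_iff h2 h3 hμ, h, mem_rootsOfUnity, Units.ext_iff]
  simp

end CurveStabilizer

/-! ### The `j`-invariant of a Hesse cubic. -/

section JInvariant

/-- The `j`-invariant of a member of the Hesse pencil. -/
def hesseJ (μ : k) : k := -27 * (μ * (μ ^ 3 - 8)) ^ 3 / (1 + μ ^ 3) ^ 3

theorem shortCurve_c₄ (A B : k) : (shortCurve A B).c₄ = -48 * A := by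
  simp [shortCurve, WeierstrassCurve.c₄, WeierstrassCurve.b₂, WeierstrassCurve.b₄]
  ring

theorem shortCurve_Δ (A B : k) : (shortCurve A B).Δ = -16 * (4 * A ^ 3 + 27 * B ^ 2) := by
  simp [shortCurve, WeierstrassCurve.Δ, WeierstrassCurve.b₂, WeierstrassCurve.b₄,
    WeierstrassCurve.b₆, WeierstrassCurve.b₈]
  ring

theorem shortCurve_coeffs_Δ (μ : k) :
    (shortCurve (coeffA μ) (coeffB μ)).Δ = -(2 ^ 12 * 3 ^ 3) * (1 + μ ^ 3) ^ 3 := by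
  rw [shortCurve_Δ, discr_coeffs]
  ring

theorem shortCurve_coeffs_Δ_ne_zero (h2 : (2 : k) ≠ 0) (h3 : (3 : k) ≠ 0) {μ : k}
    (hμ : 1 + μ ^ 3 ≠ 0) : (shortCurve (coeffA μ) (coeffB μ)).Δ ≠ 0 := by
  rw [shortCurve_coeffs_Δ]
  exact mul_ne_zero (neg_ne_zero.mpr (mul_ne_zero (pow_ne_zero _ h2) (pow_ne_zero _ h3)))
    (pow_ne_zero _ hμ)

theorem c₄_cube_div_Δ_eq_hesseJ (h2 : (2 : k) ≠ 0) (h3 : (3 : k) ≠ 0) {μ : k}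
    (hμ : 1 + μ ^ 3 ≠ 0) : (shortCurve (coeffA μ) (coeffB μ)).c₄ ^ 3 /
      (shortCurve (coeffA μ) (coeffB μ)).Δ = hesseJ μ := by
  rw [div_eq_iff (shortCurve_coeffs_Δ_ne_zero h2 h3 hμ), hesseJ, shortCurve_coeffs_Δ,
    shortCurve_c₄, coeffA]
  field_simp
  ring

open MvPolynomial in
theorem isHomogeneous_weierstrassPolynomial (W : WeierstrassCurve k) :
    W.toProjective.polynomial.IsHomogeneous 3 := by
  have h := fun i : Fin 3 => isHomogeneous_X k i
  have hC := fun c : k => isHomogeneous_C (Fin 3) c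
  rw [WeierstrassCurve.Projective.polynomial]
  exact (((((h 1).pow 2).mul (h 2)).add ((((hC _).mul (h 0)).mul (h 1)).mul (h 2))).add
    (((hC _).mul (h 1)).mul ((h 2).pow 2))).sub (((((h 0).pow 3).add
    (((hC _).mul ((h 0).pow 2)).mul (h 2))).add (((hC _).mul (h 0)).mul ((h 2).pow 2))).add
    ((hC _).mul ((h 2).pow 3)))

/-- For uniqueness, the point at infinity of any Weierstrass model pulls back to one of the nine
flexes. A translation makes it the base flex, so the comparison with the standard model preserves
infinity and is a Weierstrass change of variables up to scale. -/
theorem isJInvariant_hesseCurve_iff [IsAlgClosed k] (h2 : (2 : k) ≠ 0) (h3 : (3 : k) ≠ 0) {μ : k}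
    (hμ : 1 + μ ^ 3 ≠ 0) (j : k) : IsJInvariant (hesseCurve μ) j ↔ j = hesseJ μ := by
  obtain ⟨N, κ, m, hκ, hN, hO⟩ := exists_hesse_to_wform h2 h3 hμ
  have hcurve : ∀ (W : WeierstrassCurve k) (M : GL (Fin 3) k),
      (Matrix.ProjGenLinGroup.mk M : PGL(3, k)) • hesseCurve μ = curve W.toProjective.polynomial ↔
        ∀ w, hesse μ w = 0 ↔ weierstrassForm W (M.val.mulVec w) = 0 := by
    intro W M
    rw [hesseCurve, smul_curve_eq_iff three_ne_zero (isHomogeneous_cubic _ _ _) 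
      (isHomogeneous_weierstrassPolynomial W)]
    simp only [eval_cubic_one]
    rfl
  rw [← c₄_cube_div_Δ_eq_hesseJ h2 h3 hμ]
  constructor
  · rintro ⟨W, hW, g, hg, rfl⟩
    obtain ⟨M, rfl⟩ := Matrix.ProjGenLinGroup.mk_surjective g
    rw [hcurve] at hg
    obtain ⟨ν, hν, hM⟩ := exists_multiplier h2 h3 hμ (isCubicForm_weierstrassForm W) M hg
    have hinv : ∀ w, hesse μ ((M⁻¹).val.mulVec w) = ν⁻¹ * weierstrassForm W w := fun w => by
      rw [eq_inv_mul_iff_mul_eq₀ hν, ← hM, mulVec_inv_mulVec]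
    have hne : (![0, 1, 0] : Fin 3 → k) ≠ 0 := fun h => by simpa using congrFun h 1
    have hflex := of_isFlex_hesse h2 h3 hμ (mulVec_ne_zero M⁻¹ hne)
      ((isFlex_weierstrassForm W).map_mulVec M⁻¹ hinv)
    rw [← mk_mem_flexes_iff (mulVec_ne_zero M⁻¹ hne)] at hflex
    obtain ⟨L, -, -, hL⟩ := exists_translation_mul_fixes_baseFlex (μ := μ) h2 h3 hflex
    obtain ⟨ν', hν'⟩ := L.2
    rw [baseFlex, Projectivization.PGL.mk_smul_mk, Projectivization.mk_eq_mk_iff'] at hL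
    obtain ⟨s, hs⟩ := hL
    rw [flexVec_zero, units_smul_eq_mulVec] at hs
    have hm : m ≠ 0 := by
      rintro rfl
      refine mulVec_ne_zero N (w := ![0, 1, -1]) (fun h => ?_) (hO.trans ?_)
      · simpa using congrFun h 1
      · ext i
        fin_cases i <;> rfl
    have hO' : (N⁻¹).val.mulVec ![0, 1, 0] = m⁻¹ • ![0, 1, -1] := by
      have : (![0, 1, 0] : Fin 3 → k) = m⁻¹ • ![0, m, 0] := by
        ext i
        fin_cases i <;> simp [hm]
      rw [this, ← hO, Matrix.mulVec_smul, inv_mulVec_mulVec]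
    refine j_eq_of_weierstrassForm_map (M := M * L.1 * N⁻¹) (ν := ν * (ν' * κ⁻¹))
      (m := m⁻¹ * s) h2 (fun w => ?_) ?_
    · rw [Units.val_mul, Units.val_mul, ← Matrix.mulVec_mulVec, ← Matrix.mulVec_mulVec, hM, hν']
      have := hN ((N⁻¹).val.mulVec w)
      rw [mulVec_inv_mulVec] at this
      rw [this]
      field_simp
    · rw [Units.val_mul, Units.val_mul, ← Matrix.mulVec_mulVec, ← Matrix.mulVec_mulVec, hO',
        Matrix.mulVec_smul, Matrix.mulVec_smul]
      have e : L.1.val.mulVec ![0, 1, -1] = s • (M⁻¹).val.mulVec ![0, 1, 0] := by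
        exact hs.symm
      rw [e, Matrix.mulVec_smul, mulVec_inv_mulVec]
      ext i
      fin_cases i <;> simp
  · rintro rfl
    have hell : (shortCurve (coeffA μ) (coeffB μ)).IsElliptic :=
      ⟨(shortCurve_coeffs_Δ_ne_zero h2 h3 hμ).isUnit⟩
    refine ⟨shortCurve (coeffA μ) (coeffB μ), hell, Matrix.ProjGenLinGroup.mk N, ?_, ?_⟩
    · rw [hcurve]
      intro w
      rw [weierstrassForm_shortCurve, hN, mul_eq_zero]
      simp [hκ]
    · rw [WeierstrassCurve.j, Units.val_inv_eq_inv_val, WeierstrassCurve.coe_Δ']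
      field_simp

end JInvariant

/-! ### The order of the Hessian group. -/

section HessianGroup

theorem natCast_six_ne_zero (h2 : (2 : k) ≠ 0) (h3 : (3 : k) ≠ 0) : ((6 : ℕ) : k) ≠ 0 := by
  have : ((6 : ℕ) : k) = 2 * 3 := by norm_num
  rw [this]
  exact mul_ne_zero h2 h3

/-- At `μ = 0` the coefficient `A` vanishes and `B` does not, so the character takes its values in
all sixth roots of unity: `9 · 6 = 54`. -/
theorem nat_card_curveStabilizer_fermat [IsAlgClosed k] (h2 : (2 : k) ≠ 0) (h3 : (3 : k) ≠ 0) :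
    Nat.card (curveStabilizer (hesseCurve (0 : k))) = 54 := by
  have hμ : 1 + (0 : k) ^ 3 ≠ 0 := by simp
  have hB : coeffB (0 : k) ≠ 0 := by
    have : coeffB (0 : k) = -2 ^ 4 := by
      rw [coeffB]
      norm_num
    rw [this]
    exact neg_ne_zero.mpr (pow_ne_zero 4 h2)
  have h := Subgroup.relIndex_mul_relIndex ⊥ (translations k) (curveStabilizer (hesseCurve (0 : k)))
    bot_le (translations_le_curveStabilizer h2 h3 hμ)
  rw [Subgroup.relIndex_bot_left, Subgroup.relIndex_bot_left, nat_card_translations h2 h3,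
    relIndex_translations h2 h3 hμ, nat_card_range_multiplierChar h2 h3 hμ
      (natCast_six_ne_zero h2 h3) fun u => by simp [coeffA, hB]] at h
  exact h.symm

/-- A point `(r : 1 : 1)` of the curve satisfies `r³ + 3μr + 2 = 0`, so `r ≠ 0` and the point
determines `μ`. -/
theorem hesseCurve_injective [IsAlgClosed k] (h2 : (2 : k) ≠ 0) (h3 : (3 : k) ≠ 0) :
    Function.Injective (hesseCurve : k → Set (ℙ k (Fin 3 → k))) := by
  intro μ μ' h
  open Polynomial in
  obtain ⟨r, hr⟩ := IsAlgClosed.exists_root (.X ^ 3 + C (3 * μ) * .X + C 2 : k[X]) (by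
    have : (.X ^ 3 + C (3 * μ) * .X + C 2 : k[X]).degree = 3 := by compute_degree!
    rw [this]
    norm_num)
  have hr' : r ^ 3 + 3 * μ * r + 2 = 0 := by simpa using hr
  have hne : (![r, 1, 1] : Fin 3 → k) ≠ 0 := fun h => by simpa using congrFun h 1
  have h1 : Projectivization.mk k _ hne ∈ hesseCurve μ := by
    rw [mk_mem_hesseCurve]
    simp [hesse]
    linear_combination hr'
  rw [h, mk_mem_hesseCurve] at h1
  simp [hesse] at h1
  have hr0 : r ≠ 0 := by
    rintro rfl
    apply h2
    linear_combination hr'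
  apply mul_left_cancel₀ (mul_ne_zero h3 hr0)
  linear_combination hr' - h1

theorem ncard_equianharmonic_parameters [IsAlgClosed k] (h2 : (2 : k) ≠ 0) (h3 : (3 : k) ≠ 0) :
    {μ : k | μ * (μ ^ 3 - 8) = 0}.ncard = 4 := by
  have e : {μ : k | μ * (μ ^ 3 - 8) = 0} = insert 0 ((fun η => 2 * η) '' {η : k | η ^ 3 = 1}) := by
    ext μ
    simp only [Set.mem_ofPred_eq, Set.mem_insert_iff, Set.mem_image, mul_eq_zero]
    refine or_congr_right ⟨fun h => ⟨μ / 2, ?_, ?_⟩, ?_⟩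
    · field_simp
      linear_combination h
    · field_simp
    · rintro ⟨η, hη, rfl⟩
      linear_combination 8 * hη
  have h3c : {η : k | η ^ 3 = 1}.ncard = 3 := nat_card_cube_roots h2 h3
  have hinj : Function.Injective fun η : k => 2 * η := mul_right_injective₀ h2
  have hfin : ((fun η => 2 * η) '' {η : k | η ^ 3 = 1}).Finite :=
    (Set.finite_of_ncard_ne_zero (by rw [h3c]; norm_num)).image _
  rw [e, Set.ncard_insert_of_notMem _ hfin, Set.ncard_image_of_injective _ hinj, h3c]
  rintro ⟨η, hη, h0⟩
  have : η = 0 := by simpa [h2] using h0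
  subst this
  simp at hη

theorem IsJInvariant.smul {S : Set (ℙ k (Fin 3 → k))} {j : k} (h : IsJInvariant S j)
    (g : PGL(3, k)) : IsJInvariant (g • S) j := by
  obtain ⟨W, hW, g', e, hj⟩ := h
  exact ⟨W, hW, g' * g⁻¹, by rw [smul_smul, inv_mul_cancel_right, e], hj⟩

/-- The transformed Fermat cubic passes through the nine points, hence lies in the pencil.
Degenerate members are excluded because they contain lines, whose points all satisfy `IsFlex`. -/
theorem exists_hesseCurve_of_mem_hessianGroup [IsAlgClosed k] (h2 : (2 : k) ≠ 0)
    (h3 : (3 : k) ≠ 0) {g : PGL(3, k)} (hg : g ∈ hessianGroup k) :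
    ∃ μ : k, 1 + μ ^ 3 ≠ 0 ∧ g • hesseCurve (0 : k) = hesseCurve μ := by
  obtain ⟨M, rfl⟩ := Matrix.ProjGenLinGroup.mk_surjective g
  have h0 : 1 + (0 : k) ^ 3 ≠ 0 := by simp
  rw [hessianGroup, MulAction.mem_stabilizer_iff, smul_eq_iff_forall_mk] at hg
  have hF : IsCubicForm fun w => hesse 0 ((M⁻¹).val.mulVec w) :=
    (isCubicForm_hesse 0).comp_mulVec _
  have hiff : ∀ w : Fin 3 → k, w ≠ 0 → (((M⁻¹).val.mulVec w 0 * (M⁻¹).val.mulVec w 1 *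
      (M⁻¹).val.mulVec w 2 = 0 ∧ (M⁻¹).val.mulVec w 0 ^ 3 + (M⁻¹).val.mulVec w 1 ^ 3 +
      (M⁻¹).val.mulVec w 2 ^ 3 = 0) ↔ w 0 * w 1 * w 2 = 0 ∧ w 0 ^ 3 + w 1 ^ 3 + w 2 ^ 3 = 0) := by
    intro w hw
    have := hg _ (mulVec_ne_zero M⁻¹ hw)
    rw [mk_mem_flexes_iff, mk_mem_flexes_iff, mulVec_inv_mulVec] at this
    exact this
  obtain ⟨α, β, hαβ⟩ := hF.eq_pencil h2 h3 fun w hq hs => by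
    by_cases hw : w = 0
    · rw [hw, Matrix.mulVec_zero, hesse_zero]
    · have := ((hiff w hw).mpr ⟨hq, hs⟩).2
      rw [hesse, this]
      ring
  have hflex : ∀ w : Fin 3 → k, w ≠ 0 → IsFlex (fun w => hesse 0 ((M⁻¹).val.mulVec w)) w →
      w 0 * w 1 * w 2 = 0 ∧ w 0 ^ 3 + w 1 ^ 3 + w 2 ^ 3 = 0 := by
    intro w hw h
    rw [← hiff w hw]
    exact of_isFlex_hesse h2 h3 h0 (mulVec_ne_zero M⁻¹ hw)
      (h.map_mulVec (ν := 1) M⁻¹ fun w => (one_mul _).symm)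
  -- Otherwise the form is a multiple of `w₀w₁w₂`, which vanishes on the line `w 0 = 0`; the point
  -- `(0 : 1 : 1)` there is not one of the nine.
  have hα : α ≠ 0 := by
    rintro rfl
    have := (hflex ![0, 1, 1] (fun h => by simpa using congrFun h 1)
      ⟨![0, 1, 0], fun s hs => ?_, fun r s => ?_⟩).2
    · apply h2
      simp at this
      linear_combination this
    · have e1 := congrFun hs 1
      have e2 := congrFun hs 2
      simp at e1 e2
      rw [← e2] at e1
      exact one_ne_zero e1
    · simp only [hαβ]
      simp
  obtain ⟨μ, hμ⟩ : ∃ μ, β = α * (3 * μ) := ⟨β / (3 * α), by field_simp⟩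
  have hF' : ∀ w, hesse 0 ((M⁻¹).val.mulVec w) = α * hesse μ w := by
    intro w
    rw [hαβ, hμ, hesse]
    ring
  -- Otherwise the cubic contains the line `w₀ + w₁ = μw₂`; its point `(1 : 1 : -2μ²)` has no zero
  -- coordinate, so it is not one of the nine.
  have hD : 1 + μ ^ 3 ≠ 0 := by
    intro hD
    have hμ3 : (-μ) ^ 3 = 1 := by linear_combination -hD
    have hfac := fun w : Fin 3 → k => mul_sum_cubes_factor (w 0) (w 1) (w 2) 1 (-μ) hμ3
    have hline : ∀ w : Fin 3 → k, w 0 + w 1 - μ * w 2 = 0 → hesse μ w = 0 := by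
      intro w hw
      rw [hesse]
      linear_combination hfac w + (w 0 ^ 2 + w 1 ^ 2 + μ ^ 2 * w 2 ^ 2 - w 0 * w 1 +
        μ * w 0 * w 2 + μ * w 1 * w 2) * hw
    have hμ0 : μ ≠ 0 := by
      rintro rfl
      simp at hD
    have := (hflex ![1, 1, -2 * μ ^ 2] (fun h => by simpa using congrFun h 1)
      ⟨![1, -1, 0], fun s hs => ?_, fun r s => ?_⟩).1
    · simp [h2, hμ0] at this
    · have e1 := congrFun hs 0
      have e2 := congrFun hs 1
      simp at e1 e2
      apply h2
      linear_combination e1 - e2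
    · simp only [hF']
      rw [hline, hline]
      · ring
      · simp
      · simp
        linear_combination 2 * r * hD
  refine ⟨μ, hD, ?_⟩
  rw [smul_hesseCurve_eq_iff]
  intro w
  have := hF' (M.val.mulVec w)
  rw [inv_mulVec_mulVec] at this
  rw [this, mul_eq_zero]
  simp [hα]

/-- Both cubics have Weierstrass forms with `A = 0`, related by `diag(e², e³, 1)` with `e⁶` the
ratio of the coefficients `B`. A linear map between smooth Hesse cubics carries flexes to flexes, so
it lies in the Hessian group. -/
theorem exists_mem_hessianGroup_smul_fermat [IsAlgClosed k] (h2 : (2 : k) ≠ 0) (h3 : (3 : k) ≠ 0)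
    {μ : k} (hμ : μ * (μ ^ 3 - 8) = 0) :
    ∃ g ∈ hessianGroup k, g • hesseCurve (0 : k) = hesseCurve μ := by
  have hD : 1 + μ ^ 3 ≠ 0 := by
    rcases mul_eq_zero.mp hμ with rfl | h
    · simp
    · intro h'
      apply pow_ne_zero 2 h3
      linear_combination h' - h
  have h0 : 1 + (0 : k) ^ 3 ≠ 0 := by simp
  have hA : ∀ μ : k, μ * (μ ^ 3 - 8) = 0 → coeffA μ = 0 := by
    intro μ h
    rw [coeffA]
    linear_combination -3 * h
  have hB : ∀ μ : k, 1 + μ ^ 3 ≠ 0 → μ * (μ ^ 3 - 8) = 0 → coeffB μ ≠ 0 := by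
    intro μ hD h h'
    have := discr_coeffs μ
    rw [hA μ h, h'] at this
    have h6 : (6912 : k) = 2 ^ 8 * 3 ^ 3 := by norm_num
    rw [h6] at this
    refine mul_ne_zero (mul_ne_zero (pow_ne_zero 8 h2) (pow_ne_zero 3 h3)) (pow_ne_zero 3 hD)
      (this.symm.trans ?_)
    ring
  obtain ⟨N, κ, m, hκ, hN, -⟩ := exists_hesse_to_wform h2 h3 h0
  obtain ⟨N', κ', m', hκ', hN', -⟩ := exists_hesse_to_wform h2 h3 hD
  rw [hA 0 (by simp)] at hN
  rw [hA μ hμ] at hN'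
  have hB0 := hB 0 h0 (by simp)
  have hBμ := hB μ hD hμ
  obtain ⟨e, he⟩ := IsAlgClosed.exists_pow_nat_eq (coeffB μ / coeffB 0) (n := 6) (by norm_num)
  have he0 : e ≠ 0 := by
    rintro rfl
    rw [zero_pow (by norm_num), eq_comm, div_eq_zero_iff] at he
    tauto
  have he' : e ^ 6 * coeffB 0 = coeffB μ := by
    rw [he]
    field_simp
  have hdet : (Matrix.diagonal ![e ^ 2, e ^ 3, 1]).det ≠ 0 := by
    rw [Matrix.det_diagonal, Fin.prod_univ_three]
    simp [he0]
  let D := Matrix.GeneralLinearGroup.mkOfDetNeZero (Matrix.diagonal ![e ^ 2, e ^ 3, 1]) hdet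
  have hM : ∀ w, hesse μ ((N'⁻¹ * D * N).val.mulVec w) = κ'⁻¹ * (e ^ 6 * κ) * hesse 0 w := by
    intro w
    rw [mul_assoc κ'⁻¹, eq_inv_mul_iff_mul_eq₀ hκ', ← hN', Units.val_mul, Units.val_mul,
      ← Matrix.mulVec_mulVec, ← Matrix.mulVec_mulVec, mulVec_inv_mulVec, mul_assoc, ← hN]
    change wform _ _ ((Matrix.diagonal ![e ^ 2, e ^ 3, 1]).mulVec _) = _
    simp only [wform, Matrix.mulVec_diagonal, Matrix.cons_val]
    linear_combination (N.val.mulVec w 2) ^ 3 * he'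
  have hν : κ'⁻¹ * (e ^ 6 * κ) ≠ 0 :=
    mul_ne_zero (inv_ne_zero hκ') (mul_ne_zero (pow_ne_zero 6 he0) hκ)
  refine ⟨Matrix.ProjGenLinGroup.mk (N'⁻¹ * D * N),
    mk_mem_hessianGroup_of_hesse h2 h3 h0 hD hν hM, ?_⟩
  rw [smul_hesseCurve_eq_iff]
  intro w
  rw [hM, mul_eq_zero]
  simp only [hν, false_or]

theorem orbit_fermat [IsAlgClosed k] (h2 : (2 : k) ≠ 0) (h3 : (3 : k) ≠ 0) :
    MulAction.orbit (hessianGroup k) (hesseCurve (0 : k)) =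
      hesseCurve '' {μ : k | μ * (μ ^ 3 - 8) = 0} := by
  have h0 : 1 + (0 : k) ^ 3 ≠ 0 := by simp
  ext S
  constructor
  · rintro ⟨⟨g, hg⟩, rfl⟩
    obtain ⟨μ, hμ, e⟩ := exists_hesseCurve_of_mem_hessianGroup h2 h3 hg
    refine ⟨μ, ?_, e.symm⟩
    have hj : IsJInvariant (hesseCurve (0 : k)) 0 := by
      rw [isJInvariant_hesseCurve_iff h2 h3 h0, hesseJ]
      simp
    have := hj.smul g
    rw [e, isJInvariant_hesseCurve_iff h2 h3 hμ, hesseJ, eq_comm, div_eq_zero_iff] at this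
    have h27 : (-27 : k) = -3 ^ 3 := by norm_num
    simpa [hμ, h27, h3] using this
  · rintro ⟨μ, hμ, rfl⟩
    obtain ⟨g, hg, e⟩ := exists_mem_hessianGroup_smul_fermat h2 h3 hμ
    exact ⟨⟨g, hg⟩, e⟩

theorem nat_card_hessianGroup [IsAlgClosed k] (h2 : (2 : k) ≠ 0) (h3 : (3 : k) ≠ 0) :
    Nat.card (hessianGroup k) = 216 := by
  have h0 : 1 + (0 : k) ^ 3 ≠ 0 := by simp
  have h := Subgroup.relIndex_mul_relIndex ⊥ (curveStabilizer (hesseCurve (0 : k))) (hessianGroup k)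
    bot_le (curveStabilizer_le_hessianGroup h2 h3 h0)
  have hindex : (curveStabilizer (hesseCurve (0 : k))).relIndex (hessianGroup k) = 4 := by
    have e : (curveStabilizer (hesseCurve (0 : k))).subgroupOf (hessianGroup k) =
        MulAction.stabilizer (hessianGroup k) (hesseCurve (0 : k)) := by
      ext g
      rfl
    rw [Subgroup.relIndex, e, MulAction.index_stabilizer, orbit_fermat h2 h3,
      Set.ncard_image_of_injective _ (hesseCurve_injective h2 h3),
      ncard_equianharmonic_parameters h2 h3]
  rw [Subgroup.relIndex_bot_left, Subgroup.relIndex_bot_left, hindex,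
    nat_card_curveStabilizer_fermat h2 h3] at h
  exact h.symm

end HessianGroup

/-! ### Exponential growth of the degenerate algebras. -/

section Growth

theorem exists_lt_two_pow (C e : ℕ) : ∃ n : ℕ, C * (2 * n + 1) ^ e < 2 ^ n := by
  have h := tendsto_pow_const_div_const_pow_of_one_lt e (one_lt_two : (1 : ℝ) < 2)
  have hpos : (0 : ℝ) < 1 / (C * 3 ^ e + 1) := by positivity
  obtain ⟨n, hn, h1⟩ := ((h.eventually_lt_const hpos).and (Filter.eventually_ge_atTop 1)).exists
  refine ⟨n, ?_⟩
  have h2 : (2 * n + 1) ^ e ≤ 3 ^ e * n ^ e := by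
    rw [← mul_pow]
    exact Nat.pow_le_pow_left (by omega) e
  rw [div_lt_div_iff₀ (by positivity) (by positivity)] at hn
  have h3 : n ^ e * (C * 3 ^ e + 1) < 1 * 2 ^ n := by exact_mod_cast hn
  calc C * (2 * n + 1) ^ e ≤ C * (3 ^ e * n ^ e) := Nat.mul_le_mul_left _ h2
    _ ≤ n ^ e * (C * 3 ^ e + 1) := by
      rw [mul_add, mul_one]
      have : C * (3 ^ e * n ^ e) = n ^ e * (C * 3 ^ e) := by ring
      omega
    _ < 2 ^ n := by omega

/-- The algebra homomorphism from `Skl_3(a,b,c)` defined by three elements satisfying the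
relations. -/
theorem exists_algHom {a b c : k} {B : Type v} [Ring B] [Algebra k B] (l : (Fin 3 → k) →ₗ[k] B)
    (h : ∀ i, a • (l (x (i + 1)) * l (x (i - 1))) + b • (l (x (i - 1)) * l (x (i + 1))) +
      c • (l (x i) * l (x i)) = 0) :
    ∃ ψ : Alg a b c →ₐ[k] B, ∀ y, ψ (proj a b c y) = TensorAlgebra.lift k l y := by
  have h' : ∀ ⦃s s₀ : TensorAlgebra k (Fin 3 → k)⦄, (∃ i, s = relTensor a b c i ∧ s₀ = 0) →
      TensorAlgebra.lift k l s = TensorAlgebra.lift k l s₀ := by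
    rintro _ _ ⟨i, rfl, rfl⟩
    simp only [relTensor, X, map_add, map_smul, map_mul, TensorAlgebra.lift_ι_apply, map_zero, h]
  exact ⟨RingQuot.liftAlgHom k ⟨TensorAlgebra.lift k l, h'⟩,
    fun y => RingQuot.liftAlgHom_mkAlgHom_apply _ _ h' y⟩

/-- The free algebra on two generators. -/
abbrev WordAlgebra (k : Type u) [Field k] : Type u := MonoidAlgebra k (FreeMonoid Bool)

theorem linearIndependent_words : LinearIndependent k (MonoidAlgebra.of k (FreeMonoid Bool)) := by
  apply LinearIndependent.of_comp (MonoidAlgebra.coeffLinearEquiv k).toLinearMap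
  convert Finsupp.linearIndependent_single_one k (FreeMonoid Bool)
  rfl

/-- In the variables `y_j` with `x_i = ∑ p_ij y_j` the relations involve only the squares `y_j²`.
Sending `y_0, y_1, y_2` to `E₁₂, Y E₂₁, Y' E₂₁` with `Y, Y'` free makes all squares zero, while `y_0
y_1` and `y_0 y_2` go to `Y E₁₁` and `Y' E₁₁`. The `2^n` words of length `n` in these two products
stay independent. -/
theorem finrank_grading_of_nilpotents {a b c : k} (hfin : ∀ n, Module.Finite k (grading a b c n))
    {p q : Matrix (Fin 3) (Fin 3) k} (hqp : q * p = 1)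
    (hp : ∀ i j l, j ≠ l → a * (p (i + 1) j * p (i - 1) l) + b * (p (i - 1) j * p (i + 1) l) +
      c * (p i j * p i l) = 0) (n : ℕ) : 2 ^ n ≤ Module.finrank k (grading a b c (2 * n)) := by
  let Y : Bool → WordAlgebra k := fun s => MonoidAlgebra.of k _ (FreeMonoid.of s)
  let N : Fin 3 → Matrix (Fin 2) (Fin 2) (WordAlgebra k) :=
    ![!![0, 1; 0, 0], !![0, 0; Y false, 0], !![0, 0; Y true, 0]]
  have hN : ∀ j, N j * N j = 0 := by
    intro j
    ext r s
    fin_cases j <;> fin_cases r <;> fin_cases s <;> simp [N]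
  let l : (Fin 3 → k) →ₗ[k] Matrix (Fin 2) (Fin 2) (WordAlgebra k) :=
    Fintype.linearCombination k fun i => ∑ j, p i j • N j
  have hl : ∀ i, l (x i) = ∑ j, p i j • N j := by
    intro i
    simp [l, x, Fintype.linearCombination_apply_single]
  obtain ⟨ψ, hψ⟩ := exists_algHom (a := a) (b := b) (c := c) l (by
    intro i
    have : ∀ i i', l (x i) * l (x i') = ∑ j, ∑ m, (p i j * p i' m) • (N j * N m) := by
      intro i i'
      simp only [hl, Finset.sum_mul_sum, smul_mul_smul_comm]
    simp only [this, Finset.smul_sum, ← Finset.sum_add_distrib, smul_smul, ← add_smul]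
    refine Finset.sum_eq_zero fun j _ => Finset.sum_eq_zero fun m _ => ?_
    by_cases hjm : j = m
    · rw [hjm, hN, smul_zero]
    · rw [hp i j m hjm, zero_smul])
  have hq : ∀ j, l (q j) = N j := by
    intro j
    have : l (q j) = ∑ m, (q * p) j m • N m := by
      simp only [l, Fintype.linearCombination_apply, Matrix.mul_apply, Finset.smul_sum,
        Finset.sum_smul, smul_smul]
      exact Finset.sum_comm
    rw [this, hqp]
    simp [Matrix.one_apply]
  let T := TensorAlgebra k (Fin 3 → k)
  let z : Bool → T := fun s => TensorAlgebra.ι k (q 0) *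
    TensorAlgebra.ι k (q (if s then 2 else 1))
  have hz : ∀ L : List Bool, (L.map z).prod ∈
      LinearMap.range (TensorAlgebra.ι k : (Fin 3 → k) →ₗ[k] T) ^ (2 * L.length) := by
    intro L
    induction L with
    | nil => simp
    | cons s L ih =>
      rw [List.map_cons, List.prod_cons, List.length_cons, mul_add, mul_one, add_comm, pow_add, sq]
      exact Submodule.mul_mem_mul (Submodule.mul_mem_mul ⟨_, rfl⟩ ⟨_, rfl⟩) ih
  have hψz : ∀ L : List Bool, ψ (proj a b c (L.map z).prod) 0 0 =
      MonoidAlgebra.of k _ (FreeMonoid.ofList L) := by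
    intro L
    induction L with
    | nil => simp [MonoidAlgebra.one_def]
    | cons s L ih =>
      have e : ψ (proj a b c (z s)) = !![Y s, 0; 0, 0] := by
        rw [hψ, map_mul, TensorAlgebra.lift_ι_apply, TensorAlgebra.lift_ι_apply, hq, hq]
        ext i j
        cases s <;> fin_cases i <;> fin_cases j <;> simp [N]
      rw [List.map_cons, List.prod_cons, map_mul, map_mul, e, Matrix.mul_apply, Fin.sum_univ_two, ih,
        FreeMonoid.ofList_cons, map_mul]
      simp [Y]
  let f : (Fin n → Bool) → grading a b c (2 * n) := fun s =>
    ⟨proj a b c ((List.ofFn s).map z).prod, _, by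
      have := hz (List.ofFn s)
      rwa [List.length_ofFn] at this, rfl⟩
  let ρ : grading a b c (2 * n) →ₗ[k] WordAlgebra k :=
    { toFun := fun y => ψ y.1 0 0
      map_add' := fun y y' => by simp
      map_smul' := fun s y => by simp }
  have hρ : ∀ s, ρ (f s) = MonoidAlgebra.of k _ (FreeMonoid.ofList (List.ofFn s)) :=
    fun s => hψz _
  have hli : LinearIndependent k f := by
    apply LinearIndependent.of_comp ρ
    have hinj : Function.Injective fun s : Fin n → Bool => FreeMonoid.ofList (List.ofFn s) :=
      fun s s' h => List.ofFn_injective (FreeMonoid.ofList.injective h)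
    convert linearIndependent_words.comp _ hinj
    exact funext hρ
  have := hfin (2 * n)
  have := hli.fintype_card_le_finrank
  simpa using this

theorem not_isArtinSchelterRegular_of_nilpotents {a b c : k}
    {p q : Matrix (Fin 3) (Fin 3) k} (hqp : q * p = 1)
    (hp : ∀ i j l, j ≠ l → a * (p (i + 1) j * p (i - 1) l) + b * (p (i - 1) j * p (i + 1) l) +
      c * (p i j * p i l) = 0) : ¬IsArtinSchelterRegular k (grading a b c) := by
  rintro ⟨d, hd⟩
  obtain ⟨C, e, hC⟩ := hd.growth
  obtain ⟨n, hn⟩ := exists_lt_two_pow C e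
  exact absurd ((finrank_grading_of_nilpotents hd.finite hqp hp n).trans (hC (2 * n))) (by omega)

theorem ne_zero_of_isArtinSchelterRegular {a b c : k}
    (h : IsArtinSchelterRegular k (grading a b c)) : ¬(a = 0 ∧ b = 0) := by
  rintro ⟨rfl, rfl⟩
  refine not_isArtinSchelterRegular_of_nilpotents (p := 1) (q := 1) (one_mul 1)
    (fun i j l hjl => ?_) h
  simp only [Matrix.one_apply, zero_mul, zero_add]
  split_ifs with h1 h2
  · exact absurd (h1.symm.trans h2) hjl
  all_goals simp

/-- When `c = ad` with `d³ = 1`, a Fourier change of variables leaves only squares: each mixed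
coefficient is a multiple of a sum `1 + ε + ε²`. The factor `d` in the first row absorbs the choice
of cube root. -/
theorem cube_ne_of_isArtinSchelterRegular [IsAlgClosed k] (h2 : (2 : k) ≠ 0) (h3 : (3 : k) ≠ 0)
    {a c : k} (ha : a ≠ 0) (h : IsArtinSchelterRegular k (grading a a c)) : a ^ 3 ≠ c ^ 3 := by
  intro hac
  obtain ⟨ε, hε⟩ := exists_sq_add_self_add_one h2
  have hε3 := cube_eq_one_of_sq_add_self_add_one hε
  obtain ⟨d, rfl⟩ : ∃ d, c = a * d := ⟨c / a, by field_simp⟩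
  have hd : d ^ 3 = 1 := by
    apply mul_left_cancel₀ (pow_ne_zero 3 ha)
    linear_combination -hac
  let p : Matrix (Fin 3) (Fin 3) k := !![d, d, d; 1, ε, ε ^ 2; 1, ε ^ 2, ε]
  let q : Matrix (Fin 3) (Fin 3) k := (1 / 3 : k) • !![d ^ 2, 1, 1; d ^ 2, ε ^ 2, ε; d ^ 2, ε, ε ^ 2]
  have e : (-1 : Fin 3) = 2 ∧ (1 + 1 : Fin 3) = 2 ∧ (2 + 1 : Fin 3) = 0 ∧ (2 - 1 : Fin 3) = 1 :=
    ⟨rfl, rfl, rfl, rfl⟩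
  refine not_isArtinSchelterRegular_of_nilpotents (p := p) (q := q) ?_ (fun i j l hjl => ?_) h
  · ext i j
    rw [Matrix.mul_apply, Fin.sum_univ_three]
    fin_cases i <;> fin_cases j <;> simp [p, q] <;> field_simp <;> grind
  · fin_cases i <;> fin_cases j <;> fin_cases l <;>
      first | exact absurd rfl hjl | (simp [p, e]; grind)

end Growth

/-! ### The quadratic relations of the algebra. -/

section Relations

/-- The coefficients of the relation `t_i` with respect to the basis `x_j x_l`; at the same time,
the coefficients of the tensor `t` with respect to the basis `x_i x_j x_l`. -/
def relMatrix (a b c : k) : Fin 3 → Matrix (Fin 3) (Fin 3) k :=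
  ![!![c, 0, 0; 0, 0, a; 0, b, 0], !![0, 0, b; 0, c, 0; a, 0, 0], !![0, a, 0; b, 0, 0; 0, 0, c]]

theorem relMatrix_cyclic (a b c : k) (i j l : Fin 3) :
    relMatrix a b c i j l = relMatrix a b c l i j := by
  fin_cases i <;> fin_cases j <;> fin_cases l <;> rfl

theorem relMatrix_self_comm (a c : k) (i j l : Fin 3) :
    relMatrix a a c i j l = relMatrix a a c i l j := by
  fin_cases i <;> fin_cases j <;> fin_cases l <;> rfl

theorem sum_relMatrix_smul {B : Type v} [AddCommGroup B] [Module k B] (a b c : k) (i : Fin 3)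
    (f : Fin 3 → Fin 3 → B) : ∑ j, ∑ l, relMatrix a b c i j l • f j l =
      a • f (i + 1) (i - 1) + b • f (i - 1) (i + 1) + c • f i i := by
  have e : (-1 : Fin 3) = 2 ∧ (1 + 1 : Fin 3) = 2 ∧ (2 + 1 : Fin 3) = 0 ∧ (2 - 1 : Fin 3) = 1 :=
    ⟨rfl, rfl, rfl, rfl⟩
  fin_cases i <;> simp [relMatrix, Fin.sum_univ_three, e] <;> abel

theorem tensorForm_relMatrix {a b c : k} (hc : c ≠ 0) (w : Fin 3 → k) :
    tensorForm (fun i j l => relMatrix a b c i j l) w = c * hesse ((a + b) / c) w := by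
  simp [tensorForm, relMatrix, Fin.sum_univ_three, hesse]
  field_simp
  ring

/-- The element of degree 2 of `Skl_3(a,b,c)` with the given coefficients. -/
def quad (a b c : k) (r : Matrix (Fin 3) (Fin 3) k) : Alg a b c :=
  ∑ j, ∑ l, r j l • (gen a b c (x j) * gen a b c (x l))

theorem quad_relMatrix (a b c : k) (i : Fin 3) : quad a b c (relMatrix a b c i) = 0 := by
  rw [quad, sum_relMatrix_smul a b c i fun j l => gen a b c (x j) * gen a b c (x l)]
  have h : proj a b c (relTensor a b c i) = 0 := by
    rw [proj, RingQuot.mkAlgHom_rel k (show ∃ j, relTensor a b c i = relTensor a b c j ∧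
      (0 : TensorAlgebra k (Fin 3 → k)) = 0 from ⟨i, rfl, rfl⟩), map_zero]
  simp only [relTensor, X, map_add, map_smul, map_mul] at h
  exact h

theorem eq_sum_smul_x (w : Fin 3 → k) : w = ∑ j, w j • x j := by
  ext i
  simp [x, Finset.sum_apply, Pi.single_apply]

theorem sum_smul_mul_mulVec {B : Type v} [Ring B] [Algebra k B] (l : (Fin 3 → k) →ₗ[k] B)
    (M r : Matrix (Fin 3) (Fin 3) k) :
    ∑ i, ∑ j, r i j • (l (M.mulVec (x i)) * l (M.mulVec (x j))) =
      ∑ i, ∑ j, (M * r * M.transpose) i j • (l (x i) * l (x j)) := by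
  have h : ∀ i, l (M.mulVec (x i)) = ∑ p, M p i • l (x p) := by
    intro i
    rw [eq_sum_smul_x (M.mulVec (x i)), map_sum]
    simp only [map_smul]
    simp [x]
  simp only [h, Fin.sum_univ_three, Matrix.mul_apply, Matrix.transpose_apply]
  simp only [add_mul, mul_add, smul_mul_assoc, mul_smul_comm]
  module

/-- The left multiplication by `v` on the truncation of `Skl_3(a,b,c)` to degrees at most 2. -/
def truncatedMul (S : Submodule k (Matrix (Fin 3) (Fin 3) k)) :
    (Fin 3 → k) →ₗ[k]
      Module.End k (k × (Fin 3 → k) × (Matrix (Fin 3) (Fin 3) k ⧸ S)) where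
  toFun v :=
    { toFun := fun p => (0, p.1 • v, S.mkQ (Matrix.vecMulVec v p.2.1))
      map_add' := fun p q => by
        simp [add_smul, Matrix.vecMulVec_add]
      map_smul' := fun s p => by
        simp [mul_smul, Matrix.vecMulVec_smul] }
  map_add' v w := by
    ext <;> simp [Matrix.add_vecMulVec]
  map_smul' s v := by
    ext <;> simp [Matrix.smul_vecMulVec]

theorem truncatedMul_mul_apply (S : Submodule k (Matrix (Fin 3) (Fin 3) k)) (v w : Fin 3 → k)
    (p : k × (Fin 3 → k) × (Matrix (Fin 3) (Fin 3) k ⧸ S)) :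
    (truncatedMul S v * truncatedMul S w) p = (0, 0, p.1 • S.mkQ (Matrix.vecMulVec v w)) := by
  simp [truncatedMul, Matrix.vecMulVec_smul]

theorem sum_smul_truncatedMul (S : Submodule k (Matrix (Fin 3) (Fin 3) k))
    (r : Matrix (Fin 3) (Fin 3) k) (p : k × (Fin 3 → k) × (Matrix (Fin 3) (Fin 3) k ⧸ S)) :
    (∑ j, ∑ l, r j l • (truncatedMul S (x j) * truncatedMul S (x l))) p =
      (0, 0, p.1 • S.mkQ r) := by
  have h : r = ∑ j, ∑ l, r j l • Matrix.vecMulVec (x j) (x l) := by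
    ext i m
    simp [Matrix.sum_apply, Matrix.vecMulVec_apply, x, Pi.single_apply]
  simp only [LinearMap.sum_apply, LinearMap.smul_apply, truncatedMul_mul_apply]
  conv_rhs => rw [h]
  refine Prod.ext ?_ (Prod.ext ?_ ?_)
  · simp [Prod.fst_sum]
  · simp [Prod.fst_sum, Prod.snd_sum]
  · simp only [Prod.snd_sum, Prod.smul_snd, map_sum, map_smul, Finset.smul_sum, smul_comm p.1]

/-- The relations of degree 2 in `Skl_3(a,b,c)` are spanned by the `t_i`. -/
theorem mem_span_of_quad_eq_zero {a b c : k} {r : Matrix (Fin 3) (Fin 3) k}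
    (h : quad a b c r = 0) : r ∈ Submodule.span k (Set.range (relMatrix a b c)) := by
  set S := Submodule.span k (Set.range (relMatrix a b c)) with hS
  -- The algebra acts on `k ⊕ V ⊕ (V ⊗ V) / S`; applying a quadratic element to `1` recovers its
  -- class modulo `S`.
  obtain ⟨ψ, hψ⟩ := exists_algHom (a := a) (b := b) (c := c) (truncatedMul S) (by
    intro i
    rw [← sum_relMatrix_smul a b c i fun j l => truncatedMul S (x j) * truncatedMul S (x l)]
    refine LinearMap.ext fun p => ?_
    have : S.mkQ (relMatrix a b c i) = 0 := by
      rw [Submodule.mkQ_apply, Submodule.Quotient.mk_eq_zero]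
      exact Submodule.subset_span ⟨i, rfl⟩
    rw [sum_smul_truncatedMul, this, smul_zero]
    rfl)
  have hgen : ∀ w, ψ (gen a b c w) = truncatedMul S w := fun w => by
    have := hψ (TensorAlgebra.ι k w)
    rwa [TensorAlgebra.lift_ι_apply] at this
  have h1 := congrArg ψ h
  simp only [quad, map_sum, map_smul, map_mul, hgen, map_zero] at h1
  have h2 := congrArg (fun f => f (1, 0, 0)) h1
  simp only [sum_smul_truncatedMul] at h2
  have h3 : S.mkQ r = 0 := by simpa using h2
  rwa [Submodule.mkQ_apply, Submodule.Quotient.mk_eq_zero] at h3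

end Relations

/-! ### Graded automorphisms preserve the tensor up to a scalar. -/

section Automorphisms

theorem exists_coeffs_of_mem_autGL {a b c : k} {M : GL (Fin 3) k} (hM : M ∈ autGL a b c) :
    ∃ S : Matrix (Fin 3) (Fin 3) k, ∀ i, M.val * relMatrix a b c i * M.val.transpose =
      ∑ m, S i m • relMatrix a b c m := by
  obtain ⟨φ, -, hφ⟩ := hM
  have : ∀ i, ∃ s : Fin 3 → k, ∑ m, s m • relMatrix a b c m =
      M.val * relMatrix a b c i * M.val.transpose := by
    intro i
    rw [← Submodule.mem_span_range_iff_exists_fun]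
    apply mem_span_of_quad_eq_zero
    rw [quad, ← sum_smul_mul_mulVec]
    simp only [← hφ]
    have := congrArg φ (quad_relMatrix a b c i)
    simpa only [quad, map_sum, map_smul, map_mul, map_zero] using this
  choose S hS using this
  exact ⟨S, fun i => (hS i).symm⟩

theorem tensorMap_eq_sum (M : Matrix (Fin 3) (Fin 3) k) (t : Fin 3 → Matrix (Fin 3) (Fin 3) k)
    (p q r : Fin 3) : tensorMap M (fun i j l => t i j l) p q r =
      ∑ i, M p i * (M * t i * M.transpose) q r := by
  simp only [tensorMap, Matrix.mul_apply, Matrix.transpose_apply, Fin.sum_univ_three]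
  ring

theorem tensorMap_cyclic (M : Matrix (Fin 3) (Fin 3) k) {t : Fin 3 → Fin 3 → Fin 3 → k}
    (ht : ∀ i j l, t i j l = t l i j) (p q r : Fin 3) :
    tensorMap M t p q r = tensorMap M t r p q := by
  simp only [tensorMap]
  conv_rhs => rw [Finset.sum_comm]
  refine Finset.sum_congr rfl fun i _ => ?_
  conv_rhs => rw [Finset.sum_comm]
  refine Finset.sum_congr rfl fun j _ => Finset.sum_congr rfl fun l _ => ?_
  rw [ht i j l]
  ring

/-- Since `t = ∑ x_i t_i` and the `t_i` are permuted linearly, the image of `t` is `∑ Q_pm x_p t_m`.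
It is again cyclically invariant, and the resulting linear equations force `Q` to be scalar. -/
theorem tensorMap_eq_smul_of_mem_autGL {a b c : k} (hab : ¬(a = 0 ∧ b = 0))
    (hac : a = b → a ^ 3 ≠ c ^ 3) {M : GL (Fin 3) k} (hM : M ∈ autGL a b c) :
    ∃ ν : k, tensorMap M.val (fun i j l => relMatrix a b c i j l) =
      fun i j l => ν * relMatrix a b c i j l := by
  obtain ⟨S, hS⟩ := exists_coeffs_of_mem_autGL hM
  obtain ⟨Q, hQ⟩ : ∃ Q, Q = M.val * S := ⟨_, rfl⟩
  have h1 : ∀ p q r, tensorMap M.val (fun i j l => relMatrix a b c i j l) p q r =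
      ∑ m, Q p m * relMatrix a b c m q r := by
    intro p q r
    simp only [tensorMap_eq_sum, hS]
    simp only [hQ, Matrix.mul_apply, Matrix.sum_apply, Matrix.smul_apply, smul_eq_mul,
      Fin.sum_univ_three]
    ring
  have h3 : ∀ p q r, ∑ m, Q p m * relMatrix a b c m q r = ∑ m, Q r m * relMatrix a b c m p q :=
    fun p q r => by rw [← h1, tensorMap_cyclic _ (relMatrix_cyclic a b c), h1]
  simp only [Fin.sum_univ_three] at h3
  -- An off-diagonal entry of `Q` is killed by `a - b` if `a ≠ b`. If `a = b`, three such entries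
  -- satisfy a cyclic system with determinant `c³ - a³` up to sign.
  have off : ∀ u₀ u₁ u₂ : k, u₀ * a = u₀ * b → (a = b → u₂ * c = u₀ * a) →
      (a = b → u₀ * c = u₁ * a) → (a = b → u₁ * c = u₂ * a) → u₀ = 0 := by
    intro u₀ u₁ u₂ e0 e1 e2 e3
    by_cases h : a = b
    · have : (c ^ 3 - a ^ 3) * u₀ = 0 := by
        linear_combination c ^ 2 * e2 h + a * c * e3 h + a ^ 2 * e1 h
      exact (mul_eq_zero.mp this).resolve_left fun h' => hac h (sub_eq_zero.mp h').symm
    · exact (mul_eq_zero.mp (show u₀ * (a - b) = 0 by linear_combination e0)).resolve_right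
        (sub_ne_zero.mpr h)
  have d1 : Q 0 0 * a = Q 2 2 * a := by simpa [relMatrix] using h3 0 1 2
  have d2 : Q 1 1 * a = Q 0 0 * a := by simpa [relMatrix] using h3 1 2 0
  have d3 : Q 0 0 * b = Q 1 1 * b := by simpa [relMatrix] using h3 0 2 1
  have d4 : Q 2 2 * b = Q 0 0 * b := by simpa [relMatrix] using h3 2 1 0
  have e1 : Q 0 1 * a = Q 0 1 * b := by simpa [relMatrix] using h3 0 2 0
  have e2 : Q 1 2 * a = Q 1 2 * b := by simpa [relMatrix] using h3 1 0 1
  have e3 : Q 2 0 * a = Q 2 0 * b := by simpa [relMatrix] using h3 2 1 2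
  have e4 : Q 2 0 * c = Q 0 1 * a := by simpa [relMatrix] using h3 2 0 0
  have e5 : Q 0 1 * c = Q 1 2 * a := by simpa [relMatrix] using h3 0 1 1
  have e6 : Q 1 2 * c = Q 2 0 * a := by simpa [relMatrix] using h3 1 2 2
  have f1 : Q 0 2 * a = Q 0 2 * b := by simpa [relMatrix] using (h3 0 1 0).symm
  have f2 : Q 1 0 * a = Q 1 0 * b := by simpa [relMatrix] using (h3 1 2 1).symm
  have f3 : Q 2 1 * a = Q 2 1 * b := by simpa [relMatrix] using (h3 2 0 2).symm
  have f4 : Q 1 0 * c = Q 0 2 * b := by simpa [relMatrix] using h3 1 0 0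
  have f5 : Q 0 2 * c = Q 2 1 * b := by simpa [relMatrix] using h3 0 2 2
  have f6 : Q 2 1 * c = Q 1 0 * b := by simpa [relMatrix] using h3 2 1 1
  have z1 : Q 0 1 = 0 := off _ _ _ e1 (fun _ => e4) (fun _ => e5) fun _ => e6
  have z2 : Q 1 2 = 0 := off _ _ _ e2 (fun _ => e5) (fun _ => e6) fun _ => e4
  have z3 : Q 2 0 = 0 := off _ _ _ e3 (fun _ => e6) (fun _ => e4) fun _ => e5
  have w1 : Q 0 2 = 0 := off _ _ _ f1 (fun h => h ▸ f4) (fun h => h ▸ f5) fun h => h ▸ f6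
  have w2 : Q 1 0 = 0 := off _ _ _ f2 (fun h => h ▸ f6) (fun h => h ▸ f4) fun h => h ▸ f5
  have w3 : Q 2 1 = 0 := off _ _ _ f3 (fun h => h ▸ f5) (fun h => h ▸ f6) fun h => h ▸ f4
  have y1 : Q 1 1 = Q 0 0 := by
    by_cases ha : a = 0
    · exact (mul_right_cancel₀ (fun hb => hab ⟨ha, hb⟩) d3).symm
    · exact mul_right_cancel₀ ha d2
  have y2 : Q 2 2 = Q 0 0 := by
    by_cases ha : a = 0
    · exact mul_right_cancel₀ (fun hb => hab ⟨ha, hb⟩) d4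
    · exact (mul_right_cancel₀ ha d1).symm
  refine ⟨Q 0 0, funext fun p => funext fun q => funext fun r => ?_⟩
  rw [h1, Fin.sum_univ_three]
  fin_cases p <;> simp [z1, z2, z3, w1, w2, w3, y1, y2]

end Automorphisms

/-! ### Building automorphisms from tensor symmetries. -/

section Automorphisms

variable {a b c : k}

theorem quad_sum_smul (s : Fin 3 → k) : quad a b c (∑ m, s m • relMatrix a b c m) = 0 := by
  have h : quad a b c (∑ m, s m • relMatrix a b c m) = ∑ m, s m • quad a b c (relMatrix a b c m) := by
    simp only [quad, Fin.sum_univ_three, Matrix.add_apply, Matrix.smul_apply, smul_eq_mul]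
    module
  rw [h]
  simp only [quad_relMatrix, smul_zero, Finset.sum_const_zero]

theorem exists_algHom_gen {M S : Matrix (Fin 3) (Fin 3) k}
    (h : ∀ i, M * relMatrix a b c i * M.transpose = ∑ m, S i m • relMatrix a b c m) :
    ∃ ψ : Alg a b c →ₐ[k] Alg a b c, ∀ w, ψ (gen a b c w) = gen a b c (M.mulVec w) := by
  obtain ⟨ψ, hψ⟩ := exists_algHom (a := a) (b := b) (c := c) (gen a b c ∘ₗ M.mulVecLin) (by
    intro i
    rw [← sum_relMatrix_smul a b c i fun j l => (gen a b c ∘ₗ M.mulVecLin) (x j) *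
      (gen a b c ∘ₗ M.mulVecLin) (x l)]
    simp only [LinearMap.comp_apply, Matrix.mulVecLin_apply]
    rw [sum_smul_mul_mulVec, h]
    exact quad_sum_smul (S i))
  refine ⟨ψ, fun w => ?_⟩
  have := hψ (TensorAlgebra.ι k w)
  rwa [TensorAlgebra.lift_ι_apply] at this

theorem algHom_eq_id {ψ : Alg a b c →ₐ[k] Alg a b c} (h : ∀ w, ψ (gen a b c w) = gen a b c w) :
    ψ = AlgHom.id k _ := by
  apply RingQuot.ringQuot_ext'
  apply TensorAlgebra.hom_ext
  exact LinearMap.ext h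

theorem grading_eq (n : ℕ) : grading a b c n = LinearMap.range (gen a b c) ^ n := by
  rw [grading, Submodule.map_pow, gen, LinearMap.range_comp]

theorem mem_autGL_of_coeffs {M : GL (Fin 3) k} {S S' : Matrix (Fin 3) (Fin 3) k}
    (h : ∀ i, M.val * relMatrix a b c i * M.val.transpose = ∑ m, S i m • relMatrix a b c m)
    (h' : ∀ i, (M⁻¹).val * relMatrix a b c i * (M⁻¹).val.transpose =
      ∑ m, S' i m • relMatrix a b c m) : M ∈ autGL a b c := by
  obtain ⟨ψ, hψ⟩ := exists_algHom_gen h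
  obtain ⟨ψ', hψ'⟩ := exists_algHom_gen h'
  refine ⟨AlgEquiv.ofAlgHom ψ ψ' (algHom_eq_id fun w => ?_) (algHom_eq_id fun w => ?_),
    fun n => ?_, hψ⟩
  · rw [AlgHom.comp_apply, hψ', hψ, mulVec_inv_mulVec]
  · rw [AlgHom.comp_apply, hψ, hψ', inv_mulVec_mulVec]
  · have : (AlgEquiv.ofAlgHom ψ ψ' (algHom_eq_id fun w => by
        rw [AlgHom.comp_apply, hψ', hψ, mulVec_inv_mulVec]) (algHom_eq_id fun w => by
        rw [AlgHom.comp_apply, hψ, hψ', inv_mulVec_mulVec])).toLinearMap = ψ.toLinearMap := rfl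
    rw [this, grading_eq, Submodule.map_pow]
    congr 1
    apply le_antisymm
    · rintro _ ⟨_, ⟨w, rfl⟩, rfl⟩
      exact ⟨_, (hψ w).symm⟩
    · rintro _ ⟨w, rfl⟩
      refine ⟨_, ⟨(M⁻¹).val.mulVec w, rfl⟩, ?_⟩
      rw [AlgHom.toLinearMap_apply, hψ, mulVec_inv_mulVec]

/-- Undoing `M` in the first tensor factor turns invariance of `t` into a formula for the image of
each `t_i`: coefficient matrix `νM⁻¹` for `M`, and `ν⁻¹M` for its inverse. -/
theorem mem_autGL_of_tensorMap_eq_smul {M : GL (Fin 3) k} {ν : k} (hν : ν ≠ 0)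
    (h : tensorMap M.val (fun i j l => relMatrix a b c i j l) =
      fun i j l => ν * relMatrix a b c i j l) : M ∈ autGL a b c := by
  have h1 : ∀ p, ∑ i, M.val p i • (M.val * relMatrix a b c i * M.val.transpose) =
      ν • relMatrix a b c p := by
    intro p
    ext q r
    have := congrFun (congrFun (congrFun h p) q) r
    rw [tensorMap_eq_sum] at this
    simpa [Matrix.sum_apply] using this
  have hM : ∀ i j, ∑ p, (M⁻¹).val i p * M.val p j = if i = j then 1 else 0 := fun i j => by
    rw [← Matrix.mul_apply, ← Units.val_mul, inv_mul_cancel, Units.val_one, Matrix.one_apply]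
  have h2 : ∀ i, M.val * relMatrix a b c i * M.val.transpose =
      ∑ m, (ν • (M⁻¹).val) i m • relMatrix a b c m := by
    intro i
    have e : ∀ m, (ν • (M⁻¹).val) i m • relMatrix a b c m =
        (M⁻¹).val i m • ∑ j, M.val m j • (M.val * relMatrix a b c j * M.val.transpose) := by
      intro m
      rw [h1, Matrix.smul_apply, smul_smul, smul_eq_mul, mul_comm]
    simp only [e, Finset.smul_sum, smul_smul]
    rw [Finset.sum_comm]
    simp only [← Finset.sum_smul, hM, ite_smul, one_smul, zero_smul, Finset.sum_ite_eq,
      Finset.mem_univ, if_true]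
  refine mem_autGL_of_coeffs h2 (S' := ν⁻¹ • M.val) fun i => ?_
  have hl : (M⁻¹).val * M.val = 1 := by rw [← Units.val_mul, inv_mul_cancel, Units.val_one]
  have hr : M.val.transpose * (M⁻¹).val.transpose = 1 := by
    rw [← Matrix.transpose_mul, hl, Matrix.transpose_one]
  have h3 := congrArg (fun N => (M⁻¹).val * N * (M⁻¹).val.transpose) (h1 i)
  have e : ∀ r : Matrix (Fin 3) (Fin 3) k,
      (M⁻¹).val * (M.val * r * M.val.transpose) * (M⁻¹).val.transpose = r := by
    intro r
    calc _ = ((M⁻¹).val * M.val) * r * (M.val.transpose * (M⁻¹).val.transpose) := by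
          simp only [Matrix.mul_assoc]
      _ = r := by rw [hl, hr, Matrix.one_mul, Matrix.mul_one]
  simp only [Finset.mul_sum, Finset.sum_mul, Matrix.mul_smul, Matrix.smul_mul, e] at h3
  rw [← inv_smul_smul₀ hν ((M⁻¹).val * relMatrix a b c i * (M⁻¹).val.transpose), ← h3,
    Finset.smul_sum]
  simp only [Matrix.smul_apply, smul_smul, smul_eq_mul]

theorem hesse_transpose_of_tensorMap_eq_smul (hc : c ≠ 0) {M : Matrix (Fin 3) (Fin 3) k} {ν : k}
    (h : tensorMap M (fun i j l => relMatrix a b c i j l) =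
      fun i j l => ν * relMatrix a b c i j l) (w : Fin 3 → k) :
    hesse ((a + b) / c) (M.transpose.mulVec w) = ν * hesse ((a + b) / c) w := by
  apply mul_left_cancel₀ hc
  have h1 := tensorForm_mulVec M (fun i j l => relMatrix a b c i j l) w
  rw [tensorForm_relMatrix hc, h] at h1
  rw [h1, mul_left_comm, ← tensorForm_relMatrix hc, tensorForm, tensorForm]
  simp only [Finset.mul_sum, mul_assoc]

/-- The alternating sum of the six coefficients with distinct indices is `3(a - b)` for `t`, and an
operator multiplies it by its determinant. -/
theorem det_eq_of_tensorMap_eq_smul (h3 : (3 : k) ≠ 0) (hab : a ≠ b)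
    {M : Matrix (Fin 3) (Fin 3) k} {ν : k}
    (h : tensorMap M (fun i j l => relMatrix a b c i j l) =
      fun i j l => ν * relMatrix a b c i j l) : M.det = ν := by
  have e : ∀ i j l, tensorMap M (fun i j l => relMatrix a b c i j l) i j l =
      ν * relMatrix a b c i j l := fun i j l => by rw [h]
  have e1 := e 0 1 2
  have e2 := e 1 2 0
  have e3 := e 2 0 1
  have e4 := e 0 2 1
  have e5 := e 2 1 0
  have e6 := e 1 0 2
  simp [tensorMap, relMatrix, Fin.sum_univ_three] at e1 e2 e3 e4 e5 e6
  have h0 : 3 * (a - b) ≠ 0 := mul_ne_zero h3 (sub_ne_zero.mpr hab)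
  apply mul_left_cancel₀ h0
  rw [Matrix.det_fin_three]
  linear_combination e1 + e2 + e3 - e4 - e5 - e6

/-- Cyclic symmetry and one transposition make the tensor fully symmetric; the coefficients of its
form are then its entries times 1, 3 or 6. -/
theorem eq_zero_of_tensorForm_eq_zero (h2 : (2 : k) ≠ 0) (h3 : (3 : k) ≠ 0)
    {t : Fin 3 → Fin 3 → Fin 3 → k} (ht : ∀ i j l, t i j l = t l i j)
    (ht' : ∀ i j l, t i j l = t i l j) (h : ∀ w, tensorForm t w = 0) (i j l : Fin 3) :
    t i j l = 0 := by
  have h6 : (6 : k) ≠ 0 := by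
    have := mul_ne_zero h2 h3
    norm_num at this
    exact this
  obtain ⟨c1, c2, c3, c4, c5, c6, c7, c8, c9, c10⟩ := cubic_coeffs_eq_zero h2
    (a₁ := t 0 0 0) (a₂ := t 1 1 1) (a₃ := t 2 2 2) (a₄ := 3 * t 0 0 1) (a₅ := 3 * t 0 0 2)
    (a₆ := 3 * t 1 1 0) (a₇ := 3 * t 1 1 2) (a₈ := 3 * t 2 2 0) (a₉ := 3 * t 2 2 1)
    (a₁₀ := 6 * t 0 1 2) fun y₀ y₁ y₂ => by
      have e := h ![y₀, y₁, y₂]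
      simp only [tensorForm, Fin.sum_univ_three, Matrix.cons_val] at e
      rw [ht 0 1 0, ht 1 0 0, ht 0 1 0, ht 0 2 0, ht 2 0 0, ht 0 2 0, ht 1 0 1, ht 0 1 1, ht 1 0 1,
        ht 1 2 1, ht 2 1 1, ht 1 2 1, ht 2 0 2, ht 0 2 2, ht 2 0 2, ht 2 1 2, ht 1 2 2, ht 2 1 2,
        ht 1 2 0, ht 2 0 1, ht 1 2 0, ht 1 0 2, ht 2 1 0, ← ht' 0 1 2] at e
      linear_combination e
  replace c4 := (mul_eq_zero.mp c4).resolve_left h3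
  replace c5 := (mul_eq_zero.mp c5).resolve_left h3
  replace c6 := (mul_eq_zero.mp c6).resolve_left h3
  replace c7 := (mul_eq_zero.mp c7).resolve_left h3
  replace c8 := (mul_eq_zero.mp c8).resolve_left h3
  replace c9 := (mul_eq_zero.mp c9).resolve_left h3
  replace c10 := (mul_eq_zero.mp c10).resolve_left h6
  have d1 : t 0 2 1 = 0 := by rw [← ht', c10]
  fin_cases i <;> fin_cases j <;> fin_cases l <;>
    first
    | assumption
    | (refine (ht _ _ _).trans ?_; assumption)
    | (refine (ht _ _ _).trans ((ht _ _ _).trans ?_); assumption)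

theorem tensorMap_comm_right (M : Matrix (Fin 3) (Fin 3) k) {t : Fin 3 → Fin 3 → Fin 3 → k}
    (ht : ∀ i j l, t i j l = t i l j) (p q r : Fin 3) :
    tensorMap M t p q r = tensorMap M t p r q := by
  simp only [tensorMap]
  refine Finset.sum_congr rfl fun i _ => ?_
  rw [Finset.sum_comm]
  refine Finset.sum_congr rfl fun j _ => Finset.sum_congr rfl fun l _ => ?_
  rw [ht i l j]
  ring

theorem tensorMap_eq_smul_of_hesse_transpose (h2 : (2 : k) ≠ 0) (h3 : (3 : k) ≠ 0) (hc : c ≠ 0)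
    {M : Matrix (Fin 3) (Fin 3) k} {ν : k}
    (h : ∀ w, hesse ((a + a) / c) (M.transpose.mulVec w) = ν * hesse ((a + a) / c) w) :
    tensorMap M (fun i j l => relMatrix a a c i j l) = fun i j l => ν * relMatrix a a c i j l := by
  funext p q r
  refine sub_eq_zero.mp (eq_zero_of_tensorForm_eq_zero h2 h3 (t := fun p q r =>
    tensorMap M (fun i j l => relMatrix a a c i j l) p q r - ν * relMatrix a a c p q r)
    (fun i j l => ?_) (fun i j l => ?_) (fun w => ?_) p q r)
  · rw [tensorMap_cyclic M (relMatrix_cyclic a a c), relMatrix_cyclic]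
  · rw [tensorMap_comm_right M (relMatrix_self_comm a c), relMatrix_self_comm]
  · have h1 := tensorForm_mulVec M (fun i j l => relMatrix a a c i j l) w
    have h4 : tensorForm (fun p q r =>
        tensorMap M (fun i j l => relMatrix a a c i j l) p q r - ν * relMatrix a a c p q r) w =
        tensorForm (tensorMap M (fun i j l => relMatrix a a c i j l)) w -
          ν * tensorForm (fun i j l => relMatrix a a c i j l) w := by
      simp only [tensorForm, Finset.mul_sum, ← Finset.sum_sub_distrib, sub_mul, mul_assoc]
    rw [h4, ← h1, tensorForm_relMatrix hc, tensorForm_relMatrix hc, h]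
    ring

theorem translations_le_imageAut (a b c : k) : translations k ≤ imageAut a b c := by
  rw [translations, Subgroup.closure_le]
  rintro _ ⟨M, hM, rfl⟩
  refine ⟨M, mem_autGL_of_tensorMap_eq_smul one_ne_zero ?_, rfl⟩
  funext p q r
  rcases hM with hM | ⟨ε, hε, hM⟩
  · rw [val_eq_cyclic hM]
    fin_cases p <;> fin_cases q <;> fin_cases r <;>
      simp [tensorMap, relMatrix, Fin.sum_univ_three]
  · rw [val_eq_diagonal hM]
    have e1 : ε ^ 3 = 1 := hε.pow_eq_one
    have e2 : ε * ε ^ 2 = 1 := by rw [← e1]; ring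
    have e3 : ε ^ 2 * ε = 1 := by rw [← e1]; ring
    have e4 : ε * ε * ε = 1 := by rw [← e1]; ring
    have e5 : ε ^ 2 * ε ^ 2 * ε ^ 2 = 1 := by
      calc _ = (ε ^ 3) ^ 2 := by ring
        _ = 1 := by rw [e1, one_pow]
    fin_cases p <;> fin_cases q <;> fin_cases r <;>
      simp [tensorMap, relMatrix, Fin.sum_univ_three, e2, e3, e4, e5]

end Automorphisms

/-! ### Passing to the dual space; determination of `G_A`. -/

section Contragredient

theorem contragredient_contragredient (M : GL (Fin 3) k) :
    contragredient (contragredient M) = M := by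
  apply Units.ext
  change M.val.transpose.transpose = M.val
  rw [Matrix.transpose_transpose]

theorem transpose_mulVec_contragredient (M : GL (Fin 3) k) (w : Fin 3 → k) :
    M.val.transpose.mulVec ((contragredient M).val.mulVec w) = w := by
  rw [Matrix.mulVec_mulVec]
  change (M.val.transpose * (M⁻¹).val.transpose).mulVec w = w
  rw [← Matrix.transpose_mul, ← Units.val_mul, inv_mul_cancel, Units.val_one,
    Matrix.transpose_one, Matrix.one_mulVec]

theorem det_contragredient (M : GL (Fin 3) k) :
    (contragredient M).val.det = M.val.det⁻¹ := by
  change (M⁻¹).val.transpose.det = _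
  rw [Matrix.det_transpose]
  refine eq_inv_of_mul_eq_one_left ?_
  rw [← Matrix.det_mul, ← Units.val_mul, inv_mul_cancel, Units.val_one, Matrix.det_one]

variable {a b c : k}

/-- A graded automorphism of `Skl_3(a,b,c)` preserves the cubic form up to a scalar factor. -/
theorem exists_multiplier_of_mem_autGL (hc : c ≠ 0) (hab : ¬(a = 0 ∧ b = 0))
    (hac : a = b → a ^ 3 ≠ c ^ 3) {M : GL (Fin 3) k} (hM : M ∈ autGL a b c) :
    ∃ ν : kˣ, (∀ w, hesse ((a + b) / c) ((contragredient M).val.mulVec w) =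
      ν * hesse ((a + b) / c) w) ∧
      ((3 : k) ≠ 0 → a ≠ b → (contragredient M).val.det = ν) := by
  obtain ⟨ν, hν⟩ := tensorMap_eq_smul_of_mem_autGL hab hac hM
  have h := hesse_transpose_of_tensorMap_eq_smul hc hν
  have h0 : ν ≠ 0 := by
    rintro rfl
    have := h ((contragredient M).val.mulVec (x 0))
    rw [transpose_mulVec_contragredient, hesse_x_zero, zero_mul] at this
    exact one_ne_zero this
  refine ⟨(Units.mk0 ν h0)⁻¹, fun w => ?_, fun h3 h' => ?_⟩
  · rw [Units.val_inv_eq_inv_val, Units.val_mk0, eq_inv_mul_iff_mul_eq₀ h0, ← h,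
      transpose_mulVec_contragredient]
  · rw [det_contragredient, det_eq_of_tensorMap_eq_smul h3 h' hν, Units.val_inv_eq_inv_val,
      Units.val_mk0]

theorem imageAut_le_curveStabilizer [IsAlgClosed k] (h2 : (2 : k) ≠ 0) (h3 : (3 : k) ≠ 0)
    (hc : c ≠ 0) (hμ : 1 + ((a + b) / c) ^ 3 ≠ 0) (hab : ¬(a = 0 ∧ b = 0))
    (hac : a = b → a ^ 3 ≠ c ^ 3) :
    imageAut a b c ≤ curveStabilizer (hesseCurve ((a + b) / c)) := by
  rintro _ ⟨M, hM, rfl⟩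
  obtain ⟨ν, hν, -⟩ := exists_multiplier_of_mem_autGL hc hab hac hM
  exact (mk_mem_curveStabilizer_iff h2 h3 hμ _).mpr ⟨ν, hν⟩

/-- For `a ≠ b` the multiplier of the cubic equals the determinant, so the character is trivial and
its kernel is the translation group. -/
theorem imageAut_eq_translations [IsAlgClosed k] (h2 : (2 : k) ≠ 0) (h3 : (3 : k) ≠ 0)
    (hc : c ≠ 0) (hμ : 1 + ((a + b) / c) ^ 3 ≠ 0) (hab : a ≠ b) :
    imageAut a b c = translations k := by
  refine le_antisymm ?_ (translations_le_imageAut a b c)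
  rintro _ ⟨M, hM, rfl⟩
  obtain ⟨ν, hν, hdet⟩ := exists_multiplier_of_mem_autGL hc (fun h => hab (h.1.trans h.2.symm))
    (fun h => (hab h).elim) hM
  have hN : contragredient M ∈ hesseSimilitudes ((a + b) / c) := ⟨ν, hν⟩
  have key : multiplierChar _ ⟨contragredient M, hN⟩ = 1 := by
    refine (multiplierChar_eq_iff (M := ⟨contragredient M, hN⟩) hν 1).mpr ?_
    rw [Units.val_one, one_mul]
    exact (hdet h3 hab).symm
  exact (mk_mem_translations_iff h2 h3 hμ ⟨contragredient M, hN⟩).mpr key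

theorem imageAut_eq_curveStabilizer [IsAlgClosed k] (h2 : (2 : k) ≠ 0) (h3 : (3 : k) ≠ 0)
    (hc : c ≠ 0) (hμ : 1 + ((a + a) / c) ^ 3 ≠ 0) (ha : a ≠ 0) (hac : a ^ 3 ≠ c ^ 3) :
    imageAut a a c = curveStabilizer (hesseCurve ((a + a) / c)) := by
  refine le_antisymm
    (imageAut_le_curveStabilizer h2 h3 hc hμ (fun h => ha h.1) fun _ => hac) ?_
  rw [curveStabilizer_eq_map h2 h3 hμ]
  rintro _ ⟨M, hM, rfl⟩
  -- The operator on `V` inducing `M` on `V*` is `contragredient M`, whose transpose is `M⁻¹`; the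
  -- tensor `t`, being symmetric here, inherits the invariance of the cubic.
  obtain ⟨ν, h⟩ := (hesseSimilitudes _).inv_mem hM
  refine ⟨contragredient M, ?_, ?_⟩
  · refine mem_autGL_of_tensorMap_eq_smul ν.ne_zero
      (tensorMap_eq_smul_of_hesse_transpose h2 h3 hc fun w => ?_)
    rw [← h]
    rfl
  · change Matrix.ProjGenLinGroup.mk (contragredient (contragredient M)) = _
    rw [contragredient_contragredient]

end Contragredient

/-! ### Special values of `j` and the index of the translation group. -/

section JInvariant

theorem hesseJ_eq_zero_iff (h3 : (3 : k) ≠ 0) {μ : k} (hμ : 1 + μ ^ 3 ≠ 0) :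
    hesseJ μ = 0 ↔ coeffA μ = 0 := by
  have h27 : (-27 : k) ≠ 0 := by
    rw [show (-27 : k) = (-3) ^ 3 by norm_num]
    exact pow_ne_zero _ (neg_ne_zero.mpr h3)
  rw [hesseJ, coeffA, div_eq_zero_iff, or_iff_left (pow_ne_zero 3 hμ), mul_eq_zero,
    or_iff_right h27, pow_eq_zero_iff three_ne_zero, neg_mul, neg_mul, neg_eq_zero, mul_assoc,
    mul_eq_zero (a := (3 : k)), or_iff_right h3]

/-- The numerator of `j - 1728` is `-27` times the square of `B / 2`. -/
theorem hesseJ_eq_1728_iff (h2 : (2 : k) ≠ 0) (h3 : (3 : k) ≠ 0) {μ : k} (hμ : 1 + μ ^ 3 ≠ 0) :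
    hesseJ μ = 1728 ↔ coeffB μ = 0 := by
  have h27 : (-27 : k) ≠ 0 := by
    rw [show (-27 : k) = (-3) ^ 3 by norm_num]
    exact pow_ne_zero _ (neg_ne_zero.mpr h3)
  have e : -27 * (μ * (μ ^ 3 - 8)) ^ 3 - 1728 * (1 + μ ^ 3) ^ 3 =
      -27 * (μ ^ 6 + 20 * μ ^ 3 - 8) ^ 2 := by ring
  rw [hesseJ, div_eq_iff (pow_ne_zero 3 hμ), ← sub_eq_zero, e, mul_eq_zero, or_iff_right h27,
    pow_eq_zero_iff two_ne_zero, coeffB, mul_eq_zero, or_iff_right h2]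

theorem relIndex_translations_of_hesseJ_eq_1728 [IsAlgClosed k] (h2 : (2 : k) ≠ 0)
    (h3 : (3 : k) ≠ 0) {μ : k} (hμ : 1 + μ ^ 3 ≠ 0) (h0 : hesseJ μ ≠ 0) (h : hesseJ μ = 1728) :
    (translations k).relIndex (curveStabilizer (hesseCurve μ)) = 4 := by
  have hA : coeffA μ ≠ 0 := fun e => h0 ((hesseJ_eq_zero_iff h3 hμ).mpr e)
  have hB := (hesseJ_eq_1728_iff h2 h3 hμ).mp h
  rw [relIndex_translations h2 h3 hμ]
  refine nat_card_range_multiplierChar h2 h3 hμ ?_ fun u => ?_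
  · rw [show ((4 : ℕ) : k) = 2 * 2 by norm_num]
    exact mul_ne_zero h2 h2
  · rw [hB, mul_eq_left₀ hA]
    simp

theorem relIndex_translations_of_hesseJ_ne_1728 [IsAlgClosed k] (h2 : (2 : k) ≠ 0)
    (h3 : (3 : k) ≠ 0) {μ : k} (hμ : 1 + μ ^ 3 ≠ 0) (h0 : hesseJ μ ≠ 0) (h : hesseJ μ ≠ 1728) :
    (translations k).relIndex (curveStabilizer (hesseCurve μ)) = 2 := by
  have hA : coeffA μ ≠ 0 := fun e => h0 ((hesseJ_eq_zero_iff h3 hμ).mpr e)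
  have hB : coeffB μ ≠ 0 := fun e => h ((hesseJ_eq_1728_iff h2 h3 hμ).mpr e)
  rw [relIndex_translations h2 h3 hμ]
  refine nat_card_range_multiplierChar h2 h3 hμ (by exact_mod_cast h2) fun u => ?_
  rw [mul_eq_left₀ hA, mul_eq_left₀ hB]
  constructor
  · rintro ⟨h4, h6⟩
    linear_combination h6 - u ^ 2 * h4
  · intro h'
    exact ⟨by linear_combination (u ^ 2 + 1) * h', by linear_combination (u ^ 4 + u ^ 2 + 1) * h'⟩

/-- With `μ = 2a / c`, the zeros `μ = 0` and `μ³ = 8` of `j` are `a = 0` and `a³ = c³`. -/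
theorem hesseJ_ne_zero (h2 : (2 : k) ≠ 0) (h3 : (3 : k) ≠ 0) {a c : k} (hc : c ≠ 0)
    (hμ : 1 + ((a + a) / c) ^ 3 ≠ 0) (ha : a ≠ 0) (hac : a ^ 3 ≠ c ^ 3) :
    hesseJ ((a + a) / c) ≠ 0 := by
  rw [Ne, hesseJ_eq_zero_iff h3 hμ, coeffA]
  have h8 : (8 : k) ≠ 0 := by
    rw [show (8 : k) = 2 ^ 3 by norm_num]
    exact pow_ne_zero _ h2
  refine mul_ne_zero (mul_ne_zero (neg_ne_zero.mpr h3) (div_ne_zero ?_ hc)) fun e => hac ?_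
  · rw [← two_mul]
    exact mul_ne_zero h2 ha
  · apply mul_left_cancel₀ h8
    field_simp at e
    linear_combination e

end JInvariant

end

end Skl

theorem proposition4p1 {k : Type u} [Field k] [IsAlgClosed k]
    (h2 : ringChar k ≠ 2) (h3 : ringChar k ≠ 3) (a b c : k)
    (hreg : IsArtinSchelterRegular k (Skl.grading a b c))
    (hirr : Irreducible (Skl.cubic a b c)) :
    Skl.IsSmoothCubic (Skl.cubic a b c) ∧
    Nat.card (Skl.hessianGroup k) = 216 ∧
    Nat.card (Skl.translations k) = 9 ∧
    Skl.imageAut a b c ≤ Skl.hessianGroup k ∧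
    (a ≠ b → Skl.imageAut a b c = Skl.translations k) ∧
    (a = b →
      Skl.imageAut a b c = Skl.curveStabilizer (Skl.curve (Skl.cubic a b c)) ∧
      Skl.translations k ≤ Skl.imageAut a b c ∧
      ∃ j : k, (∀ j₀ : k, Skl.IsJInvariant (Skl.curve (Skl.cubic a b c)) j₀ ↔ j₀ = j) ∧
        j ≠ 0 ∧
        (j = 1728 → (Skl.translations k).relIndex (Skl.imageAut a b c) = 4) ∧
        (j ≠ 1728 → (Skl.translations k).relIndex (Skl.imageAut a b c) = 2)) := by
  have h2' : (2 : k) ≠ 0 := Ring.two_ne_zero h2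
  have h3' : (3 : k) ≠ 0 := fun e => h3 <| by
    have : ringChar k ∣ 3 := ringChar.dvd (by exact_mod_cast e)
    exact ((Nat.dvd_prime Nat.prime_three).mp this).resolve_left CharP.ringChar_ne_one
  have hc := Skl.ne_zero_of_irreducible_cubic hirr
  have hD := Skl.pow_add_pow_ne_zero_of_irreducible_cubic hirr
  have hμ : 1 + ((a + b) / c) ^ 3 ≠ 0 := by
    intro e
    field_simp at e
    exact hD (by linear_combination e)
  have hab := Skl.ne_zero_of_isArtinSchelterRegular hreg
  -- Polynomial growth excludes exactly the symmetric parameters for which `j` would vanish.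
  have hac : a = b → a ≠ 0 ∧ a ^ 3 ≠ c ^ 3 := by
    rintro rfl
    have ha : a ≠ 0 := fun e => hab ⟨e, e⟩
    exact ⟨ha, Skl.cube_ne_of_isArtinSchelterRegular h2' h3' ha hreg⟩
  rw [Skl.curve_cubic_eq_hesseCurve hc]
  refine ⟨Skl.isSmoothCubic_cubic h3' hc hD, Skl.nat_card_hessianGroup h2' h3',
    Skl.nat_card_translations h2' h3',
    (Skl.imageAut_le_curveStabilizer h2' h3' hc hμ hab fun h => (hac h).2).trans
      (Skl.curveStabilizer_le_hessianGroup h2' h3' hμ),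
    Skl.imageAut_eq_translations h2' h3' hc hμ, ?_⟩
  rintro rfl
  obtain ⟨ha, hac⟩ := hac rfl
  have hj := Skl.hesseJ_ne_zero h2' h3' hc hμ ha hac
  have hG := Skl.imageAut_eq_curveStabilizer h2' h3' hc hμ ha hac
  refine ⟨hG, Skl.translations_le_imageAut a a c, Skl.hesseJ ((a + a) / c),
    Skl.isJInvariant_hesseCurve_iff h2' h3' hμ, hj, fun h => ?_, fun h => ?_⟩
  · rw [hG, Skl.relIndex_translations_of_hesseJ_eq_1728 h2' h3' hμ hj h]
  · rw [hG, Skl.relIndex_translations_of_hesseJ_ne_1728 h2' h3' hμ hj h]
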